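/- Let $f\in H^3(\mathbb R)$ and $\varphi\in H^2(\mathbb R)$ be real-valued (identified with their continuous representatives), and set $$\Omega^\pm=\{(x,y)\in\mathbb R^2:\ y\gtrless f(x)\},\qquad \Gamma=\{(x,f(x)):\ x\in\mathbb R\},\qquad \Xi_\Gamma:\mathbb R\to\Gamma,\ \ \Xi_\Gamma(x)=(x,f(x)).$$ Let $\nu_\Gamma\circ\Xi_\Gamma=(1+f'^2)^{-1/2}(-f',1)$ be the unit normal on $\Gamma$ pointing into $\Omega^+$. For an open set $\Omega\subset\mathbb R^2$ let $\mathrm{UC}^1(\Omega)$ be the set of functions $u\in C^1(\Omega)$ such that $u$ and $\nabla u$ are uniformly continuous in $\Omega$. For $w^\pm$ continuous on $\overline{\Omega^\pm}$ let $[w]=w^+-w^-$ on $\Gamma$; for $U^\pm\in\mathrm{UC}^1(\Omega^\pm)$ the quantities $[U]$ and $[\partial_{\nu_\Gamma}U]$ are formed with the continuous extensions of $U^\pm$ and $\nabla U^\pm$ to $\overline{\Omega^\pm}$. Consider the transmission problem $$\left\{\begin{array}{rcll}\Delta U^\pm&=&0&\text{in }\Omega^\pm,\\ {}[U]&=&0&\text{on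 }\Gamma,\\ {}[\partial_{\nu_\Gamma}U]&=&\big((1+f'^2)^{-1/2}\varphi'\big)\circ\Xi_\Gamma^{-1}&\text{on }\Gamma,\\ \nabla U^\pm&\to&0&\text{for }|(x,y)|\to\infty,\ (x,y)\in\Omega^\pm.\end{array}\right.$$ This problem has a solution $(U^+,U^-)$ with $U^\pm\in C^2(\Omega^\pm)\cap\mathrm{UC}^1(\Omega^\pm)$, namely $U^\pm=U|_{\Omega^\pm}$ with $$U(x,y)=\frac1{2\pi}\int_{\mathbb R}\frac{(x-s)+f'(s)\,(y-f(s))}{(x-s)^2+(y-f(s))^2}\,\varphi(s)\,ds,\qquad (x,y)\in\mathbb R^2\setminus\Gamma,$$ where the integral converges absolutely for every $(x,y)\in\mathbb R^2\setminus\Gamma$. The solution is unique up to an additive constant: a pair $(V^+,V^-)$ with $V^\pm\in C^2(\Omega^\pm)\cap\mathrm{UC}^1(\Omega^\pm)$ solves the problem if and only if there is a single constant $c\in\mathbb R$ with $V^+=U+c$ in $\Omega^+$ and $V^-=U+c$ in $\Omega^-$. -/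

import Mathlib

open MeasureTheory Filter Topology
open scoped SchwartzMap Gradient InnerProductSpace ContDiff

noncomputable section

namespace MullinsSekerka

/-- The Euclidean plane `ℝ²`; a point `p` has coordinates `x = p 0` and `y = p 1`. -/
abbrev Plane : Type := EuclideanSpace ℝ (Fin 2)

/-- The real-valued function `f` belongs to `H^s(ℝ)`: it is square integrable, and the tempered
distribution that it defines belongs to the Sobolev space of order `s` based on `L²`. -/
def MemH (s : ℝ) (f : ℝ → ℝ) : Prop :=
  ∃ hf : MemLp (fun x => (f x : ℂ)) 2 (volume : Measure ℝ),
    TemperedDistribution.MemSobolev s 2 ((hf.toLp (fun x => (f x : ℂ)) : Lp ℂ 2 volume) : 𝓢'(ℝ, ℂ))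

/-- The region above the graph of `f`. -/
def OmegaPlus (f : ℝ → ℝ) : Set Plane := {p | f (p 0) < p 1}

/-- The region below the graph of `f`. -/
def OmegaMinus (f : ℝ → ℝ) : Set Plane := {p | p 1 < f (p 0)}

/-- The parametrization `x ↦ (x, f x)` of the graph of `f`. -/
def Xi (f : ℝ → ℝ) (x : ℝ) : Plane := !₂[x, f x]

/-- The graph `Γ` of `f`. -/
def Gamma (f : ℝ → ℝ) : Set Plane := Set.range (Xi f)

/-- The unit normal to the graph of `f` at `(x, f x)` which points into the region above. -/
def normal (f : ℝ → ℝ) (x : ℝ) : Plane :=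
  (√(1 + deriv f x ^ 2))⁻¹ • !₂[-deriv f x, 1]

/-- At the point `(x, f x)` of the graph, the functions `wp` (on the region above) and `wm` (on the
region below) have one-sided limits, i.e. values of their continuous extensions to the closures,
and the first minus the second is `j`. -/
def HasJump (f : ℝ → ℝ) (wp wm : Plane → ℝ) (x j : ℝ) : Prop :=
  ∃ a b : ℝ, Tendsto wp (𝓝[OmegaPlus f] (Xi f x)) (𝓝 a) ∧
    Tendsto wm (𝓝[OmegaMinus f] (Xi f x)) (𝓝 b) ∧ a - b = j

/-- `u ∈ UC¹(Ω)` for an open set `Ω`: `u` is continuously differentiable in `Ω`, and `u` and its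
first derivatives are uniformly continuous in `Ω`. -/
structure MemUC1 (u : Plane → ℝ) (Ω : Set Plane) : Prop where
  contDiffOn : ContDiffOn ℝ 1 u Ω
  uniformContinuousOn : UniformContinuousOn u Ω
  uniformContinuousOn_gradient : UniformContinuousOn (∇ u) Ω

/-- The pair `(Up, Um)` lies in the class `C² ∩ UC¹` on the two regions and solves the transmission
problem with data `f` and `φ`. Only the values of `Up` above the graph and those of `Um` below the
graph matter. -/
structure IsSolution (f φ : ℝ → ℝ) (Up Um : Plane → ℝ) : Prop where
  contDiffOn_plus : ContDiffOn ℝ 2 Up (OmegaPlus f)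
  contDiffOn_minus : ContDiffOn ℝ 2 Um (OmegaMinus f)
  memUC1_plus : MemUC1 Up (OmegaPlus f)
  memUC1_minus : MemUC1 Um (OmegaMinus f)
  laplacian_plus : ∀ p ∈ OmegaPlus f, Laplacian.laplacian Up p = 0
  laplacian_minus : ∀ p ∈ OmegaMinus f, Laplacian.laplacian Um p = 0
  jump : ∀ x : ℝ, HasJump f Up Um x 0
  jump_normal : ∀ x : ℝ,
    HasJump f (fun p => ⟪∇ Up p, normal f x⟫_ℝ) (fun p => ⟪∇ Um p, normal f x⟫_ℝ) x
      ((√(1 + deriv f x ^ 2))⁻¹ * deriv φ x)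
  gradient_plus : Tendsto (∇ Up) (Bornology.cobounded Plane ⊓ 𝓟 (OmegaPlus f)) (𝓝 0)
  gradient_minus : Tendsto (∇ Um) (Bornology.cobounded Plane ⊓ 𝓟 (OmegaMinus f)) (𝓝 0)

/-- The integrand `(r₁ + f'(s) r₂) / |r|² · φ(s)` of the potential, with
`r = p - (s, f s)`. -/
def potentialIntegrand (f φ : ℝ → ℝ) (p : Plane) (s : ℝ) : ℝ :=
  ((p 0 - s) + deriv f s * (p 1 - f s)) / ((p 0 - s) ^ 2 + (p 1 - f s) ^ 2) * φ s

/-- The potential `U(p) = (1 / 2π) ∫ (r₁ + f'(s) r₂) / |r|² · φ(s) ds` for `p ∉ Γ`. -/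
def potential (f φ : ℝ → ℝ) (p : Plane) : ℝ :=
  1 / (2 * Real.pi) * ∫ s : ℝ, potentialIntegrand f φ p s

end MullinsSekerka

end

/-!
Identify the plane with `ℂ`, write `γ(s) = s + i f(s)` for the parametrization of the graph, and
note that the integrand of the potential is the real part of `φ(s) γ'(s) / (z - γ(s))`. Hence `U =
Re F` for the Cauchy integral `F(z) = (2π)⁻¹ ∫ φ γ' / (z - γ) ds`, which is holomorphic off the
graph, and `∇U` is the complex conjugate of `F'`. Of `f` and `φ` only the following is used: both
have bounded, Hölder continuous first derivatives and are bounded (`HolderC1`), by the Sobolev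
embedding `MemH.exists_holderC1`, and `φ` is square integrable.

*The potential is a solution.* Integration by parts turns `F''` into the integral of `φ' / (z -
γ)²`, and `∫ γ' / (z - γ)² = 0` allows one to subtract from `φ'` a multiple of `γ'` that agrees with
it at a point close to `z`. The Hölder continuity of `φ'` and `γ'` then gives `|F''(z)| ≤ K
d(z)^{-3/4}`, where `d` is the distance to the graph (`exists_norm_cauchy_deriv_le`), so `F'` is
Hölder continuous up to the graph (`exists_holder_cauchy_density`). Away from the graph `F'` tends
to zero at infinity because `φ` is square integrable, and by the uniform Hölder continuity so it
does up to the graph (`tendsto_cauchy_density_two`). The jump conditions are the Plemelj relation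
`tendsto_integral_mul_inv_sub_inv`, applied to `F` and, after one integration by parts, to `F'`: the
jump of `F` is `-iφ`, which is imaginary, and that of `γ' F'` is `-iφ'`, whose real part and
negative imaginary part are `|γ'|` times the tangential and the normal jump of `∇U`.

*Uniqueness.* Let `W` be the difference of two solutions, and `G = ∂ₓW - i ∂ᵧW`, which is
holomorphic off the graph. The boundary values of `W` from the two sides agree, hence so do their
derivatives along the graph, and with them the tangential components of `∇W`
(`IsHarmonicUC1.hasDerivAt_boundary`); the normal components agree by the jump condition. So `G` is
continuous across the graph, bounded, and tends to zero at infinity, and it has to vanish by a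
version of Liouville's theorem, `HolderC1.eq_zero_of_mem_side`: for `z` above and `w` below the
graph, Cauchy's theorem for `(G - G(z)) / ((ζ - z) (ζ - w))` on the region above, for `(G - G(w)) /
((ζ - z) (ζ - w))` on the region below, and the fact that `∫ γ' / ((γ - z) (γ - w)) ≠ 0` imply `G(z)
= G(w)`. Cauchy's theorem on these unbounded regions comes from vertical translates of the graph
(`HolderC1.integral_boundary_mul_eq_zero`). Once `∇W = 0`, the function `W` is constant on each
side, and the two constants agree as `W` has no jump.
-/

noncomputable section

namespace MullinsSekerka

/-! ### The Sobolev embedding -/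

/-- The function `u` is continuously differentiable, `u` and its derivative are bounded by `C`, and
the derivative is Hölder continuous with constant `C` and exponent `1/4`. All that the potential
theory below uses of `f` and `φ`, except that `φ` is square integrable, is this property. The
exponent could be any number in `(0, 1/2)`. -/
structure HolderC1 (C : ℝ) (u : ℝ → ℝ) : Prop where
  nonneg : 0 ≤ C
  abs_le : ∀ x, |u x| ≤ C
  hasDerivAt : ∀ x, HasDerivAt u (deriv u x) x
  abs_deriv_le : ∀ x, |deriv u x| ≤ C
  holder : ∀ x y, |deriv u x - deriv u y| ≤ C * |x - y| ^ (1 / 4 : ℝ)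

theorem HolderC1.continuous {C : ℝ} {u : ℝ → ℝ} (hu : HolderC1 C u) : Continuous u :=
  continuous_iff_continuousAt.2 fun x => (hu.hasDerivAt x).continuousAt

theorem HolderC1.continuous_deriv {C : ℝ} {u : ℝ → ℝ} (hu : HolderC1 C u) :
    Continuous (deriv u) := by
  refine continuous_iff_continuousAt.2 fun x => ?_
  rw [ContinuousAt, tendsto_iff_dist_tendsto_zero]
  have h1 : Continuous fun y : ℝ => C * |y - x| ^ (1 / 4 : ℝ) :=
    continuous_const.mul ((Real.continuous_rpow_const (by norm_num)).comp (by fun_prop))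
  have h2 := h1.tendsto x
  rw [sub_self, abs_zero, Real.zero_rpow (by norm_num), mul_zero] at h2
  exact squeeze_zero (fun y => dist_nonneg) (fun y => hu.holder y x) h2

theorem HolderC1.abs_sub_le {C : ℝ} {u : ℝ → ℝ} (hu : HolderC1 C u) (x y : ℝ) :
    |u x - u y| ≤ C * |x - y| :=
  convex_univ.norm_image_sub_le_of_norm_hasDerivWithin_le
    (fun z _ => (hu.hasDerivAt z).hasDerivWithinAt) (fun z _ => hu.abs_deriv_le z)
    (Set.mem_univ y) (Set.mem_univ x)

theorem memLp_one_add_sq_rpow :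
    MemLp (fun ξ : ℝ => (((1 + ‖ξ‖ ^ 2) ^ (-3 / 8 : ℝ) : ℝ) : ℂ)) 2 (volume : Measure ℝ) := by
  have hc : Continuous (fun ξ : ℝ => (1 + ‖ξ‖ ^ 2) ^ (-3 / 8 : ℝ)) := by
    have : (fun ξ : ℝ => (1 + ‖ξ‖ ^ 2) ^ (-3 / 8 : ℝ)).HasTemperateGrowth := by fun_prop
    exact this.1.continuous
  have h1 : MemLp (fun ξ : ℝ => (1 + ‖ξ‖ ^ 2) ^ (-3 / 8 : ℝ)) 2 (volume : Measure ℝ) := by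
    rw [memLp_two_iff_integrable_sq hc.aestronglyMeasurable]
    have := integrable_rpow_neg_one_add_norm_sq (E := ℝ) (μ := volume) (r := 3 / 2)
      (by simp; norm_num)
    refine this.congr (Eventually.of_forall fun ξ => ?_)
    simp only
    rw [← Real.rpow_mul_natCast (by positivity)]
    congr 1; norm_num
  exact h1.ofReal

/-- A continuous function in `H²(ℝ)` is the inverse Fourier transform of an integrable function
that has `5/4` integrable moments. The exponent `5/4` is any number between `1` and `3/2`. -/
theorem MemH.exists_fourier_density {u : ℝ → ℝ} (hu : Continuous u) (h : MemH 2 u) :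
    ∃ w : ℝ → ℂ, Integrable (fun ξ => (((1 + ‖ξ‖ ^ 2) ^ (5 / 8 : ℝ) : ℝ) : ℂ) * w ξ) ∧
      Integrable w ∧
      ∀ x, (u x : ℂ) = ∫ ξ : ℝ, Complex.exp ((↑(2 * Real.pi * (ξ * x)) * Complex.I)) * w ξ := by
  obtain ⟨hL, hS⟩ := h
  obtain ⟨v, hv⟩ := TemperedDistribution.memSobolev_iff_exists_smulLeftCLM_fourier.mp hS
  have hm : MemLp (fun ξ : ℝ => (((1 + ‖ξ‖ ^ 2) ^ (-1 : ℝ) : ℝ) : ℂ)) 2 (volume : Measure ℝ) := by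
    have hc : Continuous (fun ξ : ℝ => (((1 + ‖ξ‖ ^ 2) ^ (-1 : ℝ) : ℝ) : ℂ)) := by
      have : (fun ξ : ℝ => (1 + ‖ξ‖ ^ 2) ^ (-1 : ℝ)).HasTemperateGrowth := by fun_prop
      exact Complex.continuous_ofReal.comp this.1.continuous
    refine memLp_one_add_sq_rpow.mono hc.aestronglyMeasurable (Eventually.of_forall fun ξ => ?_)
    rw [Complex.norm_real, Complex.norm_real, Real.norm_of_nonneg (Real.rpow_nonneg (by positivity) _),
      Real.norm_of_nonneg (Real.rpow_nonneg (by positivity) _)]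
    have h1 : (1 : ℝ) ≤ 1 + ‖ξ‖ ^ 2 := by nlinarith [sq_nonneg ‖ξ‖]
    exact Real.rpow_le_rpow_of_exponent_le h1 (by norm_num)
  -- the Fourier transform of `u`, with `v = (1 + ξ²) W` square integrable
  set W : Lp ℂ 1 (volume : Measure ℝ) := hm.toLp • v with hW
  have hWv : (W : ℝ → ℂ) =ᵐ[volume] fun ξ => (((1 + ‖ξ‖ ^ 2) ^ (-1 : ℝ) : ℝ) : ℂ) * v ξ := by
    filter_upwards [Lp.coeFn_lpSMul (r := 1) hm.toLp v, hm.coeFn_toLp] with x h1 h2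
    rw [h1, Pi.smul_apply', h2]; rfl
  have hF : FourierTransform.fourier ((hL.toLp (fun x => (u x : ℂ)) : Lp ℂ 2 volume) : 𝓢'(ℝ, ℂ))
      = (W : 𝓢'(ℝ, ℂ)) := by
    rw [hW, MeasureTheory.Lp.toTemperedDistribution_smul_eq (by fun_prop), ← hv,
      TemperedDistribution.smulLeftCLM_smulLeftCLM_apply (by fun_prop) (by fun_prop)]
    convert! (TemperedDistribution.smulLeftCLM_const 1 (FourierTransform.fourier
      ((hL.toLp (fun x => (u x : ℂ)) : Lp ℂ 2 volume) : 𝓢'(ℝ, ℂ)))).symm using 1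
    · simp
    · congr
      ext x
      rw [Pi.mul_apply, ← Complex.ofReal_mul, ← Real.rpow_add (by positivity)]
      norm_num
  have hWi : Integrable W := L1.integrable_coeFn W
  have hcont : Continuous (FourierTransformInv.fourierInv (W : ℝ → ℂ) : ℝ → ℂ) := by
    rw [← Real.Lp.coe_fourierTransformInv]
    exact (Real.Lp.fourierTransformInv W).continuous
  -- `u` agrees almost everywhere with the inverse Fourier transform of `W`, because both define the
  -- same distribution
  have hae : (fun x => (u x : ℂ)) =ᵐ[volume]
      (FourierTransformInv.fourierInv (W : ℝ → ℂ) : ℝ → ℂ) := by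
    refine ae_eq_of_integral_contDiff_smul_eq
      (Complex.continuous_ofReal.comp hu).locallyIntegrable hcont.locallyIntegrable ?_
    intro g hg hgc
    have hg₁ : HasCompactSupport (Complex.ofRealCLM ∘ g) := hgc.comp_left rfl
    have hg₂ : ContDiff ℝ ∞ (Complex.ofRealCLM ∘ g) := by fun_prop
    set G : 𝓢(ℝ, ℂ) := hg₁.toSchwartzMap hg₂
    have hG : ∀ x, G x = (g x : ℂ) := fun x => rfl
    have e1 : ∫ x, g x • (u x : ℂ) =
        ((hL.toLp (fun x => (u x : ℂ)) : Lp ℂ 2 volume) : 𝓢'(ℝ, ℂ)) G := by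
      rw [Lp.toTemperedDistribution_apply]
      refine integral_congr_ae ?_
      filter_upwards [hL.coeFn_toLp] with x hx
      rw [hx, hG]; simp
    have e2 : ((hL.toLp (fun x => (u x : ℂ)) : Lp ℂ 2 volume) : 𝓢'(ℝ, ℂ)) G
        = (W : 𝓢'(ℝ, ℂ)) (FourierTransformInv.fourierInv G) := by
      rw [← hF, TemperedDistribution.fourier_apply]
      congr 1
      exact (FourierTransform.fourier_fourierInv_eq G).symm
    rw [e1, e2, Lp.toTemperedDistribution_apply]
    have e3 := VectorFourier.integral_fourierIntegral_smul_eq_flip (L := -innerₗ ℝ)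
      (μ := volume) (ν := volume) (e := Real.fourierChar) (f := (G : ℝ → ℂ)) (g := (W : ℝ → ℂ))
      Real.continuous_fourierChar (by
        simp only [LinearMap.neg_apply, innerₗ_apply_apply]
        exact continuous_inner.neg) G.integrable hWi
    have e4 : (-innerₗ ℝ : ℝ →ₗ[ℝ] ℝ →ₗ[ℝ] ℝ).flip = -innerₗ ℝ := by
      ext; simp
    rw [e4] at e3
    simp only [hG] at e3
    simp only [SchwartzMap.fourierInv_coe]
    exact e3
  have heq : (fun x => (u x : ℂ)) = (FourierTransformInv.fourierInv (W : ℝ → ℂ) : ℝ → ℂ) :=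
    (Continuous.ae_eq_iff_eq volume (Complex.continuous_ofReal.comp hu) hcont).1 hae
  refine ⟨W, ?_, hWi, fun x => ?_⟩
  · have hi : Integrable (fun ξ : ℝ => (((1 + ‖ξ‖ ^ 2) ^ (-3 / 8 : ℝ) : ℝ) : ℂ) * v ξ) :=
      memLp_one_add_sq_rpow.integrable_mul (Lp.memLp v)
    refine hi.congr ?_
    filter_upwards [hWv] with ξ hξ
    rw [hξ, ← mul_assoc]
    congr 1
    rw [← Complex.ofReal_mul, ← Real.rpow_add (by positivity)]
    norm_num
  · rw [show (u x : ℂ) = (fun x => (u x : ℂ)) x from rfl, heq, Real.fourierInv_eq']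
    simp [mul_comm]

/-- Interpolation between the Lipschitz estimate and the trivial bound. -/
theorem norm_exp_mul_I_sub_exp_mul_I_le (a b : ℝ) :
    ‖Complex.exp (a * Complex.I) - Complex.exp (b * Complex.I)‖ ≤ 2 * |a - b| ^ (1 / 4 : ℝ) := by
  have h1 : Complex.exp (a * Complex.I) - Complex.exp (b * Complex.I) =
      Complex.exp (b * Complex.I) * (Complex.exp (Complex.I * (a - b : ℝ)) - 1) := by
    rw [mul_sub, ← Complex.exp_add, mul_one]
    congr 2
    push_cast; ring
  rw [h1, norm_mul, Complex.norm_exp_ofReal_mul_I, one_mul]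
  rcases le_total |a - b| 1 with h | h
  · calc _ ≤ ‖a - b‖ := Real.norm_exp_I_mul_ofReal_sub_one_le
      _ = |a - b| ^ (1 : ℝ) := by simp
      _ ≤ |a - b| ^ (1 / 4 : ℝ) :=
        Real.rpow_le_rpow_of_exponent_ge_of_imp (abs_nonneg _) h (by norm_num) (by norm_num)
      _ ≤ _ := by linarith [Real.rpow_nonneg (abs_nonneg (a - b)) (1 / 4)]
  · calc _ ≤ ‖Complex.exp (Complex.I * (a - b : ℝ))‖ + ‖(1 : ℂ)‖ := norm_sub_le _ _
      _ = 2 := by rw [mul_comm, Complex.norm_exp_ofReal_mul_I]; norm_num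
      _ ≤ _ := by
        have := Real.one_le_rpow h (show (0 : ℝ) ≤ 1 / 4 by norm_num)
        linarith

/-- The Sobolev embedding of `H²(ℝ)` in `C^{1,1/4}`. -/
theorem MemH.exists_holderC1 {u : ℝ → ℝ} (hu : Continuous u) (h : MemH 2 u) :
    ∃ C : ℝ, HolderC1 C u := by
  obtain ⟨w, hw, hwi, huw⟩ := h.exists_fourier_density hu
  have hwm := hwi.aestronglyMeasurable
  -- `M ξ = (1 + ξ²)^{5/8} |w ξ|` controls all the moments that are used
  set M : ℝ → ℝ := fun ξ => (1 + ‖ξ‖ ^ 2) ^ (5 / 8 : ℝ) * ‖w ξ‖ with hM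
  have hMi : Integrable M := by
    refine hw.norm.congr (Eventually.of_forall fun ξ => ?_)
    simp only [hM, norm_mul, Complex.norm_real]
    rw [Real.norm_of_nonneg (by positivity)]
  have hM0 : ∀ ξ, 0 ≤ M ξ := fun ξ => by positivity
  have hpow : ∀ ξ : ℝ, |ξ| ^ (5 / 4 : ℝ) ≤ (1 + ‖ξ‖ ^ 2) ^ (5 / 8 : ℝ) := fun ξ => by
    calc |ξ| ^ (5 / 4 : ℝ) = (|ξ| ^ 2) ^ (5 / 8 : ℝ) := by
          rw [← Real.rpow_natCast_mul (abs_nonneg _)]; norm_num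
      _ ≤ _ := Real.rpow_le_rpow (by positivity) (by simp) (by norm_num)
  have hone : ∀ ξ : ℝ, 1 ≤ (1 + ‖ξ‖ ^ 2) ^ (5 / 8 : ℝ) := fun ξ =>
    Real.one_le_rpow (by nlinarith [sq_nonneg ‖ξ‖]) (by norm_num)
  have hmid : ∀ ξ : ℝ, |ξ| ≤ (1 + ‖ξ‖ ^ 2) ^ (5 / 8 : ℝ) := fun ξ => by
    rcases le_total |ξ| 1 with h | h
    · exact h.trans (hone ξ)
    · refine le_trans ?_ (hpow ξ)
      conv_lhs => rw [← Real.rpow_one |ξ|]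
      exact Real.rpow_le_rpow_of_exponent_le h (by norm_num)
  set D : ℝ → ℂ := fun x => ∫ ξ : ℝ, Complex.exp (↑(2 * Real.pi * (ξ * x)) * Complex.I) *
    ((2 * Real.pi * ξ : ℝ) * Complex.I * w ξ) with hD
  have hcexp : ∀ x : ℝ,
      Continuous fun ξ : ℝ => Complex.exp (↑(2 * Real.pi * (ξ * x)) * Complex.I) := fun x => by
    fun_prop
  have hcpol : Continuous fun ξ : ℝ => ((2 * Real.pi * ξ : ℝ) : ℂ) * Complex.I := by fun_prop
  have hnorm : ∀ x ξ : ℝ, ‖Complex.exp (↑(2 * Real.pi * (ξ * x)) * Complex.I) *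
    ((2 * Real.pi * ξ : ℝ) * Complex.I * w ξ)‖ = 2 * Real.pi * |ξ| * ‖w ξ‖ := fun x ξ => by
    rw [norm_mul, norm_mul, norm_mul, Complex.norm_exp_ofReal_mul_I, Complex.norm_I,
      Complex.norm_real, Real.norm_eq_abs, abs_mul, abs_of_pos Real.two_pi_pos]
    ring
  have hnormM : ∀ ξ : ℝ, 2 * Real.pi * |ξ| * ‖w ξ‖ ≤ 2 * Real.pi * M ξ := fun ξ => by
    simp only [hM, mul_assoc]
    have := Real.two_pi_pos
    gcongr
    exact hmid ξ
  have hDi : ∀ x : ℝ, Integrable fun ξ : ℝ =>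
      Complex.exp (↑(2 * Real.pi * (ξ * x)) * Complex.I) *
        ((2 * Real.pi * ξ : ℝ) * Complex.I * w ξ) := fun x => by
    refine (hMi.const_mul (2 * Real.pi)).mono'
      ((hcexp x).aestronglyMeasurable.mul (hcpol.aestronglyMeasurable.mul hwm)) ?_
    exact Eventually.of_forall fun ξ => (hnorm x ξ).le.trans (hnormM ξ)
  have hder : ∀ x, HasDerivAt (fun x => (u x : ℂ)) (D x) x := fun x => by
    have := (hasDerivAt_integral_of_dominated_loc_of_deriv_le (μ := volume) (s := Set.univ)
      (x₀ := x) (F := fun x ξ => Complex.exp ((↑(2 * Real.pi * (ξ * x)) * Complex.I)) * w ξ)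
      (F' := fun x ξ => Complex.exp (↑(2 * Real.pi * (ξ * x)) * Complex.I) *
        ((2 * Real.pi * ξ : ℝ) * Complex.I * w ξ)) (bound := fun ξ => 2 * Real.pi * M ξ)
      univ_mem (Eventually.of_forall fun y => (hcexp y).aestronglyMeasurable.mul hwm)
      (hwi.mono ((hcexp x).aestronglyMeasurable.mul hwm) (Eventually.of_forall fun ξ => by
        rw [norm_mul, Complex.norm_exp_ofReal_mul_I, one_mul]))
      (hDi x).aestronglyMeasurable
      (Eventually.of_forall fun ξ y _ => (hnorm y ξ).le.trans (hnormM ξ))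
      (hMi.const_mul _) (Eventually.of_forall fun ξ y _ => ?_)).2
    · simp_rw [huw]; exact this
    · have h1 : HasDerivAt (fun y : ℝ => ((2 * Real.pi * (ξ * y) : ℝ) : ℂ) * Complex.I)
          (((2 * Real.pi * ξ : ℝ) : ℂ) * Complex.I) y := by
        refine HasDerivAt.mul_const ?_ _
        refine HasDerivAt.ofReal_comp ?_
        simpa [mul_assoc] using ((hasDerivAt_id y).const_mul ξ).const_mul (2 * Real.pi)
      have := h1.cexp.mul_const (w ξ)
      simpa only [mul_assoc] using this
  have hder' : ∀ x, HasDerivAt u (D x).re x := fun x => by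
    have := Complex.reCLM.hasFDerivAt.comp_hasDerivAt x (hder x)
    simpa [Function.comp_def] using this
  have hderiv : ∀ x, deriv u x = (D x).re := fun x => (hder' x).deriv
  set I := ∫ ξ, M ξ with hI
  have hI0 : 0 ≤ I := integral_nonneg hM0
  have hpi : (1 : ℝ) ≤ 2 * Real.pi := by linarith [Real.pi_gt_three]
  refine ⟨(2 * Real.pi) * (2 * (2 * Real.pi)) * I, by positivity, fun x => ?_, fun x => ?_,
    fun x => ?_, fun x y => ?_⟩
  · have : |u x| = ‖(u x : ℂ)‖ := by simp
    rw [this, huw]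
    calc _ ≤ ∫ ξ, M ξ := by
          refine norm_integral_le_of_norm_le hMi (Eventually.of_forall fun ξ => ?_)
          rw [norm_mul, Complex.norm_exp_ofReal_mul_I]
          exact mul_le_mul_of_nonneg_right (hone ξ) (norm_nonneg _)
      _ ≤ _ := by rw [← hI]; nlinarith [mul_le_mul hpi hpi (by norm_num) (by linarith)]
  · rw [hderiv]; exact hder' x
  · rw [hderiv]
    calc _ ≤ ‖D x‖ := Complex.abs_re_le_norm _
      _ ≤ ∫ ξ, 2 * Real.pi * M ξ := norm_integral_le_of_norm_le (hMi.const_mul _)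
          (Eventually.of_forall fun ξ => (hnorm x ξ).le.trans (hnormM ξ))
      _ = 2 * Real.pi * I := integral_const_mul _ _
      _ ≤ _ := by
        have : 0 ≤ 2 * Real.pi * I := by positivity
        nlinarith
  · rw [hderiv, hderiv, ← Complex.sub_re]
    have hb : ∀ ξ : ℝ, ‖Complex.exp (↑(2 * Real.pi * (ξ * x)) * Complex.I) *
        ((2 * Real.pi * ξ : ℝ) * Complex.I * w ξ) -
        Complex.exp (↑(2 * Real.pi * (ξ * y)) * Complex.I) *
        ((2 * Real.pi * ξ : ℝ) * Complex.I * w ξ)‖ ≤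
        (2 * Real.pi) * (2 * (2 * Real.pi)) * |x - y| ^ (1 / 4 : ℝ) * M ξ := fun ξ => by
      rw [← sub_mul, norm_mul]
      have h1 : ‖((2 * Real.pi * ξ : ℝ) : ℂ) * Complex.I * w ξ‖ = 2 * Real.pi * |ξ| * ‖w ξ‖ := by
        rw [norm_mul, norm_mul, Complex.norm_I, Complex.norm_real, Real.norm_eq_abs, abs_mul,
          abs_of_pos Real.two_pi_pos, mul_one]
      rw [h1]
      have h2 : |2 * Real.pi * (ξ * x) - 2 * Real.pi * (ξ * y)| ^ (1 / 4 : ℝ) ≤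
          2 * Real.pi * |ξ| ^ (1 / 4 : ℝ) * |x - y| ^ (1 / 4 : ℝ) := by
        rw [show 2 * Real.pi * (ξ * x) - 2 * Real.pi * (ξ * y) = 2 * Real.pi * (ξ * (x - y)) by ring,
          abs_mul (2 * Real.pi), abs_mul ξ, abs_of_pos Real.two_pi_pos, Real.mul_rpow
          Real.two_pi_pos.le (by positivity), Real.mul_rpow (abs_nonneg ξ) (abs_nonneg (x - y)),
          mul_assoc]
        have h4 : (2 * Real.pi) ^ (1 / 4 : ℝ) ≤ 2 * Real.pi :=
          Real.rpow_le_self_of_one_le hpi (by norm_num)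
        gcongr
      have h3 : |ξ| ^ (1 / 4 : ℝ) * |ξ| ≤ (1 + ‖ξ‖ ^ 2) ^ (5 / 8 : ℝ) := by
        refine le_trans (le_of_eq ?_) (hpow ξ)
        rcases eq_or_ne |ξ| 0 with h0 | h0
        · rw [h0]; norm_num
        · rw [← Real.rpow_add_one h0]; norm_num
      calc _ ≤ 2 * (2 * Real.pi * |ξ| ^ (1 / 4 : ℝ) * |x - y| ^ (1 / 4 : ℝ)) *
            (2 * Real.pi * |ξ| * ‖w ξ‖) := by
            have := norm_exp_mul_I_sub_exp_mul_I_le (2 * Real.pi * (ξ * x)) (2 * Real.pi * (ξ * y))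
            gcongr
            exact this.trans (by gcongr)
        _ = (2 * Real.pi) * (2 * (2 * Real.pi)) * |x - y| ^ (1 / 4 : ℝ) *
            ((|ξ| ^ (1 / 4 : ℝ) * |ξ|) * ‖w ξ‖) := by ring
        _ ≤ _ := by
          simp only [hM]
          gcongr
    calc _ ≤ ‖D x - D y‖ := Complex.abs_re_le_norm _
      _ ≤ ∫ ξ, (2 * Real.pi) * (2 * (2 * Real.pi)) * |x - y| ^ (1 / 4 : ℝ) * M ξ := by
          rw [hD]; simp only
          rw [← integral_sub (hDi x) (hDi y)]
          exact norm_integral_le_of_norm_le (hMi.const_mul _) (Eventually.of_forall hb)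
      _ = _ := by rw [integral_const_mul]; ring

/-! ### The graph in the complex plane -/

/-- The parametrization `s ↦ s + i f(s)` of the graph of `f` in the complex plane. -/
def curve (f : ℝ → ℝ) (s : ℝ) : ℂ := ⟨s, f s⟩

/-- The tangent vector `1 + i f'(s)` of the graph of `f`. -/
def tangent (f : ℝ → ℝ) (s : ℝ) : ℂ := ⟨1, deriv f s⟩

/-- The vertical distance from `z` to the graph of `f`, which is comparable to the distance when `f`
is Lipschitz. -/
def vdist (f : ℝ → ℝ) (z : ℂ) : ℝ := |z.im - f z.re|

/-- The integral `∫ h(s) / (z - γ(s))ⁿ ds` along the graph `γ` of `f`. The line element is not part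
of the definition: for a contour integral `h` has to contain the factor `γ'`. -/
def cauchy (f : ℝ → ℝ) (h : ℝ → ℂ) (n : ℕ) (z : ℂ) : ℂ := ∫ s : ℝ, h s / (z - curve f s) ^ n

/-! ### The majorants of the kernels -/

theorem rpow_div_one_add_sq_le (a u : ℝ) (ha : 0 ≤ a) :
    |u| ^ a / (|u| + 1) ^ 2 ≤ (1 + ‖u‖) ^ (-(2 - a)) := by
  have h0 : 0 < 1 + |u| := by positivity
  rw [Real.norm_eq_abs, neg_sub, Real.rpow_sub h0, add_comm |u| 1, Real.rpow_two]
  gcongr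
  linarith [abs_nonneg u]

theorem integrable_rpow_div_one_add_sq {a : ℝ} (ha : 0 ≤ a) (ha1 : a < 1) :
    Integrable fun u : ℝ => |u| ^ a / (|u| + 1) ^ 2 := by
  have h : Integrable (fun u : ℝ => (1 + ‖u‖) ^ (-(2 - a))) :=
    integrable_one_add_norm (by simp; linarith)
  refine h.mono' ?_ (Eventually.of_forall fun u => ?_)
  · have hc : Continuous fun u : ℝ => |u| ^ a / (|u| + 1) ^ 2 :=
      ((Real.continuous_rpow_const ha).comp continuous_abs).div (by fun_prop)
        (fun u => by positivity)
    exact hc.aestronglyMeasurable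
  · rw [Real.norm_of_nonneg (by positivity)]
    exact rpow_div_one_add_sq_le a u ha

/-- The substitution `t = d u`. -/
theorem rpow_div_sq_scale {a d : ℝ} (hd : 0 < d) (t : ℝ) :
    |t| ^ a / (|t| + d) ^ 2 = d ^ (a - 2) * (|d⁻¹ * t| ^ a / (|d⁻¹ * t| + 1) ^ 2) := by
  have h1 : |d⁻¹ * t| = d⁻¹ * |t| := by rw [abs_mul, abs_of_pos (inv_pos.2 hd)]
  have h2 : |t| + d = d * (d⁻¹ * |t| + 1) := by field_simp
  rw [h1, h2, Real.mul_rpow (inv_pos.2 hd).le (abs_nonneg t), mul_pow, Real.rpow_sub hd,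
    Real.inv_rpow hd.le, Real.rpow_two]
  have h3 : d ^ a ≠ 0 := (Real.rpow_pos_of_pos hd a).ne'
  have h4 : d⁻¹ * |t| + 1 ≠ 0 := by positivity
  field_simp

theorem integrable_rpow_div_sq {a d : ℝ} (ha : 0 ≤ a) (ha1 : a < 1) (hd : 0 < d) (x : ℝ) :
    Integrable fun s : ℝ => |x - s| ^ a / (|x - s| + d) ^ 2 := by
  have h : Integrable fun t : ℝ => |t| ^ a / (|t| + d) ^ 2 := by
    simp_rw [rpow_div_sq_scale hd]
    exact ((integrable_rpow_div_one_add_sq ha ha1).comp_mul_left' (inv_ne_zero hd.ne')).const_mul _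
  exact h.comp_sub_left x

theorem integral_rpow_div_sq {a d : ℝ} (hd : 0 < d) (x : ℝ) :
    ∫ s : ℝ, |x - s| ^ a / (|x - s| + d) ^ 2 =
      d ^ (a - 1) * ∫ u : ℝ, |u| ^ a / (|u| + 1) ^ 2 := by
  rw [integral_sub_left_eq_self (fun t : ℝ => |t| ^ a / (|t| + d) ^ 2) volume x]
  simp_rw [rpow_div_sq_scale hd]
  rw [integral_const_mul, Measure.integral_comp_mul_left
    (fun u : ℝ => |u| ^ a / (|u| + 1) ^ 2) d⁻¹, inv_inv, abs_of_pos hd, smul_eq_mul, ← mul_assoc]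
  congr 1
  rw [← Real.rpow_add_one hd.ne']
  congr 1; ring

theorem integrable_inv_sq {d : ℝ} (hd : 0 < d) (x : ℝ) :
    Integrable fun s : ℝ => 1 / (|x - s| + d) ^ 2 := by
  simpa using integrable_rpow_div_sq le_rfl one_pos hd x

theorem integral_inv_sq {d : ℝ} (hd : 0 < d) (x : ℝ) :
    ∫ s : ℝ, 1 / (|x - s| + d) ^ 2 = d⁻¹ * ∫ u : ℝ, 1 / (|u| + 1) ^ 2 := by
  have := integral_rpow_div_sq (a := 0) hd x
  simpa [Real.rpow_neg_one] using this

/-! ### Cauchy integrals along the graph -/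

section Curve

variable {f : ℝ → ℝ} {C : ℝ}

theorem HolderC1.hasDerivAt_curve (hf : HolderC1 C f) (s : ℝ) :
    HasDerivAt (curve f) (tangent f s) s := by
  have h1 : HasDerivAt (fun s : ℝ => (s : ℂ) + (f s : ℂ) * Complex.I)
      (((1 : ℝ) : ℂ) + ((deriv f s : ℝ) : ℂ) * Complex.I) s :=
    (hasDerivAt_id s).ofReal_comp.add ((hf.hasDerivAt s).ofReal_comp.mul_const _)
  convert! h1 using 1
  · ext s; simp [curve, Complex.ext_iff]
  · simp [tangent, Complex.ext_iff]

theorem HolderC1.continuous_curve (hf : HolderC1 C f) : Continuous (curve f) :=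
  continuous_iff_continuousAt.2 fun s => (hf.hasDerivAt_curve s).continuousAt

theorem HolderC1.continuous_tangent (hf : HolderC1 C f) : Continuous (tangent f) := by
  have h : tangent f = fun s => (1 : ℂ) + ((deriv f s : ℝ) : ℂ) * Complex.I := by
    ext s; simp [tangent, Complex.ext_iff]
  rw [h]
  exact continuous_const.add
    ((Complex.continuous_ofReal.comp hf.continuous_deriv).mul continuous_const)

theorem one_le_norm_tangent (f : ℝ → ℝ) (s : ℝ) : 1 ≤ ‖tangent f s‖ := by
  have := Complex.abs_re_le_norm (tangent f s)
  simpa [tangent] using this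

theorem tangent_ne_zero (f : ℝ → ℝ) (s : ℝ) : tangent f s ≠ 0 :=
  norm_pos_iff.1 (one_pos.trans_le (one_le_norm_tangent f s))

theorem HolderC1.norm_tangent_le (hf : HolderC1 C f) (s : ℝ) : ‖tangent f s‖ ≤ 1 + C := by
  refine (Complex.norm_le_abs_re_add_abs_im _).trans ?_
  simp only [tangent, abs_one]
  linarith [hf.abs_deriv_le s]

theorem HolderC1.norm_tangent_sub_le (hf : HolderC1 C f) (s t : ℝ) :
    ‖tangent f s - tangent f t‖ ≤ C * |s - t| ^ (1 / 4 : ℝ) := by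
  refine (Complex.norm_le_abs_re_add_abs_im _).trans ?_
  simp only [tangent, Complex.sub_re, Complex.sub_im, sub_self, abs_zero, zero_add]
  exact hf.holder s t

/-- The distance from `z` to a point `γ(s)` of the graph is comparable to `|x - s|` plus the
vertical distance. -/
theorem HolderC1.le_norm_sub_curve (hf : HolderC1 C f) (z : ℂ) (s : ℝ) :
    |z.re - s| + vdist f z ≤ (2 + C) * ‖z - curve f s‖ := by
  have h1 := Complex.abs_re_le_norm (z - curve f s)
  have h2 := Complex.abs_im_le_norm (z - curve f s)
  simp only [curve, Complex.sub_re, Complex.sub_im] at h1 h2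
  have h3 := hf.abs_sub_le z.re s
  have h4 : vdist f z ≤ |z.im - f s| + |f z.re - f s| := by
    rw [vdist, show z.im - f z.re = (z.im - f s) - (f z.re - f s) by ring]
    exact abs_sub _ _
  have h5 : C * |z.re - s| ≤ C * ‖z - curve f s‖ := mul_le_mul_of_nonneg_left h1 hf.nonneg
  change |z.re - s| + vdist f z ≤ (2 + C) * ‖z - curve f s‖
  simp only [curve] at h5 ⊢
  nlinarith

theorem HolderC1.sub_curve_ne_zero (hf : HolderC1 C f) {z : ℂ} (hz : 0 < vdist f z) (s : ℝ) :
    z - curve f s ≠ 0 := by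
  intro h
  have := hf.le_norm_sub_curve z s
  rw [h, norm_zero, mul_zero] at this
  linarith [abs_nonneg (z.re - s)]

theorem HolderC1.inv_norm_sub_curve_le (hf : HolderC1 C f) {z : ℂ} (hz : 0 < vdist f z) (s : ℝ) :
    ‖z - curve f s‖⁻¹ ≤ (2 + C) / (|z.re - s| + vdist f z) := by
  have h0 := norm_pos_iff.2 (hf.sub_curve_ne_zero hz s)
  have h1 := hf.le_norm_sub_curve z s
  rw [inv_eq_one_div, div_le_div_iff₀ h0 (by positivity)]
  linarith

theorem HolderC1.norm_div_sub_curve_sq_le (hf : HolderC1 C f) {z : ℂ} (hz : 0 < vdist f z)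
    (w : ℂ) (s : ℝ) :
    ‖w / (z - curve f s) ^ 2‖ ≤ (2 + C) ^ 2 * (‖w‖ / (|z.re - s| + vdist f z) ^ 2) := by
  rw [norm_div, norm_pow, div_eq_mul_inv, ← inv_pow]
  have := hf.inv_norm_sub_curve_le hz s
  calc _ ≤ ‖w‖ * ((2 + C) / (|z.re - s| + vdist f z)) ^ 2 := by gcongr
    _ = _ := by rw [div_pow]; ring

theorem HolderC1.aestronglyMeasurable_kernel (hf : HolderC1 C f) {h : ℝ → ℂ}
    (hm : AEStronglyMeasurable h volume) (z : ℂ) (n : ℕ) :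
    AEStronglyMeasurable (fun s => h s / (z - curve f s) ^ n) volume := by
  have : Measurable fun s => (z - curve f s) ^ n :=
    ((continuous_const.sub hf.continuous_curve).pow n).measurable
  exact (hm.aemeasurable.div this.aemeasurable).aestronglyMeasurable

theorem HolderC1.integrable_kernel_sq (hf : HolderC1 C f) {h : ℝ → ℂ}
    (hm : AEStronglyMeasurable h volume) {M : ℝ} (hM : ∀ s, ‖h s‖ ≤ M) {z : ℂ}
    (hz : 0 < vdist f z) : Integrable fun s => h s / (z - curve f s) ^ 2 := by
  refine ((integrable_inv_sq hz z.re).const_mul ((2 + C) ^ 2 * M)).mono'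
    (hf.aestronglyMeasurable_kernel hm z 2) (Eventually.of_forall fun s => ?_)
  refine (hf.norm_div_sub_curve_sq_le hz (h s) s).trans ?_
  rw [mul_assoc, mul_one_div]
  gcongr
  exact hM s

/-- The first power of the kernel is only square integrable, which is the reason for assuming that
`h` is. -/
theorem HolderC1.integrable_kernel_one (hf : HolderC1 C f) {h : ℝ → ℂ} (hm : MemLp h 2 volume)
    {z : ℂ} (hz : 0 < vdist f z) : Integrable fun s => h s / (z - curve f s) ^ 1 := by
  have hk : MemLp (fun s => ((1 : ℂ)) / (z - curve f s) ^ 1) 2 volume := by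
    rw [memLp_two_iff_integrable_sq_norm
      (hf.aestronglyMeasurable_kernel aestronglyMeasurable_const z 1)]
    refine (hf.integrable_kernel_sq (h := fun _ => 1) aestronglyMeasurable_const (M := 1)
      (by simp) hz).norm.congr (Eventually.of_forall fun s => ?_)
    simp
  refine (hm.integrable_mul hk).congr (Eventually.of_forall fun s => ?_)
  simp [div_eq_mul_inv]

theorem HolderC1.hasDerivAt_cauchy (hf : HolderC1 C f) {h : ℝ → ℂ}
    (hm : AEStronglyMeasurable h volume) {M : ℝ} (hM : ∀ s, ‖h s‖ ≤ M) {z : ℂ}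
    (hz : 0 < vdist f z) {n : ℕ} (hn : 1 ≤ n)
    (hi : Integrable fun s => h s / (z - curve f s) ^ n) :
    HasDerivAt (cauchy f h n) (-n * cauchy f h (n + 1) z) z := by
  have hC := hf.nonneg
  have hM0 : 0 ≤ M := (norm_nonneg _).trans (hM 0)
  set d := vdist f z with hd
  have hball : Metric.ball z (d / (2 * (2 + C))) ∈ 𝓝 z := Metric.ball_mem_nhds _ (by positivity)
  have hlow : ∀ w ∈ Metric.ball z (d / (2 * (2 + C))), ∀ s : ℝ,
      (|z.re - s| + d) / (2 * (2 + C)) ≤ ‖w - curve f s‖ := fun w hw s => by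
    have h1 := hf.le_norm_sub_curve z s
    have h2 : ‖z - w‖ < d / (2 * (2 + C)) := by rw [← dist_eq_norm, dist_comm]; exact hw
    have h3 : ‖z - curve f s‖ ≤ ‖z - w‖ + ‖w - curve f s‖ := norm_sub_le_norm_sub_add_norm_sub _ _ _
    rw [div_le_iff₀ (by positivity)]
    rw [lt_div_iff₀ (by positivity)] at h2
    rw [← hd] at h1
    have h4 : (2 + C) * ‖z - curve f s‖ ≤ (2 + C) * (‖z - w‖ + ‖w - curve f s‖) := by gcongr
    nlinarith [abs_nonneg (z.re - s)]
  have hpos : ∀ w ∈ Metric.ball z (d / (2 * (2 + C))), ∀ s : ℝ, 0 < ‖w - curve f s‖ :=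
    fun w hw s => lt_of_lt_of_le (by positivity) (hlow w hw s)
  have key := (hasDerivAt_integral_of_dominated_loc_of_deriv_le (μ := volume) (x₀ := z)
    (F := fun w s => h s / (w - curve f s) ^ n)
    (F' := fun w s => -n * (h s / (w - curve f s) ^ (n + 1)))
    (bound := fun s => n * M * (2 * (2 + C)) ^ (n + 1) / d ^ (n - 1) * (1 / (|z.re - s| + d) ^ 2))
    hball (Eventually.of_forall fun w => hf.aestronglyMeasurable_kernel hm w n) hi
    ((hf.aestronglyMeasurable_kernel hm z (n + 1)).const_mul _)
    (Eventually.of_forall fun s w hw => ?_) ((integrable_inv_sq hz z.re).const_mul _)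
    (Eventually.of_forall fun s w hw => ?_)).2
  · rw [integral_const_mul] at key
    exact key
  · have hp := hpos w hw s
    have hl := hlow w hw s
    have hs : 0 < |z.re - s| + d := by positivity
    rw [norm_mul, norm_neg, Complex.norm_natCast, norm_div, norm_pow]
    calc (n : ℝ) * (‖h s‖ / ‖w - curve f s‖ ^ (n + 1))
        ≤ n * (M / ((|z.re - s| + d) / (2 * (2 + C))) ^ (n + 1)) := by
          gcongr
          exact hM s
      _ = n * M * (2 * (2 + C)) ^ (n + 1) / (|z.re - s| + d) ^ (n + 1) := by
          rw [div_pow]; field_simp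
      _ ≤ n * M * (2 * (2 + C)) ^ (n + 1) / (d ^ (n - 1) * (|z.re - s| + d) ^ 2) := by
          gcongr
          obtain ⟨m, rfl⟩ := Nat.exists_eq_add_of_le hn
          rw [show 1 + m + 1 = (1 + m - 1) + 2 by omega, pow_add]
          gcongr
          linarith [abs_nonneg (z.re - s)]
      _ = _ := by rw [mul_one_div, div_div]
  · have hp := norm_pos_iff.1 (hpos w hw s)
    have h1 : HasDerivAt (fun w : ℂ => (w - curve f s) ^ n)
        (n * (w - curve f s) ^ (n - 1) * 1) w := ((hasDerivAt_id w).sub_const _).pow n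
    have h2 := (h1.inv (pow_ne_zero n hp)).const_mul (h s)
    refine h2.congr_deriv ?_
    obtain ⟨m, rfl⟩ := Nat.exists_eq_add_of_le hn
    simp only [Nat.add_sub_cancel_left, mul_one]
    field_simp
    ring

theorem HolderC1.hasDerivAt_inv_sub_curve (hf : HolderC1 C f) {z : ℂ} (hz : 0 < vdist f z) (s : ℝ) :
    HasDerivAt (fun s => (z - curve f s)⁻¹) (tangent f s / (z - curve f s) ^ 2) s := by
  have := ((hf.hasDerivAt_curve s).const_sub z).inv (hf.sub_curve_ne_zero hz s)
  rw [neg_neg] at this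
  exact this

theorem HolderC1.hasDerivAt_inv_sub_curve_sq (hf : HolderC1 C f) {z : ℂ} (hz : 0 < vdist f z)
    (s : ℝ) : HasDerivAt (fun s => ((z - curve f s) ^ 2)⁻¹)
      (2 * (tangent f s / (z - curve f s) ^ 3)) s := by
  have h0 := hf.sub_curve_ne_zero hz s
  have := (((hf.hasDerivAt_curve s).const_sub z).pow 2).inv (pow_ne_zero 2 h0)
  refine this.congr_deriv ?_
  field_simp
  simp
  ring

theorem HolderC1.tendsto_inv_sub_curve (hf : HolderC1 C f) {z : ℂ} (hz : 0 < vdist f z)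
    {l : Filter ℝ} (hl : Tendsto (fun s => |s|) l atTop) :
    Tendsto (fun s => (z - curve f s)⁻¹) l (𝓝 0) := by
  rw [tendsto_zero_iff_norm_tendsto_zero]
  have h1 : Tendsto (fun s => |z.re - s| + vdist f z) l atTop := by
    refine tendsto_atTop_mono (fun s => ?_) (tendsto_atTop_add_const_right l (-|z.re|) hl)
    have := abs_sub_abs_le_abs_sub s z.re
    rw [abs_sub_comm] at this
    linarith
  refine squeeze_zero (fun _ => norm_nonneg _) (fun s => ?_) (h1.const_div_atTop (2 + C))
  rw [norm_inv]
  exact hf.inv_norm_sub_curve_le hz s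

/-- The kernel `γ' / (z - γ)²` has the antiderivative `1 / (z - γ)`, which vanishes at infinity. -/
theorem HolderC1.integral_tangent_div_sq (hf : HolderC1 C f) {z : ℂ} (hz : 0 < vdist f z) :
    cauchy f (tangent f) 2 z = 0 := by
  have := integral_of_hasDerivAt_of_tendsto (hf.hasDerivAt_inv_sub_curve hz)
    (hf.integrable_kernel_sq hf.continuous_tangent.aestronglyMeasurable hf.norm_tangent_le hz)
    (hf.tendsto_inv_sub_curve hz tendsto_abs_atBot_atTop)
    (hf.tendsto_inv_sub_curve hz tendsto_abs_atTop_atTop)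
  simpa [cauchy] using this

end Curve

/-! ### Hölder continuity up to the boundary -/

/-- A bound `K τ^{-3/4}` of the `τ`-derivative for `τ > 0` gives a Hölder estimate up to `τ = 0`. -/
theorem norm_sub_le_of_norm_deriv_le_rpow {g g' : ℝ → ℂ} {K : ℝ} (hK : 0 ≤ K)
    (hg : ∀ τ, 0 < τ → HasDerivAt g (g' τ) τ) (hb : ∀ τ, 0 < τ → ‖g' τ‖ ≤ K * τ ^ (-3 / 4 : ℝ))
    {a b : ℝ} (ha : 0 < a) (hab : a ≤ b) : ‖g b - g a‖ ≤ 4 * K * (b - a) ^ (1 / 4 : ℝ) := by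
  have key : ‖g b - g a‖ ≤ 4 * K * (b ^ (1 / 4 : ℝ) - a ^ (1 / 4 : ℝ)) := by
    refine image_norm_le_of_norm_deriv_right_le_deriv_boundary' (a := a) (b := b)
      (f := fun t => g t - g a) (f' := g')
      (B := fun t => 4 * K * (t ^ (1 / 4 : ℝ) - a ^ (1 / 4 : ℝ)))
      (B' := fun t => K * t ^ (-3 / 4 : ℝ)) ?_ ?_ ?_ ?_ ?_ ?_ ⟨hab, le_rfl⟩
    · exact fun t ht => ((hg t (ha.trans_le ht.1)).sub_const _).continuousAt.continuousWithinAt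
    · exact fun t ht => ((hg t (ha.trans_le ht.1)).sub_const _).hasDerivWithinAt
    · simp
    · exact (continuous_const.mul ((Real.continuous_rpow_const (by norm_num)).sub
        continuous_const)).continuousOn
    · intro t ht
      have h1 := (((Real.hasDerivAt_rpow_const (p := 1 / 4)
        (Or.inl (ha.trans_le ht.1).ne')).sub_const (a ^ (1 / 4 : ℝ))).const_mul (4 * K))
      refine (h1.congr_deriv ?_).hasDerivWithinAt
      rw [show (1 / 4 - 1 : ℝ) = -3 / 4 by norm_num]; ring
    · exact fun t ht => hb t (ha.trans_le ht.1)
  refine key.trans ?_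
  have h := Real.rpow_add_le_add_rpow (p := 1 / 4) (sub_nonneg.2 hab) ha.le (by norm_num)
    (by norm_num)
  rw [sub_add_cancel] at h
  have : b ^ (1 / 4 : ℝ) - a ^ (1 / 4 : ℝ) ≤ (b - a) ^ (1 / 4 : ℝ) := by linarith
  gcongr

/-- If both partial derivatives of `Φ` are bounded by `K τ^{-3/4}`, then `Φ` is Hölder continuous
with exponent `1/4` on the half plane `τ > 0`: two points at distance `h` are connected by moving
up by `h`, across, and down. -/
theorem holder_of_partial_deriv_le {Φ Φx Φτ : ℝ → ℝ → ℂ} {K : ℝ} (hK : 0 ≤ K)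
    (hx : ∀ x τ, 0 < τ → HasDerivAt (fun x => Φ x τ) (Φx x τ) x)
    (hτ : ∀ x τ, 0 < τ → HasDerivAt (fun τ => Φ x τ) (Φτ x τ) τ)
    (hxb : ∀ x τ, 0 < τ → ‖Φx x τ‖ ≤ K * τ ^ (-3 / 4 : ℝ))
    (hτb : ∀ x τ, 0 < τ → ‖Φτ x τ‖ ≤ K * τ ^ (-3 / 4 : ℝ))
    {x₁ x₂ τ₁ τ₂ : ℝ} (h1 : 0 < τ₁) (h2 : 0 < τ₂) :
    ‖Φ x₁ τ₁ - Φ x₂ τ₂‖ ≤ 13 * K * (|x₁ - x₂| + |τ₁ - τ₂|) ^ (1 / 4 : ℝ) := by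
  set h := |x₁ - x₂| + |τ₁ - τ₂| with hh
  have h0 : 0 ≤ h := by positivity
  rcases h0.eq_or_lt with h0 | h0
  · have e1 : x₁ = x₂ := by
      have := abs_nonneg (τ₁ - τ₂)
      exact sub_eq_zero.1 (abs_eq_zero.1 (le_antisymm (by linarith) (abs_nonneg _)))
    have e2 : τ₁ = τ₂ := by
      have := abs_nonneg (x₁ - x₂)
      exact sub_eq_zero.1 (abs_eq_zero.1 (le_antisymm (by linarith) (abs_nonneg _)))
    rw [e1, e2, sub_self, norm_zero]
    positivity
  have a1 : ‖Φ x₁ (τ₁ + h) - Φ x₁ τ₁‖ ≤ 4 * K * h ^ (1 / 4 : ℝ) := by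
    have := norm_sub_le_of_norm_deriv_le_rpow hK (fun τ => hτ x₁ τ) (fun τ => hτb x₁ τ) h1
      (show τ₁ ≤ τ₁ + h by linarith)
    rwa [add_sub_cancel_left] at this
  have hle : τ₂ ≤ τ₁ + h := by
    have := abs_le.1 (le_refl |τ₁ - τ₂|)
    have := abs_nonneg (x₁ - x₂)
    linarith
  have a2 : ‖Φ x₂ (τ₁ + h) - Φ x₂ τ₂‖ ≤ 8 * K * h ^ (1 / 4 : ℝ) := by
    refine (norm_sub_le_of_norm_deriv_le_rpow hK (fun τ => hτ x₂ τ) (fun τ => hτb x₂ τ) h2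
      hle).trans ?_
    have e1 : (τ₁ + h - τ₂) ^ (1 / 4 : ℝ) ≤ (2 * h) ^ (1 / 4 : ℝ) := by
      refine Real.rpow_le_rpow (by linarith) ?_ (by norm_num)
      have := le_abs_self (τ₁ - τ₂)
      have := abs_nonneg (x₁ - x₂)
      linarith
    have e2 : (2 : ℝ) ^ (1 / 4 : ℝ) ≤ 2 := Real.rpow_le_self_of_one_le (by norm_num) (by norm_num)
    rw [Real.mul_rpow (by norm_num) h0.le] at e1
    have e3 : (2 : ℝ) ^ (1 / 4 : ℝ) * h ^ (1 / 4 : ℝ) ≤ 2 * h ^ (1 / 4 : ℝ) := by gcongr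
    calc _ ≤ 4 * K * (2 * h ^ (1 / 4 : ℝ)) := by gcongr; exact e1.trans e3
      _ = _ := by ring
  have a3 : ‖Φ x₁ (τ₁ + h) - Φ x₂ (τ₁ + h)‖ ≤ K * h ^ (1 / 4 : ℝ) := by
    have e1 : ‖Φ x₁ (τ₁ + h) - Φ x₂ (τ₁ + h)‖ ≤ K * h ^ (-3 / 4 : ℝ) * ‖x₁ - x₂‖ := by
      refine convex_univ.norm_image_sub_le_of_norm_hasDerivWithin_le (f := fun x => Φ x (τ₁ + h))
        (fun z _ => (hx z (τ₁ + h) (by linarith)).hasDerivWithinAt) (fun z _ => ?_)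
        (Set.mem_univ _) (Set.mem_univ _)
      refine (hxb z (τ₁ + h) (by linarith)).trans ?_
      gcongr ?_ * ?_
      exact Real.rpow_le_rpow_of_nonpos h0 (by linarith) (by norm_num)
    refine e1.trans ?_
    have e2 : ‖x₁ - x₂‖ ≤ h := by
      rw [Real.norm_eq_abs]
      linarith [abs_nonneg (τ₁ - τ₂)]
    calc _ ≤ K * h ^ (-3 / 4 : ℝ) * h := by gcongr
      _ = K * h ^ (1 / 4 : ℝ) := by
        rw [mul_assoc, ← Real.rpow_add_one h0.ne']; norm_num
  calc ‖Φ x₁ τ₁ - Φ x₂ τ₂‖ = ‖-(Φ x₁ (τ₁ + h) - Φ x₁ τ₁) + (Φ x₁ (τ₁ + h) - Φ x₂ (τ₁ + h)) +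
        (Φ x₂ (τ₁ + h) - Φ x₂ τ₂)‖ := by congr 1; ring
    _ ≤ ‖-(Φ x₁ (τ₁ + h) - Φ x₁ τ₁)‖ + ‖Φ x₁ (τ₁ + h) - Φ x₂ (τ₁ + h)‖ +
        ‖Φ x₂ (τ₁ + h) - Φ x₂ τ₂‖ := norm_add₃_le
    _ ≤ 4 * K * h ^ (1 / 4 : ℝ) + K * h ^ (1 / 4 : ℝ) + 8 * K * h ^ (1 / 4 : ℝ) := by
        rw [norm_neg]; gcongr
    _ = _ := by ring

/-! ### The two sides of the graph -/

/-- The point at signed vertical distance `σ τ` from the point `γ(x)` of the graph. Here and below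
`σ` is `1` or `-1` and selects one of the two sides, and `(x, τ)` with `τ > 0` are coordinates on
it. -/
def shiftPt (f : ℝ → ℝ) (σ x τ : ℝ) : ℂ := ⟨x, f x + σ * τ⟩

/-- The region above the graph if `σ = 1`, the region below the graph if `σ = -1`. -/
def side (f : ℝ → ℝ) (σ : ℝ) : Set ℂ := {z | 0 < σ * (z.im - f z.re)}

/-- The vertical distance of a point of `side f σ` to the graph, taken negative on the other side.
-/
def height (f : ℝ → ℝ) (σ : ℝ) (z : ℂ) : ℝ := σ * (z.im - f z.re)

variable {f φ : ℝ → ℝ} {C B σ : ℝ}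

theorem vdist_shiftPt (hσ : |σ| = 1) {τ : ℝ} (hτ : 0 ≤ τ) (x : ℝ) :
    vdist f (shiftPt f σ x τ) = τ := by
  simp [vdist, shiftPt, abs_mul, hσ, abs_of_nonneg hτ]

theorem sq_eq_one_of_abs (hσ : |σ| = 1) : σ * σ = 1 := by
  rw [← abs_mul_abs_self, hσ, one_mul]

theorem shiftPt_height (hσ : |σ| = 1) (z : ℂ) : shiftPt f σ z.re (height f σ z) = z := by
  have := sq_eq_one_of_abs hσ
  apply Complex.ext
  · rfl
  · simp only [shiftPt, height]
    rw [← mul_assoc, this]; ring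

theorem shiftPt_mem_side (hσ : |σ| = 1) {τ : ℝ} (hτ : 0 < τ) (x : ℝ) :
    shiftPt f σ x τ ∈ side f σ := by
  simp only [side, shiftPt, Set.mem_ofPred_eq, add_sub_cancel_left]
  rw [← mul_assoc, sq_eq_one_of_abs hσ, one_mul]
  exact hτ

theorem vdist_pos_of_mem_side {z : ℂ} (hz : z ∈ side f σ) : 0 < vdist f z := by
  rw [vdist, abs_pos]
  intro h
  simp [side, h] at hz

theorem shiftPt_eq (x τ : ℝ) : shiftPt f σ x τ = curve f x + (τ : ℂ) * (σ * Complex.I) := by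
  apply Complex.ext <;> simp [shiftPt, curve, mul_comm]

theorem HolderC1.hasDerivAt_shiftPt_left (hf : HolderC1 C f) (x τ : ℝ) :
    HasDerivAt (fun x => shiftPt f σ x τ) (tangent f x) x := by
  simp_rw [shiftPt_eq]
  exact (hf.hasDerivAt_curve x).add_const _

theorem hasDerivAt_shiftPt_right (x τ : ℝ) :
    HasDerivAt (fun τ => shiftPt f σ x τ) (σ * Complex.I) τ := by
  simp_rw [shiftPt_eq]
  simpa using ((hasDerivAt_id τ).ofReal_comp.mul_const ((σ : ℂ) * Complex.I)).const_add (curve f x)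

theorem norm_sigma_mul_I (hσ : |σ| = 1) : ‖(σ : ℂ) * Complex.I‖ = 1 := by
  simp [hσ]

/-- The coordinates `(x, τ)` on a side of the graph are Lipschitz functions of the point. -/
theorem HolderC1.height_sub_le (hf : HolderC1 C f) (hσ : |σ| = 1) (z w : ℂ) :
    |z.re - w.re| + |height f σ z - height f σ w| ≤ (2 + C) * ‖z - w‖ := by
  have h1 := Complex.abs_re_le_norm (z - w)
  have h2 := Complex.abs_im_le_norm (z - w)
  simp only [Complex.sub_re, Complex.sub_im] at h1 h2
  have h3 := hf.abs_sub_le z.re w.re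
  have h4 : C * |z.re - w.re| ≤ C * ‖z - w‖ := mul_le_mul_of_nonneg_left h1 hf.nonneg
  have h5 : |height f σ z - height f σ w| ≤ |z.im - w.im| + |f z.re - f w.re| := by
    rw [height, height, ← mul_sub, abs_mul, hσ, one_mul,
      show z.im - f z.re - (w.im - f w.re) = (z.im - w.im) - (f z.re - f w.re) by ring]
    exact abs_sub _ _
  linarith

theorem HolderC1.isOpen_side (hf : HolderC1 C f) : IsOpen (side f σ) :=
  isOpen_lt continuous_const
    (continuous_const.mul (Complex.continuous_im.sub (hf.continuous.comp Complex.continuous_re)))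

/-! ### The density of the potential -/

/-- The density `φ γ'` of the Cauchy integral whose real part is the potential. -/
def density (f φ : ℝ → ℝ) (s : ℝ) : ℂ := (φ s : ℂ) * tangent f s

theorem norm_density_le (hf : HolderC1 C f) (hφ : HolderC1 B φ) (s : ℝ) :
    ‖density f φ s‖ ≤ B * (1 + C) := by
  rw [density, norm_mul, Complex.norm_real]
  have := hf.nonneg
  exact mul_le_mul (hφ.abs_le s) (hf.norm_tangent_le s) (norm_nonneg _) hφ.nonneg

theorem continuous_density (hf : HolderC1 C f) (hφ : HolderC1 B φ) :
    Continuous (density f φ) :=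
  (Complex.continuous_ofReal.comp hφ.continuous).mul hf.continuous_tangent

theorem continuous_ofReal_deriv (hφ : HolderC1 B φ) :
    Continuous fun s => ((deriv φ s : ℝ) : ℂ) :=
  Complex.continuous_ofReal.comp hφ.continuous_deriv

theorem norm_ofReal_deriv_le (hφ : HolderC1 B φ) (s : ℝ) : ‖((deriv φ s : ℝ) : ℂ)‖ ≤ B := by
  rw [Complex.norm_real]; exact hφ.abs_deriv_le s

theorem HolderC1.integrable_kernel_cube (hf : HolderC1 C f) {h : ℝ → ℂ}
    (hm : AEStronglyMeasurable h volume) {M : ℝ} (hM : ∀ s, ‖h s‖ ≤ M) {z : ℂ}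
    (hz : 0 < vdist f z) : Integrable fun s => h s / (z - curve f s) ^ 3 := by
  refine (hf.integrable_kernel_sq (h := fun s => h s / (z - curve f s) ^ 1)
    (hf.aestronglyMeasurable_kernel hm z 1) (M := M * ((2 + C) / vdist f z)) (fun s => ?_) hz).congr
    (Eventually.of_forall fun s => ?_)
  · rw [pow_one, norm_div, div_eq_mul_inv]
    have h1 := hf.inv_norm_sub_curve_le hz s
    have hC := hf.nonneg
    have h2 : (2 + C) / (|z.re - s| + vdist f z) ≤ (2 + C) / vdist f z := by
      gcongr; linarith [abs_nonneg (z.re - s)]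
    have := hM s
    have hM0 := (norm_nonneg _).trans this
    gcongr
    exact h1.trans h2
  · simp only
    rw [div_div, ← pow_add]

/-- Integration by parts removes one power of the kernel at the price of a derivative of `φ`. -/
theorem cauchy_density_three (hf : HolderC1 C f) (hφ : HolderC1 B φ) {z : ℂ}
    (hz : 0 < vdist f z) :
    2 * cauchy f (density f φ) 3 z = -cauchy f (fun s => ((deriv φ s : ℝ) : ℂ)) 2 z := by
  have h := integral_mul_deriv_eq_deriv_mul_of_integrable (u := fun s => (φ s : ℂ))
    (u' := fun s => ((deriv φ s : ℝ) : ℂ)) (v := fun s => ((z - curve f s) ^ 2)⁻¹)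
    (v' := fun s => 2 * (tangent f s / (z - curve f s) ^ 3))
    (fun s _ => (hφ.hasDerivAt s).ofReal_comp) (fun s _ => hf.hasDerivAt_inv_sub_curve_sq hz s)
    ?_ ?_ ?_
  · rw [cauchy, cauchy, ← integral_const_mul]
    simp only [div_eq_mul_inv] at h ⊢
    rw [← h]
    refine integral_congr_ae (Eventually.of_forall fun s => ?_)
    simp only [density]; ring
  · refine ((hf.integrable_kernel_cube (continuous_density hf hφ).aestronglyMeasurable
      (norm_density_le hf hφ) hz).const_mul 2).congr (Eventually.of_forall fun s => ?_)
    simp only [density, Pi.mul_apply]; ring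
  · refine (hf.integrable_kernel_sq (continuous_ofReal_deriv hφ).aestronglyMeasurable
      (norm_ofReal_deriv_le hφ) hz).congr (Eventually.of_forall fun s => ?_)
    simp only [Pi.mul_apply, div_eq_mul_inv]
  · refine (hf.integrable_kernel_sq (h := fun s => (φ s : ℂ))
      (Complex.continuous_ofReal.comp hφ.continuous).aestronglyMeasurable (M := B)
      (fun s => by rw [Complex.norm_real]; exact hφ.abs_le s) hz).congr
      (Eventually.of_forall fun s => ?_)
    simp only [Pi.mul_apply, div_eq_mul_inv]

/-- The second derivative of the Cauchy integral, after integration by parts. -/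
theorem hasDerivAt_cauchy_density_two (hf : HolderC1 C f) (hφ : HolderC1 B φ) {z : ℂ}
    (hz : 0 < vdist f z) : HasDerivAt (cauchy f (density f φ) 2)
      (cauchy f (fun s => ((deriv φ s : ℝ) : ℂ)) 2 z) z := by
  have hm := (continuous_density hf hφ).aestronglyMeasurable (μ := volume)
  refine (hf.hasDerivAt_cauchy hm (norm_density_le hf hφ) hz (by norm_num)
    (hf.integrable_kernel_sq hm (norm_density_le hf hφ) hz)).congr_deriv ?_
  have := cauchy_density_three hf hφ hz
  push_cast
  linear_combination -this

/-- The second derivative of the Cauchy integral blows up at most like `d^{-3/4}` at distance `d`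
from the graph. As `∫ γ' / (z - γ)² = 0`, one may subtract from the density its value at the nearby
point `γ(x)` and use its Hölder continuity. -/
theorem exists_norm_cauchy_deriv_le (hf : HolderC1 C f) (hφ : HolderC1 B φ) :
    ∃ K, 0 ≤ K ∧ ∀ z, 0 < vdist f z →
      ‖cauchy f (fun s => ((deriv φ s : ℝ) : ℂ)) 2 z‖ ≤ K * vdist f z ^ (-3 / 4 : ℝ) := by
  have hC := hf.nonneg
  have hB := hφ.nonneg
  refine ⟨(2 + C) ^ 2 * (B + B * C) * ∫ u : ℝ, |u| ^ (1 / 4 : ℝ) / (|u| + 1) ^ 2, ?_, ?_⟩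
  · have : 0 ≤ ∫ u : ℝ, |u| ^ (1 / 4 : ℝ) / (|u| + 1) ^ 2 :=
      integral_nonneg fun u => by positivity
    positivity
  intro z hz
  set x := z.re
  set g : ℂ := ((deriv φ x : ℝ) : ℂ) / tangent f x with hg
  have ht := tangent_ne_zero f x
  have e1 : cauchy f (fun s => ((deriv φ s : ℝ) : ℂ)) 2 z =
      ∫ s, (((deriv φ s : ℝ) : ℂ) - g * tangent f s) / (z - curve f s) ^ 2 := by
    have h0 := hf.integral_tangent_div_sq hz
    have h1 := hf.integrable_kernel_sq (continuous_ofReal_deriv hφ).aestronglyMeasurable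
      (norm_ofReal_deriv_le hφ) hz
    have h2 := (hf.integrable_kernel_sq hf.continuous_tangent.aestronglyMeasurable
      hf.norm_tangent_le hz).const_mul g
    simp_rw [sub_div, mul_div_assoc]
    rw [integral_sub h1 h2, integral_const_mul]
    change _ = _ - g * cauchy f (tangent f) 2 z
    rw [h0, mul_zero, sub_zero]; rfl
  have e2 : ∀ s, ‖((deriv φ s : ℝ) : ℂ) - g * tangent f s‖ ≤
      (B + B * C) * |x - s| ^ (1 / 4 : ℝ) := fun s => by
    have : ((deriv φ s : ℝ) : ℂ) - g * tangent f s =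
        ((deriv φ s - deriv φ x : ℝ) : ℂ) + g * (tangent f x - tangent f s) := by
      rw [hg]; push_cast; field_simp; ring
    rw [this]
    have hgB : ‖g‖ ≤ B := by
      rw [hg, norm_div]
      exact (div_le_self (norm_nonneg _) (one_le_norm_tangent f x)).trans
        (norm_ofReal_deriv_le hφ x)
    have h1 := hφ.holder s x
    rw [abs_sub_comm s x] at h1
    have h2 := hf.norm_tangent_sub_le x s
    calc _ ≤ ‖((deriv φ s - deriv φ x : ℝ) : ℂ)‖ + ‖g‖ * ‖tangent f x - tangent f s‖ := by
          rw [← norm_mul]; exact norm_add_le _ _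
      _ ≤ B * |x - s| ^ (1 / 4 : ℝ) + B * (C * |x - s| ^ (1 / 4 : ℝ)) := by
          rw [Complex.norm_real, Real.norm_eq_abs]; gcongr
      _ = _ := by ring
  have hi := integrable_rpow_div_sq (a := 1 / 4) (by norm_num) (by norm_num) hz x
  rw [e1]
  calc _ ≤ ∫ s, (2 + C) ^ 2 * (B + B * C) * (|x - s| ^ (1 / 4 : ℝ) / (|x - s| + vdist f z) ^ 2) := by
        refine norm_integral_le_of_norm_le (hi.const_mul _) (Eventually.of_forall fun s => ?_)
        refine (hf.norm_div_sub_curve_sq_le hz _ s).trans ?_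
        calc _ ≤ (2 + C) ^ 2 * ((B + B * C) * |x - s| ^ (1 / 4 : ℝ) /
              (|x - s| + vdist f z) ^ 2) := by gcongr; exact e2 s
          _ = _ := by ring
    _ = _ := by
        rw [integral_const_mul, integral_rpow_div_sq hz]
        norm_num
        ring

/-- The derivative of the Cauchy integral is Hölder continuous up to the graph, in the coordinates
`(x, τ)`. -/
theorem exists_holder_cauchy_density (hf : HolderC1 C f) (hφ : HolderC1 B φ) :
    ∃ K, 0 ≤ K ∧ ∀ σ : ℝ, |σ| = 1 → ∀ z ∈ side f σ, ∀ w ∈ side f σ,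
      ‖cauchy f (density f φ) 2 z - cauchy f (density f φ) 2 w‖ ≤
        K * (|z.re - w.re| + |height f σ z - height f σ w|) ^ (1 / 4 : ℝ) := by
  obtain ⟨K, hK, hb⟩ := exists_norm_cauchy_deriv_le hf hφ
  have hC := hf.nonneg
  refine ⟨13 * (K * (1 + C)), by positivity, fun σ hσ z hz w hw => ?_⟩
  have hd : ∀ x τ, 0 < τ → HasDerivAt (cauchy f (density f φ) 2)
      (cauchy f (fun s => ((deriv φ s : ℝ) : ℂ)) 2 (shiftPt f σ x τ)) (shiftPt f σ x τ) :=
    fun x τ hτ => hasDerivAt_cauchy_density_two hf hφ (by rwa [vdist_shiftPt hσ hτ.le])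
  have hb' : ∀ x τ, 0 < τ → ‖cauchy f (fun s => ((deriv φ s : ℝ) : ℂ)) 2 (shiftPt f σ x τ)‖ ≤
      K * τ ^ (-3 / 4 : ℝ) := fun x τ hτ => by
    have := hb (shiftPt f σ x τ) (by rwa [vdist_shiftPt hσ hτ.le])
    rwa [vdist_shiftPt hσ hτ.le] at this
  have hx : ∀ x τ, 0 < τ → HasDerivAt (fun x => cauchy f (density f φ) 2 (shiftPt f σ x τ))
      (cauchy f (fun s => ((deriv φ s : ℝ) : ℂ)) 2 (shiftPt f σ x τ) * tangent f x) x :=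
    fun x τ hτ => HasDerivAt.comp (h := fun x => shiftPt f σ x τ) x (hd x τ hτ)
      (hf.hasDerivAt_shiftPt_left x τ)
  have ht : ∀ x τ, 0 < τ → HasDerivAt (fun τ => cauchy f (density f φ) 2 (shiftPt f σ x τ))
      (cauchy f (fun s => ((deriv φ s : ℝ) : ℂ)) 2 (shiftPt f σ x τ) * (σ * Complex.I)) τ :=
    fun x τ hτ => HasDerivAt.comp (h := fun τ => shiftPt f σ x τ) τ (hd x τ hτ)
      (hasDerivAt_shiftPt_right x τ)
  have key := holder_of_partial_deriv_le (K := K * (1 + C)) (by positivity)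
    (Φ := fun x τ => cauchy f (density f φ) 2 (shiftPt f σ x τ))
    hx ht
    (fun x τ hτ => ?_) (fun x τ hτ => ?_) (x₁ := z.re) (x₂ := w.re) hz hw
  · change ‖cauchy f (density f φ) 2 (shiftPt f σ z.re (height f σ z)) -
      cauchy f (density f φ) 2 (shiftPt f σ w.re (height f σ w))‖ ≤ _ at key
    rw [shiftPt_height hσ, shiftPt_height hσ] at key
    exact key
  · rw [norm_mul]
    have h1 := hf.norm_tangent_le x
    calc _ ≤ K * τ ^ (-3 / 4 : ℝ) * (1 + C) := by
          gcongr; exact hb' x τ hτ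
      _ = _ := by ring
  · rw [norm_mul, norm_sigma_mul_I hσ, mul_one]
    refine (hb' x τ hτ).trans ?_
    gcongr
    exact le_mul_of_one_le_right hK (by linarith)

theorem uniformContinuousOn_cauchy_density_two (hf : HolderC1 C f) (hφ : HolderC1 B φ)
    (hσ : |σ| = 1) : UniformContinuousOn (cauchy f (density f φ) 2) (side f σ) := by
  obtain ⟨K, hK, hb⟩ := exists_holder_cauchy_density hf hφ
  have hC := hf.nonneg
  rw [Metric.uniformContinuousOn_iff]
  intro ε hε
  have hc : Tendsto (fun t : ℝ => K * ((2 + C) * t) ^ (1 / 4 : ℝ)) (𝓝 0) (𝓝 0) := by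
    have : Continuous fun t : ℝ => K * ((2 + C) * t) ^ (1 / 4 : ℝ) :=
      continuous_const.mul ((Real.continuous_rpow_const (by norm_num)).comp (by fun_prop))
    have h := this.tendsto 0
    rwa [mul_zero, Real.zero_rpow (by norm_num), mul_zero] at h
  obtain ⟨δ, hδ, hδε⟩ := Metric.eventually_nhds_iff.1 (hc.eventually (gt_mem_nhds hε))
  refine ⟨δ, hδ, fun z hz w hw hzw => ?_⟩
  rw [dist_eq_norm]
  refine (hb σ hσ z hz w hw).trans_lt (lt_of_le_of_lt ?_ (hδε (y := ‖z - w‖) ?_))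
  · gcongr
    exact hf.height_sub_le hσ z w
  · rw [dist_zero_right, norm_norm, ← dist_eq_norm]; exact hzw

/-! ### Boundedness and decay -/

theorem tendsto_norm_sub_const_cobounded (w : ℂ) {l : Filter ℂ} (hl : l ≤ Bornology.cobounded ℂ) :
    Tendsto (fun z : ℂ => ‖z - w‖) l atTop := by
  have h1 : Tendsto (fun z : ℂ => ‖z‖ + -‖w‖) l atTop :=
    tendsto_atTop_add_const_right _ _ (tendsto_norm_cobounded_atTop.mono_left hl)
  refine tendsto_atTop_mono (fun z => ?_) h1
  linarith [norm_sub_norm_le z w]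

/-- Away from the graph the derivative of the Cauchy integral tends to zero at infinity, because `φ`
is square integrable. -/
theorem tendsto_cauchy_density_of_le_vdist (hf : HolderC1 C f) (hφ : HolderC1 B φ)
    (hφ2 : MemLp φ 2 volume) {δ : ℝ} (hδ : 0 < δ) :
    Tendsto (cauchy f (density f φ) 2) (Bornology.cobounded ℂ ⊓ 𝓟 {z | δ ≤ vdist f z}) (𝓝 0) := by
  have hC := hf.nonneg
  set l := Bornology.cobounded ℂ ⊓ 𝓟 {z : ℂ | δ ≤ vdist f z} with hl
  have hmem : ∀ᶠ z in l, δ ≤ vdist f z := mem_inf_of_right (mem_principal_self _)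
  have : (Bornology.cobounded ℂ).IsCountablyGenerated := by
    rw [← comap_norm_atTop]; infer_instance
  have hφi : Integrable fun s => φ s ^ 2 :=
    (memLp_two_iff_integrable_sq hφ2.aestronglyMeasurable).1 hφ2
  have hkm : ∀ z : ℂ, Measurable fun s : ℝ => φ s ^ 2 / (|z.re - s| + vdist f z) ^ 2 := fun z =>
    (hφ.continuous.measurable.pow_const 2).div (by fun_prop)
  have hkb : ∀ z : ℂ, δ ≤ vdist f z → ∀ s : ℝ,
      ‖φ s ^ 2 / (|z.re - s| + vdist f z) ^ 2‖ ≤ φ s ^ 2 / δ ^ 2 := fun z hz s => by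
    rw [Real.norm_of_nonneg (by positivity)]
    gcongr
    linarith [abs_nonneg (z.re - s)]
  have hlim : Tendsto (fun z : ℂ => ∫ s, φ s ^ 2 / (|z.re - s| + vdist f z) ^ 2) l (𝓝 0) := by
    have h := tendsto_integral_filter_of_dominated_convergence (μ := volume) (l := l)
      (F := fun (z : ℂ) s => φ s ^ 2 / (|z.re - s| + vdist f z) ^ 2) (f := fun _ => (0 : ℝ))
      (fun s => φ s ^ 2 / δ ^ 2) (Eventually.of_forall fun z => (hkm z).aestronglyMeasurable)
      (hmem.mono fun z hz => Eventually.of_forall (hkb z hz)) (hφi.div_const _)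
      (Eventually.of_forall fun s => ?_)
    · simpa using h
    · refine Tendsto.const_div_atTop (Tendsto.comp (tendsto_pow_atTop (two_ne_zero)) ?_) _
      refine tendsto_atTop_mono (fun z => ?_) ((tendsto_norm_sub_const_cobounded (curve f s)
        inf_le_left).const_mul_atTop (show 0 < (1 + C)⁻¹ by positivity))
      rw [inv_mul_le_iff₀ (by positivity)]
      refine (Complex.norm_le_abs_re_add_abs_im _).trans ?_
      simp only [curve, Complex.sub_re, Complex.sub_im, vdist]
      have h1 := hf.abs_sub_le z.re s
      have h2 : |z.im - f s| ≤ |z.im - f z.re| + |f z.re - f s| := abs_sub_le _ _ _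
      nlinarith [abs_nonneg (z.im - f z.re), abs_nonneg (z.re - s)]
  set c := ∫ u : ℝ, 1 / (|u| + 1) ^ 2 with hc
  have hc0 : 0 ≤ c := integral_nonneg fun u => by positivity
  -- `2 |φ| ≤ η + η⁻¹ φ²` for every `η > 0` replaces the Cauchy-Schwarz inequality
  have hbound : ∀ η : ℝ, 0 < η → ∀ z : ℂ, δ ≤ vdist f z → ‖cauchy f (density f φ) 2 z‖ ≤
      (2 + C) ^ 2 * (1 + C) * (η * (δ⁻¹ * c) +
        η⁻¹ * ∫ s, φ s ^ 2 / (|z.re - s| + vdist f z) ^ 2) := fun η hη z hz => by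
    have hz0 : 0 < vdist f z := hδ.trans_le hz
    have i1 := (integrable_inv_sq hz0 z.re).const_mul η
    have i2 : Integrable fun s => φ s ^ 2 / (|z.re - s| + vdist f z) ^ 2 :=
      (hφi.div_const (δ ^ 2)).mono' (hkm z).aestronglyMeasurable (Eventually.of_forall (hkb z hz))
    have i2 := i2.const_mul η⁻¹
    calc _ ≤ ∫ s, (2 + C) ^ 2 * (1 + C) * (η * (1 / (|z.re - s| + vdist f z) ^ 2) +
          η⁻¹ * (φ s ^ 2 / (|z.re - s| + vdist f z) ^ 2)) := by
          refine norm_integral_le_of_norm_le ((i1.add i2).const_mul _)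
            (Eventually.of_forall fun s => ?_)
          refine (hf.norm_div_sub_curve_sq_le hz0 _ s).trans ?_
          have e1 : ‖density f φ s‖ ≤ (1 + C) * |φ s| := by
            rw [density, norm_mul, Complex.norm_real, Real.norm_eq_abs, mul_comm]
            gcongr
            exact hf.norm_tangent_le s
          have e2 : |φ s| ≤ η + η⁻¹ * φ s ^ 2 := by
            have h3 : 0 ≤ η⁻¹ * (η - |φ s|) ^ 2 := by positivity
            have h4 : η⁻¹ * (η - |φ s|) ^ 2 = η - 2 * |φ s| + η⁻¹ * φ s ^ 2 := by
              rw [sub_sq, sq_abs]; field_simp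
            linarith [abs_nonneg (φ s)]
          calc _ ≤ (2 + C) ^ 2 * ((1 + C) * (η + η⁻¹ * φ s ^ 2) /
                (|z.re - s| + vdist f z) ^ 2) := by
                gcongr
                exact e1.trans (by gcongr)
            _ = _ := by ring
      _ = (2 + C) ^ 2 * (1 + C) * (η * ((vdist f z)⁻¹ * c) +
        η⁻¹ * ∫ s, φ s ^ 2 / (|z.re - s| + vdist f z) ^ 2) := by
          rw [integral_const_mul, integral_add i1 i2, integral_const_mul, integral_const_mul,
            integral_inv_sq hz0]
      _ ≤ _ := by gcongr
  rw [Metric.tendsto_nhds]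
  intro ε hε
  set A := (2 + C) ^ 2 * (1 + C) with hA
  have hA0 : 0 < A := by positivity
  set η := ε / (2 * A * (δ⁻¹ * c + 1)) with hη
  have hη0 : 0 < η := by positivity
  have h1 : A * (η * (δ⁻¹ * c)) ≤ ε / 2 := by
    have : A * (η * (δ⁻¹ * c + 1)) = ε / 2 := by rw [hη]; field_simp
    rw [← this]; gcongr; linarith
  have h2 : Tendsto (fun z : ℂ => A * (η⁻¹ * ∫ s, φ s ^ 2 / (|z.re - s| + vdist f z) ^ 2)) l
      (𝓝 0) := by
    simpa using (hlim.const_mul η⁻¹).const_mul A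
  filter_upwards [hmem, h2.eventually (gt_mem_nhds (half_pos hε))] with z hz hz2
  rw [dist_zero_right]
  refine (hbound η hη0 z hz).trans_lt ?_
  rw [mul_add]; linarith

theorem exists_norm_cauchy_density_two_le (hf : HolderC1 C f) (hφ : HolderC1 B φ) :
    ∃ M, 0 ≤ M ∧ ∀ z, 0 < vdist f z → ‖cauchy f (density f φ) 2 z‖ ≤ M * (vdist f z)⁻¹ := by
  have hC := hf.nonneg
  have hB := hφ.nonneg
  refine ⟨(2 + C) ^ 2 * (B * (1 + C)) * ∫ u : ℝ, 1 / (|u| + 1) ^ 2, ?_, fun z hz => ?_⟩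
  · have : 0 ≤ ∫ u : ℝ, 1 / (|u| + 1) ^ 2 := integral_nonneg fun u => by positivity
    positivity
  calc _ ≤ ∫ s, (2 + C) ^ 2 * (B * (1 + C)) * (1 / (|z.re - s| + vdist f z) ^ 2) := by
        refine norm_integral_le_of_norm_le ((integrable_inv_sq hz z.re).const_mul _)
          (Eventually.of_forall fun s => ?_)
        refine (hf.norm_div_sub_curve_sq_le hz _ s).trans ?_
        rw [mul_assoc, mul_one_div]
        gcongr
        exact norm_density_le hf hφ s
    _ = _ := by rw [integral_const_mul, integral_inv_sq hz]; ring

theorem re_shiftPt (x τ : ℝ) : (shiftPt f σ x τ).re = x := rfl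

theorem height_shiftPt (hσ : |σ| = 1) (x τ : ℝ) : height f σ (shiftPt f σ x τ) = τ := by
  simp only [height, shiftPt, add_sub_cancel_left]
  rw [← mul_assoc, sq_eq_one_of_abs hσ, one_mul]

/-- The derivative of the Cauchy integral tends to zero at infinity up to the graph: its value at
`z` differs little from that at the point which is moved away from the graph by a small `δ'`. -/
theorem tendsto_cauchy_density_two (hf : HolderC1 C f) (hφ : HolderC1 B φ)
    (hφ2 : MemLp φ 2 volume) (hσ : |σ| = 1) :
    Tendsto (cauchy f (density f φ) 2) (Bornology.cobounded ℂ ⊓ 𝓟 (side f σ)) (𝓝 0) := by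
  obtain ⟨K, hK, hb⟩ := exists_holder_cauchy_density hf hφ
  rw [Metric.tendsto_nhds]
  intro ε hε
  have hc : Tendsto (fun t : ℝ => K * t ^ (1 / 4 : ℝ)) (𝓝 0) (𝓝 0) := by
    have : Continuous fun t : ℝ => K * t ^ (1 / 4 : ℝ) :=
      continuous_const.mul (Real.continuous_rpow_const (by norm_num))
    have h := this.tendsto 0
    rwa [Real.zero_rpow (by norm_num), mul_zero] at h
  obtain ⟨δ, hδ, hδε⟩ := Metric.eventually_nhds_iff.1 (hc.eventually (gt_mem_nhds (half_pos hε)))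
  set δ' := δ / 2
  have hδ' : 0 < δ' := half_pos hδ
  have hKδ : K * δ' ^ (1 / 4 : ℝ) < ε / 2 := hδε (by
    rw [Real.dist_0_eq_abs, abs_of_pos hδ']; exact half_lt_self hδ)
  -- `S` moves a point away from the graph by `δ'`
  set S : ℂ → ℂ := fun z => z + (δ' : ℂ) * (σ * Complex.I) with hS
  have hSeq : ∀ z, S z = shiftPt f σ z.re (height f σ z + δ') := fun z => by
    rw [shiftPt_eq, hS]
    simp only
    nth_rw 1 [← shiftPt_height (f := f) hσ z]
    rw [shiftPt_eq]; push_cast; ring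
  have hSt : Tendsto S (Bornology.cobounded ℂ ⊓ 𝓟 (side f σ))
      (Bornology.cobounded ℂ ⊓ 𝓟 {z | δ' ≤ vdist f z}) := by
    refine tendsto_inf.2 ⟨?_, tendsto_principal.2 ?_⟩
    · rw [← comap_norm_atTop, tendsto_comap_iff, comap_norm_atTop]
      have := tendsto_norm_sub_const_cobounded (-((δ' : ℂ) * (σ * Complex.I)))
        (l := Bornology.cobounded ℂ ⊓ 𝓟 (side f σ)) inf_le_left
      refine this.congr fun z => ?_
      simp [hS]
    · filter_upwards [mem_inf_of_right (mem_principal_self _)] with z hz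
      have hz' : 0 < height f σ z := hz
      rw [hSeq, vdist_shiftPt hσ (by linarith)]
      linarith
  have hT := (tendsto_cauchy_density_of_le_vdist hf hφ hφ2 hδ').comp hSt
  filter_upwards [hT.eventually (Metric.ball_mem_nhds 0 (half_pos hε)),
    mem_inf_of_right (mem_principal_self _)] with z hz1 hz
  have hz' : 0 < height f σ z := hz
  have h1 := hb σ hσ z hz (S z) (by rw [hSeq]; exact shiftPt_mem_side hσ (by linarith) _)
  have h2 : (S z).re = z.re := by rw [hSeq]; rfl
  have h3 : height f σ (S z) = height f σ z + δ' := by rw [hSeq, height_shiftPt hσ]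
  rw [h2, h3, sub_self, abs_zero, zero_add, abs_sub_comm, add_sub_cancel_left,
    abs_of_pos hδ'] at h1
  rw [dist_zero_right]
  have hz2 : ‖cauchy f (density f φ) 2 (S z)‖ < ε / 2 := by simpa using hz1
  calc _ = ‖(cauchy f (density f φ) 2 z - cauchy f (density f φ) 2 (S z)) +
        cauchy f (density f φ) 2 (S z)‖ := by rw [sub_add_cancel]
    _ ≤ _ := norm_add_le _ _
    _ < ε := by linarith

/-- The derivative of the Cauchy integral is bounded: at height at least `1` by the size of the
kernel, and elsewhere by comparison with the point higher up by `1`. -/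
theorem exists_norm_cauchy_density_two_le_const (hf : HolderC1 C f) (hφ : HolderC1 B φ)
    (hσ : |σ| = 1) :
    ∃ M, 0 ≤ M ∧ ∀ z ∈ side f σ, ‖cauchy f (density f φ) 2 z‖ ≤ M := by
  obtain ⟨K, hK, hb⟩ := exists_holder_cauchy_density hf hφ
  obtain ⟨M, hM, hb'⟩ := exists_norm_cauchy_density_two_le hf hφ
  refine ⟨K + M, by positivity, fun z hz => ?_⟩
  have hz' : 0 < height f σ z := hz
  set w := shiftPt f σ z.re (height f σ z + 1)
  have hw : w ∈ side f σ := shiftPt_mem_side hσ (by linarith) _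
  have h1 := hb σ hσ z hz w hw
  rw [height_shiftPt hσ, re_shiftPt, sub_self, abs_zero, zero_add, abs_sub_comm,
    add_sub_cancel_left, abs_one, Real.one_rpow, mul_one] at h1
  have hv : vdist f w = height f σ z + 1 := vdist_shiftPt hσ (by linarith) _
  have h2 := hb' w (by rw [hv]; linarith)
  have h3 : M * (vdist f w)⁻¹ ≤ M := by
    rw [hv]
    exact mul_le_of_le_one_right hM (inv_le_one_of_one_le₀ (by linarith))
  calc _ = ‖(cauchy f (density f φ) 2 z - cauchy f (density f φ) 2 w) +
        cauchy f (density f φ) 2 w‖ := by rw [sub_add_cancel]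
    _ ≤ _ := norm_add_le _ _
    _ ≤ _ := by linarith

theorem memLp_density (hf : HolderC1 C f) (hφ2 : MemLp φ 2 volume) :
    MemLp (density f φ) 2 volume := by
  refine hφ2.of_le_mul (c := 1 + C) ?_ (Eventually.of_forall fun s => ?_)
  · exact (Complex.continuous_ofReal.comp_aestronglyMeasurable hφ2.aestronglyMeasurable).mul
      hf.continuous_tangent.aestronglyMeasurable
  · rw [density, norm_mul, Complex.norm_real, mul_comm]
    gcongr
    exact hf.norm_tangent_le s

theorem hasDerivAt_cauchy_density_one (hf : HolderC1 C f) (hφ : HolderC1 B φ)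
    (hφ2 : MemLp φ 2 volume) {z : ℂ} (hz : 0 < vdist f z) :
    HasDerivAt (cauchy f (density f φ) 1) (-cauchy f (density f φ) 2 z) z := by
  have := hf.hasDerivAt_cauchy (continuous_density hf hφ).aestronglyMeasurable
    (norm_density_le hf hφ) hz le_rfl (hf.integrable_kernel_one (memLp_density hf hφ2) hz)
  simpa using this

/-- The Cauchy integral is Lipschitz continuous on each side, since its derivative is bounded and
points are joined by paths along translates of the graph and vertical segments. -/
theorem uniformContinuousOn_cauchy_density_one (hf : HolderC1 C f) (hφ : HolderC1 B φ)
    (hφ2 : MemLp φ 2 volume) (hσ : |σ| = 1) :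
    UniformContinuousOn (cauchy f (density f φ) 1) (side f σ) := by
  obtain ⟨M, hM, hb⟩ := exists_norm_cauchy_density_two_le_const hf hφ hσ
  have hC := hf.nonneg
  have hd : ∀ x τ, 0 < τ → HasDerivAt (cauchy f (density f φ) 1)
      (-cauchy f (density f φ) 2 (shiftPt f σ x τ)) (shiftPt f σ x τ) := fun x τ hτ =>
    hasDerivAt_cauchy_density_one hf hφ hφ2 (by rwa [vdist_shiftPt hσ hτ.le])
  have hlip : ∀ z ∈ side f σ, ∀ w ∈ side f σ, ‖cauchy f (density f φ) 1 z -
      cauchy f (density f φ) 1 w‖ ≤ M * (1 + C) * ((2 + C) * ‖z - w‖) := fun z hz w hw => by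
    have hz' : 0 < height f σ z := hz
    have hw' : 0 < height f σ w := hw
    have h1 : ‖cauchy f (density f φ) 1 (shiftPt f σ z.re (height f σ z)) -
        cauchy f (density f φ) 1 (shiftPt f σ w.re (height f σ z))‖ ≤
        M * (1 + C) * ‖z.re - w.re‖ := by
      refine convex_univ.norm_image_sub_le_of_norm_hasDerivWithin_le
        (f := fun x => cauchy f (density f φ) 1 (shiftPt f σ x (height f σ z)))
        (fun x _ => (HasDerivAt.comp (h := fun x => shiftPt f σ x (height f σ z)) x (hd x _ hz')
          (hf.hasDerivAt_shiftPt_left x _)).hasDerivWithinAt) (fun x _ => ?_)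
        (Set.mem_univ _) (Set.mem_univ _)
      rw [norm_mul, norm_neg]
      have := hf.norm_tangent_le x
      gcongr
      exact hb _ (shiftPt_mem_side hσ hz' x)
    have h2 : ‖cauchy f (density f φ) 1 (shiftPt f σ w.re (height f σ z)) -
        cauchy f (density f φ) 1 (shiftPt f σ w.re (height f σ w))‖ ≤
        M * ‖height f σ z - height f σ w‖ := by
      refine (convex_Ioi (0 : ℝ)).norm_image_sub_le_of_norm_hasDerivWithin_le
        (f := fun τ => cauchy f (density f φ) 1 (shiftPt f σ w.re τ))
        (fun τ hτ => (HasDerivAt.comp (h := fun τ => shiftPt f σ w.re τ) τ (hd w.re τ hτ)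
          (hasDerivAt_shiftPt_right w.re τ)).hasDerivWithinAt) (fun τ hτ => ?_)
        (Set.mem_Ioi.2 hw') (Set.mem_Ioi.2 hz')
      rw [norm_mul, norm_neg, norm_sigma_mul_I hσ, mul_one]
      exact hb _ (shiftPt_mem_side hσ hτ _)
    rw [shiftPt_height hσ] at h1 h2
    have h3 := hf.height_sub_le (f := f) hσ z w
    rw [Real.norm_eq_abs] at h1 h2
    calc _ ≤ _ := norm_sub_le_norm_sub_add_norm_sub _ _ _
      _ ≤ M * (1 + C) * |z.re - w.re| + M * |height f σ z - height f σ w| := add_le_add h1 h2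
      _ ≤ M * (1 + C) * |z.re - w.re| + M * (1 + C) * |height f σ z - height f σ w| := by
          gcongr
          exact le_mul_of_one_le_right hM (by linarith)
      _ = M * (1 + C) * (|z.re - w.re| + |height f σ z - height f σ w|) := by ring
      _ ≤ _ := by gcongr
  refine (LipschitzOnWith.of_dist_le_mul (K := (M * (1 + C) * (2 + C)).toNNReal)
    fun z hz w hw => ?_).uniformContinuousOn
  rw [dist_eq_norm, dist_eq_norm, Real.coe_toNNReal _ (by positivity), mul_assoc _ (2 + C)]
  exact hlip z hz w hw

/-! ### The jump relations -/

theorem add_mem_slitPlane_of_re_eq_one {a : ℂ} (ha : a.re = 1) (u ε : ℝ) (hε : ε = 1 ∨ ε = -1) :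
    1 + (ε * Complex.I) * a * u ∈ Complex.slitPlane := by
  rcases eq_or_ne u 0 with rfl | hu
  · simp
  · refine Or.inr ?_
    rcases hε with rfl | rfl <;> simp [ha, hu]

/-- The difference of the logarithms tends to `log (ia) - log (-ia) = πi` as `Im (ia) = 1 > 0`. -/
theorem tendsto_log_sub_log {a : ℂ} (ha : a.re = 1) :
    Tendsto (fun u : ℝ => Complex.log (1 + ((1 : ℝ) * Complex.I) * a * u) -
      Complex.log (1 + ((-1 : ℝ) * Complex.I) * a * u)) atTop (𝓝 (Real.pi * Complex.I)) := by
  have him : (Complex.I * a).im = 1 := by simp [ha]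
  have h1 : Complex.I * a ∈ Complex.slitPlane := Or.inr (by rw [him]; exact one_ne_zero)
  have h2 : -(Complex.I * a) ∈ Complex.slitPlane := Or.inr (by simp [ha])
  have hinv : Tendsto (fun u : ℝ => ((u⁻¹ : ℝ) : ℂ)) atTop (𝓝 0) := by
    have := (Complex.continuous_ofReal.tendsto 0).comp tendsto_inv_atTop_zero
    simpa [Function.comp_def] using this
  have t1 : Tendsto (fun u : ℝ => Complex.log (Complex.I * a + ((u⁻¹ : ℝ) : ℂ))) atTop
      (𝓝 (Complex.log (Complex.I * a))) := by
    have := hinv.const_add (Complex.I * a)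
    rw [add_zero] at this
    exact this.clog h1
  have t2 : Tendsto (fun u : ℝ => Complex.log (-(Complex.I * a) + ((u⁻¹ : ℝ) : ℂ))) atTop
      (𝓝 (Complex.log (-(Complex.I * a)))) := by
    have := hinv.const_add (-(Complex.I * a))
    rw [add_zero] at this
    exact this.clog h2
  have hval : Complex.log (Complex.I * a) - Complex.log (-(Complex.I * a)) =
      Real.pi * Complex.I := by
    rw [Complex.log, Complex.log, norm_neg,
      Complex.arg_neg_eq_arg_sub_pi_of_im_pos (by rw [him]; exact one_pos)]
    push_cast; ring
  rw [← hval]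
  refine (t1.sub t2).congr' ?_
  filter_upwards [eventually_gt_atTop 0] with u hu
  have hu' : (u : ℂ) ≠ 0 := Complex.ofReal_ne_zero.2 hu.ne'
  have e1 : 1 + ((1 : ℝ) * Complex.I) * a * u = u * (Complex.I * a + ((u⁻¹ : ℝ) : ℂ)) := by
    push_cast; field_simp; ring
  have e2 : 1 + ((-1 : ℝ) * Complex.I) * a * u = u * (-(Complex.I * a) + ((u⁻¹ : ℝ) : ℂ)) := by
    push_cast; field_simp; ring
  have n1 : Complex.I * a + ((u⁻¹ : ℝ) : ℂ) ≠ 0 := fun h => by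
    have := congrArg Complex.im h
    rw [Complex.add_im, him, Complex.ofReal_im] at this
    norm_num at this
  have n2 : -(Complex.I * a) + ((u⁻¹ : ℝ) : ℂ) ≠ 0 := fun h => by
    have := congrArg Complex.im h
    rw [Complex.add_im, Complex.neg_im, him, Complex.ofReal_im] at this
    norm_num at this
  rw [e1, e2, Complex.log_ofReal_mul hu n1, Complex.log_ofReal_mul hu n2]
  ring

theorem one_add_sq_mul_eq (a : ℂ) (u : ℝ) : 1 + a ^ 2 * u ^ 2 =
    (1 + ((1 : ℝ) * Complex.I) * a * u) * (1 + ((-1 : ℝ) * Complex.I) * a * u) := by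
  push_cast
  linear_combination a ^ 2 * u ^ 2 * Complex.I_sq

/-- The integral `∫ du / (1 + a² u²) = π / a` for a complex `a`, computed with the antiderivative
`(2ia)⁻¹ (log (1 + iau) - log (1 - iau))`. The case `Re a = 1` is the one of a tangent vector. -/
theorem integral_inv_one_add_sq_mul {a : ℂ} (ha : a.re = 1)
    (hi : Integrable fun u : ℝ => (1 + a ^ 2 * (u : ℂ) ^ 2)⁻¹) :
    ∫ u : ℝ, (1 + a ^ 2 * (u : ℂ) ^ 2)⁻¹ = Real.pi / a := by
  have ha0 : a ≠ 0 := fun h => by rw [h] at ha; simp at ha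
  set L : ℝ → ℂ := fun u => Complex.log (1 + ((1 : ℝ) * Complex.I) * a * u) -
    Complex.log (1 + ((-1 : ℝ) * Complex.I) * a * u) with hL
  have hodd : ∀ u, L (-u) = -L u := fun u => by
    simp only [hL, Complex.ofReal_neg, Complex.ofReal_one]
    rw [neg_sub]
    congr 2 <;> ring_nf
  have htop := (tendsto_log_sub_log ha).const_mul (2 * Complex.I * a)⁻¹
  have hbot : Tendsto (fun u => (2 * Complex.I * a)⁻¹ * L u) atBot
      (𝓝 ((2 * Complex.I * a)⁻¹ * -(Real.pi * Complex.I))) := by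
    have := ((tendsto_log_sub_log ha).comp tendsto_neg_atBot_atTop).neg
    refine (this.congr fun u => ?_).const_mul _
    change -L (-u) = L u
    rw [hodd, neg_neg]
  have hd : ∀ u : ℝ, HasDerivAt (fun u => (2 * Complex.I * a)⁻¹ * L u)
      ((1 + a ^ 2 * (u : ℂ) ^ 2)⁻¹) u := fun u => by
    have h0 : ∀ ε : ℝ, HasDerivAt (fun u : ℝ => 1 + (ε * Complex.I) * a * u)
        ((ε * Complex.I) * a) u := fun ε => by
      simpa using ((hasDerivAt_id u).ofReal_comp.const_mul ((ε * Complex.I) * a)).const_add 1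
    have m1 := add_mem_slitPlane_of_re_eq_one ha u 1 (Or.inl rfl)
    have m2 := add_mem_slitPlane_of_re_eq_one ha u (-1) (Or.inr rfl)
    have := (((h0 1).clog_real m1).sub ((h0 (-1)).clog_real m2)).const_mul (2 * Complex.I * a)⁻¹
    refine this.congr_deriv ?_
    rw [one_add_sq_mul_eq]
    have n1 := Complex.slitPlane_ne_zero m1
    have n2 := Complex.slitPlane_ne_zero m2
    have hI := Complex.I_ne_zero
    rw [div_sub_div _ _ n1 n2, inv_mul_eq_div, div_div, inv_eq_one_div,
      div_eq_div_iff (mul_ne_zero (mul_ne_zero n1 n2) (by simp [ha0])) (mul_ne_zero n1 n2)]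
    push_cast; ring
  rw [integral_of_hasDerivAt_of_tendsto hd hi hbot htop]
  have hI := Complex.I_ne_zero
  field_simp
  ring

/-- The difference of the Cauchy kernels at the points above and below `γ(x)`. -/
theorem inv_sub_inv_shiftPt (hf : HolderC1 C f) {t : ℝ} (ht : 0 < t) (x s : ℝ) :
    (shiftPt f 1 x t - curve f s)⁻¹ - (shiftPt f (-1) x t - curve f s)⁻¹ =
      -2 * Complex.I * t * ((shiftPt f 1 x t - curve f s)⁻¹ *
        (shiftPt f (-1) x t - curve f s)⁻¹) := by
  have h1 := hf.sub_curve_ne_zero (z := shiftPt f 1 x t)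
    (by rwa [vdist_shiftPt (by simp) ht.le]) s
  have h2 := hf.sub_curve_ne_zero (z := shiftPt f (-1) x t)
    (by rwa [vdist_shiftPt (by simp) ht.le]) s
  have h3 : (shiftPt f (-1) x t - curve f s) - (shiftPt f 1 x t - curve f s) =
      -2 * Complex.I * t := by
    rw [shiftPt_eq, shiftPt_eq]; push_cast; ring
  rw [← h3]
  field_simp

theorem norm_inv_mul_inv_shiftPt_le (hf : HolderC1 C f) {t : ℝ} (ht : 0 < t) (x s : ℝ) :
    ‖(shiftPt f 1 x t - curve f s)⁻¹ * (shiftPt f (-1) x t - curve f s)⁻¹‖ ≤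
      (2 + C) ^ 2 * (1 / (|x - s| + t) ^ 2) := by
  have h1 := hf.inv_norm_sub_curve_le (z := shiftPt f 1 x t)
    (by rwa [vdist_shiftPt (by simp) ht.le]) s
  have h2 := hf.inv_norm_sub_curve_le (z := shiftPt f (-1) x t)
    (by rwa [vdist_shiftPt (by simp) ht.le]) s
  rw [vdist_shiftPt (by simp) ht.le, re_shiftPt] at h1 h2
  have hC := hf.nonneg
  rw [norm_mul, norm_inv, norm_inv]
  calc _ ≤ ((2 + C) / (|x - s| + t)) * ((2 + C) / (|x - s| + t)) := by gcongr
    _ = _ := by field_simp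

theorem integrable_mul_inv_mul_inv_shiftPt (hf : HolderC1 C f) {h : ℝ → ℂ} (hc : Continuous h)
    {M : ℝ} (hM : ∀ s, ‖h s‖ ≤ M) {t : ℝ} (ht : 0 < t) (x : ℝ) :
    Integrable fun s => h s * ((shiftPt f 1 x t - curve f s)⁻¹ *
      (shiftPt f (-1) x t - curve f s)⁻¹) := by
  have hm : ∀ z : ℂ, Measurable fun s => (z - curve f s)⁻¹ := fun z =>
    (continuous_const.sub hf.continuous_curve).measurable.inv
  refine ((integrable_inv_sq ht x).const_mul (M * (2 + C) ^ 2)).mono'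
    (hc.measurable.mul ((hm _).mul (hm _))).aestronglyMeasurable (Eventually.of_forall fun s => ?_)
  rw [norm_mul, mul_assoc M]
  have := hM s
  have hM0 := (norm_nonneg _).trans this
  exact mul_le_mul this (norm_inv_mul_inv_shiftPt_le hf ht x s) (norm_nonneg _) hM0

theorem integrable_mul_inv_sub_inv_shiftPt (hf : HolderC1 C f) {h : ℝ → ℂ} (hc : Continuous h)
    {M : ℝ} (hM : ∀ s, ‖h s‖ ≤ M) {t : ℝ} (ht : 0 < t) (x : ℝ) :
    Integrable fun s => h s * ((shiftPt f 1 x t - curve f s)⁻¹ -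
      (shiftPt f (-1) x t - curve f s)⁻¹) := by
  simp_rw [inv_sub_inv_shiftPt hf ht]
  refine ((integrable_mul_inv_mul_inv_shiftPt hf hc hM ht x).const_mul
    (-2 * Complex.I * t)).congr (Eventually.of_forall fun s => ?_)
  simp only; ring

/-- The Plemelj jump relation for the Cauchy integral with a bounded continuous density, along the
vertical line through `γ(x)`. In the variable `u = (s - x) / t` the difference of the kernels tends
to the Poisson-type kernel `-2i / (1 + γ'(x)² u²)`. -/
theorem tendsto_integral_mul_inv_sub_inv (hf : HolderC1 C f) {h : ℝ → ℂ} (hc : Continuous h)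
    {M : ℝ} (hM : ∀ s, ‖h s‖ ≤ M) (x : ℝ) :
    Tendsto (fun t : ℝ => ∫ s, h s * ((shiftPt f 1 x t - curve f s)⁻¹ -
      (shiftPt f (-1) x t - curve f s)⁻¹)) (𝓝[>] 0)
      (𝓝 (-2 * Real.pi * Complex.I * (h x / tangent f x))) := by
  have hC := hf.nonneg
  set a := tangent f x with ha
  have hM0 : 0 ≤ M := (norm_nonneg _).trans (hM 0)
  -- the rescaled kernel, up to the factor `-2i`
  set κ : ℝ → ℝ → ℂ := fun t u => (t * (shiftPt f 1 x t - curve f (x + t * u))⁻¹) *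
      (t * (shiftPt f (-1) x t - curve f (x + t * u))⁻¹) with hκ
  have hscale : ∀ t : ℝ, 0 < t → ∫ s, h s * ((shiftPt f 1 x t - curve f s)⁻¹ -
      (shiftPt f (-1) x t - curve f s)⁻¹) = ∫ u, -2 * Complex.I * (h (x + t * u) * κ t u) :=
    fun t ht => by
    rw [← integral_add_left_eq_self _ x]
    have := Measure.integral_comp_mul_left (fun s => h (x + s) *
      ((shiftPt f 1 x t - curve f (x + s))⁻¹ - (shiftPt f (-1) x t - curve f (x + s))⁻¹)) t
    rw [abs_of_pos (inv_pos.2 ht), eq_comm, inv_smul_eq_iff₀ ht.ne'] at this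
    rw [this, ← integral_smul]
    refine integral_congr_ae (Eventually.of_forall fun u => ?_)
    simp only [hκ]
    rw [inv_sub_inv_shiftPt hf ht, Complex.real_smul]
    ring
  have hκb : ∀ t : ℝ, 0 < t → ∀ u, ‖κ t u‖ ≤ (2 + C) ^ 2 * (1 / (|0 - u| + 1) ^ 2) :=
    fun t ht u => by
    have h1 := norm_inv_mul_inv_shiftPt_le hf ht x (x + t * u)
    have e1 : |x - (x + t * u)| = t * |u| := by
      rw [sub_add_cancel_left, abs_neg, abs_mul, abs_of_pos ht]
    have e2 : κ t u = (t : ℂ) ^ 2 * ((shiftPt f 1 x t - curve f (x + t * u))⁻¹ *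
        (shiftPt f (-1) x t - curve f (x + t * u))⁻¹) := by simp only [hκ]; ring
    rw [e1] at h1
    rw [e2, norm_mul, norm_pow, Complex.norm_real, Real.norm_of_nonneg ht.le, zero_sub, abs_neg]
    calc _ ≤ t ^ 2 * ((2 + C) ^ 2 * (1 / (t * |u| + t) ^ 2)) := by gcongr
      _ = _ := by
          have : t * |u| + t = t * (|u| + 1) := by ring
          rw [this]
          field_simp
  have hκlim : ∀ u : ℝ, Tendsto (fun t => κ t u) (𝓝[>] 0) (𝓝 ((1 + a ^ 2 * (u : ℂ) ^ 2)⁻¹)) :=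
    fun u => by
    have tq : Tendsto (fun t : ℝ => (t : ℂ)⁻¹ * (curve f (x + t * u) - curve f x)) (𝓝[>] 0)
        (𝓝 (a * u)) := by
      have hd : HasDerivAt (fun t : ℝ => curve f (x + t * u)) (u • a) 0 := by
        have h1 : HasDerivAt (fun t : ℝ => x + t * u) u 0 := by
          simpa using ((hasDerivAt_id (0 : ℝ)).mul_const u).const_add x
        have h2 : HasDerivAt (curve f) a (x + 0 * u) := by simpa using hf.hasDerivAt_curve x
        exact HasDerivAt.scomp (h := fun t : ℝ => x + t * u) (0 : ℝ) h2 h1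
      have := (hasDerivAt_iff_tendsto_slope.1 hd).mono_left
        (nhdsWithin_mono _ (show Set.Ioi (0 : ℝ) ⊆ {0}ᶜ from fun t ht => ne_of_gt ht))
      rw [Complex.real_smul, mul_comm] at this
      refine this.congr fun t => ?_
      rw [slope_def_module, sub_zero, zero_mul, add_zero, Complex.real_smul]
      push_cast; rfl
    have hfac : ∀ ε : ℝ, (ε = 1 ∨ ε = -1) → Tendsto (fun t : ℝ => (t : ℂ) *
        (shiftPt f ε x t - curve f (x + t * u))⁻¹) (𝓝[>] 0)
        (𝓝 ((ε * Complex.I - a * u)⁻¹)) := fun ε hε => by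
      have h1 : (ε : ℂ) * Complex.I - a * u ≠ 0 := by
        have h2 := Complex.slitPlane_ne_zero (add_mem_slitPlane_of_re_eq_one
          (a := a) rfl u ε hε)
        intro h3
        apply h2
        have h4 : (ε : ℂ) * ε = 1 := by rcases hε with rfl | rfl <;> simp
        have : 1 + (ε * Complex.I) * a * u = -(ε * Complex.I) * (ε * Complex.I - a * u) := by
          linear_combination (-1 : ℂ) * h4 + ε * ε * (Complex.I_sq)
        rw [this, h3, mul_zero]
      refine ((tq.const_sub ((ε : ℂ) * Complex.I)).inv₀ h1).congr' ?_
      filter_upwards [self_mem_nhdsWithin] with t ht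
      have ht' : (t : ℂ) ≠ 0 := Complex.ofReal_ne_zero.2 (ne_of_gt ht)
      rw [shiftPt_eq]
      rw [show curve f x + (t : ℂ) * (ε * Complex.I) - curve f (x + t * u) =
        t * (ε * Complex.I - (t : ℂ)⁻¹ * (curve f (x + t * u) - curve f x)) by field_simp; ring]
      rw [mul_inv, mul_inv_cancel_left₀ ht']
    have h2 := (hfac 1 (Or.inl rfl)).mul (hfac (-1) (Or.inr rfl))
    have e : ((1 : ℝ) * Complex.I - a * u)⁻¹ * ((-1 : ℝ) * Complex.I - a * u)⁻¹ =
        (1 + a ^ 2 * (u : ℂ) ^ 2)⁻¹ := by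
      rw [← mul_inv]
      congr 1
      push_cast
      linear_combination (-1 : ℂ) * Complex.I_sq
    rwa [e] at h2
  have hint : Integrable fun u : ℝ => (1 + a ^ 2 * (u : ℂ) ^ 2)⁻¹ := by
    refine ((integrable_inv_sq one_pos 0).const_mul ((2 + C) ^ 2)).mono' ?_
      (Eventually.of_forall fun u => ?_)
    · exact (Measurable.inv (by fun_prop)).aestronglyMeasurable
    · refine le_of_tendsto (hκlim u).norm ?_
      filter_upwards [self_mem_nhdsWithin] with t ht using hκb t ht u
  have hres := tendsto_integral_filter_of_dominated_convergence (μ := volume) (l := 𝓝[>] (0 : ℝ))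
    (F := fun t u => -2 * Complex.I * (h (x + t * u) * κ t u))
    (f := fun u => -2 * Complex.I * (h x * (1 + a ^ 2 * (u : ℂ) ^ 2)⁻¹))
    (fun u => 2 * (M * ((2 + C) ^ 2 * (1 / (|0 - u| + 1) ^ 2))))
    (Eventually.of_forall fun t => ?_) ?_
    ((((integrable_inv_sq one_pos 0).const_mul _).const_mul _).const_mul _)
    (Eventually.of_forall fun u => ?_)
  · rw [integral_const_mul, integral_const_mul, integral_inv_one_add_sq_mul rfl hint] at hres
    have e : -2 * Complex.I * (h x * (Real.pi / a)) = -2 * Real.pi * Complex.I * (h x / a) := by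
      ring
    rw [e] at hres
    refine hres.congr' ?_
    filter_upwards [self_mem_nhdsWithin] with t ht using (hscale t ht).symm
  · have hm : ∀ z : ℂ, Measurable fun u : ℝ => (z - curve f (x + t * u))⁻¹ := fun z =>
      (continuous_const.sub (hf.continuous_curve.comp (by fun_prop))).measurable.inv
    exact (measurable_const.mul ((hc.comp (by fun_prop)).measurable.mul
      ((measurable_const.mul (hm _)).mul (measurable_const.mul (hm _))))).aestronglyMeasurable
  · filter_upwards [self_mem_nhdsWithin] with t ht
    refine Eventually.of_forall fun u => ?_
    rw [norm_mul, norm_mul (h _)]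
    have e3 : ‖-2 * Complex.I‖ = 2 := by simp
    rw [e3]
    gcongr
    · exact hM _
    · exact hκb t ht u
  · have th : Tendsto (fun t : ℝ => h (x + t * u)) (𝓝[>] 0) (𝓝 (h x)) := by
      have : Continuous fun t : ℝ => h (x + t * u) := hc.comp (by fun_prop)
      have := this.tendsto 0
      rw [zero_mul, add_zero] at this
      exact this.mono_left nhdsWithin_le_nhds
    exact (th.mul (hκlim u)).const_mul _

/-- The jump of the Cauchy integral across the graph is `-2πi φ`. -/
theorem tendsto_cauchy_density_one_sub (hf : HolderC1 C f) (hφ : HolderC1 B φ)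
    (hφ2 : MemLp φ 2 volume) (x : ℝ) :
    Tendsto (fun t : ℝ => cauchy f (density f φ) 1 (shiftPt f 1 x t) -
      cauchy f (density f φ) 1 (shiftPt f (-1) x t)) (𝓝[>] 0)
      (𝓝 (-2 * Real.pi * Complex.I * φ x)) := by
  have h := tendsto_integral_mul_inv_sub_inv hf (continuous_density hf hφ)
    (norm_density_le hf hφ) x
  rw [density, mul_div_cancel_right₀ _ (tangent_ne_zero f x)] at h
  refine h.congr' ?_
  filter_upwards [self_mem_nhdsWithin] with t ht
  have ht' : 0 < t := ht
  rw [cauchy, cauchy, ← integral_sub]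
  · refine integral_congr_ae (Eventually.of_forall fun s => ?_)
    simp only [pow_one, div_eq_mul_inv, mul_sub]
  all_goals
    refine hf.integrable_kernel_one (memLp_density hf hφ2) ?_
    rwa [vdist_shiftPt (by simp) ht'.le]

/-- The jump of (minus) the derivative of the Cauchy integral: one integration by parts leads to the
Cauchy integral with density `φ' / γ'`. -/
theorem tendsto_cauchy_density_two_sub (hf : HolderC1 C f) (hφ : HolderC1 B φ) (x : ℝ) :
    Tendsto (fun t : ℝ => cauchy f (density f φ) 2 (shiftPt f 1 x t) -
      cauchy f (density f φ) 2 (shiftPt f (-1) x t)) (𝓝[>] 0)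
      (𝓝 (2 * Real.pi * Complex.I * (((deriv φ x : ℝ) : ℂ) / tangent f x))) := by
  have h := (tendsto_integral_mul_inv_sub_inv hf (continuous_ofReal_deriv hφ)
    (norm_ofReal_deriv_le hφ) x).neg
  have e : -(-2 * Real.pi * Complex.I * (((deriv φ x : ℝ) : ℂ) / tangent f x)) =
      2 * Real.pi * Complex.I * (((deriv φ x : ℝ) : ℂ) / tangent f x) := by ring
  rw [e] at h
  refine h.congr' ?_
  filter_upwards [self_mem_nhdsWithin] with t ht
  have ht' : 0 < t := ht
  have v1 : 0 < vdist f (shiftPt f 1 x t) := by rwa [vdist_shiftPt (by simp) ht'.le]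
  have v2 : 0 < vdist f (shiftPt f (-1) x t) := by rwa [vdist_shiftPt (by simp) ht'.le]
  have i1 := hf.integrable_kernel_sq (continuous_density hf hφ).aestronglyMeasurable
    (norm_density_le hf hφ) v1
  have i2 := hf.integrable_kernel_sq (continuous_density hf hφ).aestronglyMeasurable
    (norm_density_le hf hφ) v2
  have hbp := integral_mul_deriv_eq_deriv_mul_of_integrable (u := fun s => (φ s : ℂ))
    (u' := fun s => ((deriv φ s : ℝ) : ℂ))
    (v := fun s => (shiftPt f 1 x t - curve f s)⁻¹ - (shiftPt f (-1) x t - curve f s)⁻¹)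
    (v' := fun s => tangent f s / (shiftPt f 1 x t - curve f s) ^ 2 -
      tangent f s / (shiftPt f (-1) x t - curve f s) ^ 2)
    (fun s _ => (hφ.hasDerivAt s).ofReal_comp)
    (fun s _ => (hf.hasDerivAt_inv_sub_curve v1 s).sub (hf.hasDerivAt_inv_sub_curve v2 s)) ?_
    (integrable_mul_inv_sub_inv_shiftPt hf (continuous_ofReal_deriv hφ) (norm_ofReal_deriv_le hφ)
      ht' x)
    (integrable_mul_inv_sub_inv_shiftPt hf (Complex.continuous_ofReal.comp hφ.continuous) (M := B)
      (fun s => by rw [Function.comp_apply, Complex.norm_real]; exact hφ.abs_le s) ht' x)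
  · rw [← hbp, cauchy, cauchy, ← integral_sub i1 i2]
    refine integral_congr_ae (Eventually.of_forall fun s => ?_)
    simp only [density]; ring
  · refine (i1.sub i2).congr (Eventually.of_forall fun s => ?_)
    simp only [density, Pi.mul_apply, Pi.sub_apply]; ring

/-! ### The complex plane and the Euclidean plane -/

/-- The identification of `ℂ` with the Euclidean plane. -/
def toPlane : ℂ ≃ₗᵢ[ℝ] Plane := Complex.orthonormalBasisOneI.repr

@[simp]
theorem toPlane_apply_zero (z : ℂ) : toPlane z 0 = z.re := rfl

@[simp]
theorem toPlane_apply_one (z : ℂ) : toPlane z 1 = z.im := rfl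

@[simp]
theorem toPlane_symm_re (p : Plane) : (toPlane.symm p).re = p 0 := by
  rw [← toPlane_apply_zero, toPlane.apply_symm_apply]

@[simp]
theorem toPlane_symm_im (p : Plane) : (toPlane.symm p).im = p 1 := by
  rw [← toPlane_apply_one, toPlane.apply_symm_apply]

/-- The image in the plane of `side f σ`. -/
def sidePlane (f : ℝ → ℝ) (σ : ℝ) : Set Plane := toPlane.symm ⁻¹' side f σ

theorem OmegaPlus_eq (f : ℝ → ℝ) : OmegaPlus f = sidePlane f 1 := by
  ext p; simp [OmegaPlus, sidePlane, side]

theorem OmegaMinus_eq (f : ℝ → ℝ) : OmegaMinus f = sidePlane f (-1) := by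
  ext p; simp [OmegaMinus, sidePlane, side]

theorem Xi_eq (f : ℝ → ℝ) (x : ℝ) : Xi f x = toPlane (curve f x) := by
  ext i; fin_cases i <;> rfl

theorem toPlane_symm_Xi (f : ℝ → ℝ) (x : ℝ) : toPlane.symm (Xi f x) = curve f x := by
  rw [Xi_eq, toPlane.symm_apply_apply]

theorem vdist_pos_of_notMem_Gamma {p : Plane} (hp : p ∉ Gamma f) :
    0 < vdist f (toPlane.symm p) := by
  rw [vdist, abs_pos, sub_ne_zero, toPlane_symm_im, toPlane_symm_re]
  intro h
  refine hp ⟨p 0, ?_⟩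
  ext i; fin_cases i
  · rfl
  · exact h.symm

theorem isOpen_sidePlane (hf : HolderC1 C f) : IsOpen (sidePlane f σ) :=
  hf.isOpen_side.preimage toPlane.symm.continuous

theorem tendsto_toPlane_symm_nhdsWithin (x : ℝ) :
    Tendsto toPlane.symm (𝓝[sidePlane f σ] (Xi f x)) (𝓝[side f σ] (curve f x)) := by
  refine tendsto_nhdsWithin_iff.2 ⟨?_, ?_⟩
  · rw [← toPlane_symm_Xi]
    exact (toPlane.symm.continuous.tendsto _).mono_left nhdsWithin_le_nhds
  · filter_upwards [self_mem_nhdsWithin] with p hp using hp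

theorem tendsto_toPlane_nhdsWithin (x : ℝ) :
    Tendsto toPlane (𝓝[side f σ] (curve f x)) (𝓝[sidePlane f σ] (Xi f x)) := by
  refine tendsto_nhdsWithin_iff.2 ⟨?_, ?_⟩
  · rw [Xi_eq]
    exact (toPlane.continuous.tendsto _).mono_left nhdsWithin_le_nhds
  · filter_upwards [self_mem_nhdsWithin] with z hz
    rwa [sidePlane, Set.mem_preimage, toPlane.symm_apply_apply]

theorem tendsto_toPlane_symm_cobounded :
    Tendsto toPlane.symm (Bornology.cobounded Plane ⊓ 𝓟 (sidePlane f σ))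
      (Bornology.cobounded ℂ ⊓ 𝓟 (side f σ)) := by
  refine tendsto_inf.2 ⟨?_, tendsto_principal.2 ?_⟩
  · rw [← comap_norm_atTop (E := ℂ), tendsto_comap_iff]
    refine (tendsto_norm_cobounded_atTop.mono_left inf_le_left).congr fun p => ?_
    simp
  · exact mem_inf_of_right (mem_principal_self _)

theorem tendsto_toPlane_cobounded :
    Tendsto toPlane (Bornology.cobounded ℂ ⊓ 𝓟 (side f σ))
      (Bornology.cobounded Plane ⊓ 𝓟 (sidePlane f σ)) := by
  refine tendsto_inf.2 ⟨?_, tendsto_principal.2 ?_⟩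
  · rw [← comap_norm_atTop (E := Plane), tendsto_comap_iff]
    refine (tendsto_norm_cobounded_atTop.mono_left inf_le_left).congr fun p => ?_
    simp
  · filter_upwards [mem_inf_of_right (mem_principal_self _)] with z hz
    rwa [sidePlane, Set.mem_preimage, toPlane.symm_apply_apply]

/-- The Laplacian is invariant under linear isometries. -/
theorem laplacian_comp_toPlane (u : Plane → ℝ) (z : ℂ) :
    Laplacian.laplacian (u ∘ toPlane) z = Laplacian.laplacian u (toPlane z) := by
  have h1 := congrFun (InnerProductSpace.laplacian_eq_iteratedFDeriv_orthonormalBasis (u ∘ toPlane)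
    Complex.orthonormalBasisOneI) z
  have h2 := congrFun (InnerProductSpace.laplacian_eq_iteratedFDeriv_orthonormalBasis u
    (Complex.orthonormalBasisOneI.map toPlane)) (toPlane z)
  rw [h1, h2]
  refine Finset.sum_congr rfl fun i _ => ?_
  have h3 := toPlane.toContinuousLinearEquiv.iteratedFDerivWithin_comp_right u
    (s := Set.univ) uniqueDiffOn_univ (x := z) (Set.mem_univ _) 2
  rw [Set.preimage_univ, iteratedFDerivWithin_univ, iteratedFDerivWithin_univ] at h3
  change iteratedFDeriv ℝ 2 (u ∘ toPlane.toContinuousLinearEquiv) z _ = _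
  rw [h3, ContinuousMultilinearMap.compContinuousLinearMap_apply]
  congr 1
  ext j
  fin_cases j <;> rfl

/-- The gradient of the real part of a holomorphic function `F` is the conjugate of `F'`. -/
theorem hasGradientAt_re_comp {F : ℂ → ℂ} {F' : ℂ} {p : Plane}
    (hF : HasDerivAt F F' (toPlane.symm p)) :
    HasGradientAt (fun p => (F (toPlane.symm p)).re) (toPlane (starRingEnd ℂ F')) p := by
  rw [hasGradientAt_iff_hasFDerivAt]
  have h1 := (hF.hasFDerivAt.restrictScalars ℝ).comp p
    (toPlane.symm.toContinuousLinearEquiv.hasFDerivAt (x := p))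
  have h2 := Complex.reCLM.hasFDerivAt.comp p h1
  refine h2.congr_fderiv ?_
  ext v
  obtain ⟨w, rfl⟩ := toPlane.surjective v
  have e : ⟪toPlane (starRingEnd ℂ F'), toPlane w⟫_ℝ = (w * F').re := by
    rw [toPlane.inner_map_map, Complex.inner, Complex.conj_conj]
  rw [InnerProductSpace.toDual_apply_apply, e]
  simp [mul_comm]

/-! ### One-sided limits -/

theorem tendsto_shiftPt (hσ : |σ| = 1) (x : ℝ) :
    Tendsto (fun t => shiftPt f σ x t) (𝓝[>] 0) (𝓝[side f σ] (curve f x)) := by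
  refine tendsto_nhdsWithin_iff.2 ⟨?_, ?_⟩
  · have h : Continuous fun t => shiftPt f σ x t :=
      continuous_iff_continuousAt.2 fun t => (hasDerivAt_shiftPt_right x t).continuousAt
    have := h.tendsto 0
    rw [shiftPt_eq x 0, Complex.ofReal_zero, zero_mul, add_zero] at this
    exact this.mono_left nhdsWithin_le_nhds
  · filter_upwards [self_mem_nhdsWithin] with t ht using shiftPt_mem_side hσ ht x

theorem neBot_nhdsWithin_side (hσ : |σ| = 1) (x : ℝ) : (𝓝[side f σ] (curve f x)).NeBot :=
  (tendsto_shiftPt hσ x).neBot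

theorem exists_tendsto_of_uniformContinuousOn (hσ : |σ| = 1) {F : ℂ → ℂ}
    (hF : UniformContinuousOn F (side f σ)) (x : ℝ) :
    ∃ a, Tendsto F (𝓝[side f σ] (curve f x)) (𝓝 a) := by
  have := neBot_nhdsWithin_side (f := f) hσ x
  have hc : Cauchy (𝓝[side f σ] (curve f x)) := cauchy_nhds.mono nhdsWithin_le_nhds
  exact cauchy_map_iff_exists_tendsto.1 (hc.map_of_le hF inf_le_right)

theorem tendsto_sub_shiftPt {F : ℂ → ℂ} {x : ℝ} {a b : ℂ}
    (ha : Tendsto F (𝓝[side f 1] (curve f x)) (𝓝 a))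
    (hb : Tendsto F (𝓝[side f (-1)] (curve f x)) (𝓝 b)) :
    Tendsto (fun t => F (shiftPt f 1 x t) - F (shiftPt f (-1) x t)) (𝓝[>] 0) (𝓝 (a - b)) :=
  (ha.comp (tendsto_shiftPt (by simp) x)).sub (hb.comp (tendsto_shiftPt (by simp) x))

/-! ### The potential -/

theorem potentialIntegrand_eq (f φ : ℝ → ℝ) (p : Plane) (s : ℝ) :
    potentialIntegrand f φ p s =
      (density f φ s / (toPlane.symm p - curve f s) ^ 1).re := by
  rw [pow_one, potentialIntegrand, Complex.div_re]
  simp only [density, tangent, curve, Complex.normSq_apply, Complex.sub_re, Complex.sub_im,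
    toPlane_symm_re, toPlane_symm_im, Complex.re_ofReal_mul, Complex.im_ofReal_mul]
  ring

theorem integrable_potentialIntegrand (hf : HolderC1 C f) (hφ2 : MemLp φ 2 volume) {p : Plane}
    (hp : 0 < vdist f (toPlane.symm p)) : Integrable (potentialIntegrand f φ p) :=
  (hf.integrable_kernel_one (memLp_density hf hφ2) hp).re.congr
    (Eventually.of_forall fun s => (potentialIntegrand_eq f φ p s).symm)

/-- The holomorphic function whose real part is the potential. -/
def complexPotential (f φ : ℝ → ℝ) (z : ℂ) : ℂ :=
  ((1 / (2 * Real.pi) : ℝ) : ℂ) * cauchy f (density f φ) 1 z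

/-- The derivative of `complexPotential`. -/
def complexPotentialDeriv (f φ : ℝ → ℝ) (z : ℂ) : ℂ :=
  -(((1 / (2 * Real.pi) : ℝ) : ℂ) * cauchy f (density f φ) 2 z)

theorem potential_eq (hf : HolderC1 C f) (hφ2 : MemLp φ 2 volume) {p : Plane}
    (hp : 0 < vdist f (toPlane.symm p)) :
    potential f φ p = (complexPotential f φ (toPlane.symm p)).re := by
  rw [potential, complexPotential, Complex.re_ofReal_mul]
  congr 1
  simp_rw [potentialIntegrand_eq]
  exact integral_re (hf.integrable_kernel_one (memLp_density hf hφ2) hp)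

theorem hasDerivAt_complexPotential (hf : HolderC1 C f) (hφ : HolderC1 B φ)
    (hφ2 : MemLp φ 2 volume) {z : ℂ} (hz : 0 < vdist f z) :
    HasDerivAt (complexPotential f φ) (complexPotentialDeriv f φ z) z := by
  refine ((hasDerivAt_cauchy_density_one hf hφ hφ2 hz).const_mul _).congr_deriv ?_
  rw [complexPotentialDeriv, mul_neg]

theorem eqOn_potential (hf : HolderC1 C f) (hφ2 : MemLp φ 2 volume) :
    Set.EqOn (potential f φ) (fun p => (complexPotential f φ (toPlane.symm p)).re)
      (sidePlane f σ) :=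
  fun _ hp => potential_eq hf hφ2 (vdist_pos_of_mem_side hp)

theorem gradient_potential (hf : HolderC1 C f) (hφ : HolderC1 B φ) (hφ2 : MemLp φ 2 volume)
    {p : Plane} (hp : p ∈ sidePlane f σ) : ∇ (potential f φ) p =
      toPlane (starRingEnd ℂ (complexPotentialDeriv f φ (toPlane.symm p))) := by
  have h1 := hasGradientAt_re_comp
    (hasDerivAt_complexPotential hf hφ hφ2 (vdist_pos_of_mem_side hp))
  refine (HasGradientAt.congr_of_eventuallyEq h1 ?_).gradient
  filter_upwards [(isOpen_sidePlane hf).mem_nhds hp] with q hq using eqOn_potential hf hφ2 hq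

theorem contDiffOn_potential (hf : HolderC1 C f) (hφ : HolderC1 B φ) (hφ2 : MemLp φ 2 volume)
    (n : WithTop ℕ∞) : ContDiffOn ℝ n (potential f φ) (sidePlane f σ) := by
  have h1 : DifferentiableOn ℂ (complexPotential f φ) (side f σ) := fun z hz =>
    (hasDerivAt_complexPotential hf hφ hφ2
      (vdist_pos_of_mem_side hz)).differentiableAt.differentiableWithinAt
  have h2 : ContDiffOn ℝ n (complexPotential f φ) (side f σ) :=
    (h1.contDiffOn hf.isOpen_side).restrict_scalars ℝ
  have h3 : ContDiffOn ℝ n (fun p => (complexPotential f φ (toPlane.symm p)).re)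
      (sidePlane f σ) :=
    Complex.reCLM.contDiff.comp_contDiffOn
      (h2.comp (toPlane.symm.toContinuousLinearEquiv.contDiff.contDiffOn) fun _ hp => hp)
  exact h3.congr (eqOn_potential hf hφ2)

theorem laplacian_potential (hf : HolderC1 C f) (hφ : HolderC1 B φ) (hφ2 : MemLp φ 2 volume)
    {p : Plane} (hp : p ∈ sidePlane f σ) : Laplacian.laplacian (potential f φ) p = 0 := by
  have hz : toPlane.symm p ∈ side f σ := hp
  have h1 : AnalyticAt ℂ (complexPotential f φ) (toPlane.symm p) :=
    DifferentiableOn.analyticAt (s := side f σ) (fun z hz => (hasDerivAt_complexPotential hf hφ hφ2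
      (vdist_pos_of_mem_side hz)).differentiableAt.differentiableWithinAt)
      (hf.isOpen_side.mem_nhds hz)
  have h2 := h1.harmonicAt_re
  have h3 := h2.2.self_of_nhds
  have h4 : potential f φ ∘ toPlane =ᶠ[𝓝 (toPlane.symm p)]
      fun z => (complexPotential f φ z).re := by
    filter_upwards [hf.isOpen_side.mem_nhds hz] with w hw
    have := eqOn_potential hf hφ2 (σ := σ) (f := f) (x := toPlane w) (by
      rwa [sidePlane, Set.mem_preimage, toPlane.symm_apply_apply])
    simpa using this
  have h5 := laplacian_comp_toPlane (potential f φ) (toPlane.symm p)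
  rw [toPlane.apply_symm_apply] at h5
  rw [← h5, (InnerProductSpace.laplacian_congr_nhds h4).eq_of_nhds]
  exact h3

theorem uniformContinuousOn_const_mul {F : ℂ → ℂ} {S : Set ℂ} (hF : UniformContinuousOn F S)
    (c : ℂ) : UniformContinuousOn (fun z => c * F z) S :=
  (LipschitzWith.uniformContinuous (lipschitzWith_smul c)).comp_uniformContinuousOn hF

theorem uniformContinuousOn_complexPotential (hf : HolderC1 C f) (hφ : HolderC1 B φ)
    (hφ2 : MemLp φ 2 volume) (hσ : |σ| = 1) :
    UniformContinuousOn (complexPotential f φ) (side f σ) :=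
  uniformContinuousOn_const_mul (uniformContinuousOn_cauchy_density_one hf hφ hφ2 hσ) _

theorem uniformContinuousOn_complexPotentialDeriv (hf : HolderC1 C f) (hφ : HolderC1 B φ)
    (hσ : |σ| = 1) : UniformContinuousOn (complexPotentialDeriv f φ) (side f σ) :=
  uniformContinuous_neg.comp_uniformContinuousOn
    (uniformContinuousOn_const_mul (uniformContinuousOn_cauchy_density_two hf hφ hσ) _)

theorem uniformContinuousOn_comp_toPlane_symm {α : Type*} [UniformSpace α] {F : ℂ → α}
    (hF : UniformContinuousOn F (side f σ)) :
    UniformContinuousOn (fun p => F (toPlane.symm p)) (sidePlane f σ) :=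
  hF.comp toPlane.symm.isometry.uniformContinuous.uniformContinuousOn fun _ hp => hp

theorem memUC1_potential (hf : HolderC1 C f) (hφ : HolderC1 B φ) (hφ2 : MemLp φ 2 volume)
    (hσ : |σ| = 1) : MemUC1 (potential f φ) (sidePlane f σ) where
  contDiffOn := contDiffOn_potential hf hφ hφ2 1
  uniformContinuousOn := by
    refine UniformContinuousOn.congr ?_ (eqOn_potential hf hφ2).symm
    exact Complex.reCLM.uniformContinuous.comp_uniformContinuousOn
      (uniformContinuousOn_comp_toPlane_symm (uniformContinuousOn_complexPotential hf hφ hφ2 hσ))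
  uniformContinuousOn_gradient := by
    refine UniformContinuousOn.congr ?_ fun p hp => (gradient_potential hf hφ hφ2 hp).symm
    exact (toPlane.isometry.uniformContinuous.comp
      Complex.isometry_conj.uniformContinuous).comp_uniformContinuousOn
      (uniformContinuousOn_comp_toPlane_symm (uniformContinuousOn_complexPotentialDeriv hf hφ hσ))

theorem tendsto_gradient_potential (hf : HolderC1 C f) (hφ : HolderC1 B φ)
    (hφ2 : MemLp φ 2 volume) (hσ : |σ| = 1) :
    Tendsto (∇ (potential f φ)) (Bornology.cobounded Plane ⊓ 𝓟 (sidePlane f σ)) (𝓝 0) := by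
  have h1 := (tendsto_cauchy_density_two hf hφ hφ2 hσ).const_mul
    (((1 / (2 * Real.pi) : ℝ) : ℂ))
  have h2 := (h1.neg.comp tendsto_toPlane_symm_cobounded)
  rw [mul_zero, neg_zero] at h2
  have h3 : Tendsto (fun z : ℂ => toPlane (starRingEnd ℂ z)) (𝓝 0) (𝓝 0) := by
    have := (toPlane.continuous.comp Complex.continuous_conj).tendsto 0
    simpa [Function.comp_def] using this
  refine (h3.comp h2).congr' ?_
  filter_upwards [mem_inf_of_right (mem_principal_self _)] with p hp
  rw [gradient_potential hf hφ hφ2 hp]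
  rfl

theorem hasJump_potential (hf : HolderC1 C f) (hφ : HolderC1 B φ) (hφ2 : MemLp φ 2 volume)
    (x : ℝ) : HasJump f (potential f φ) (potential f φ) x 0 := by
  obtain ⟨a, ha⟩ := exists_tendsto_of_uniformContinuousOn (f := f) (σ := 1) (by simp)
    (uniformContinuousOn_complexPotential hf hφ hφ2 (by simp)) x
  obtain ⟨b, hb⟩ := exists_tendsto_of_uniformContinuousOn (f := f) (σ := -1) (by simp)
    (uniformContinuousOn_complexPotential hf hφ hφ2 (by simp)) x
  have h1 := tendsto_sub_shiftPt ha hb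
  have h2 := (tendsto_cauchy_density_one_sub hf hφ hφ2 x).const_mul ((1 / (2 * Real.pi) : ℝ) : ℂ)
  have h3 := tendsto_nhds_unique h1 (h2.congr fun t => by
    simp only [complexPotential]; ring)
  have key : ∀ {σ : ℝ} {c : ℂ}, Tendsto (complexPotential f φ) (𝓝[side f σ] (curve f x)) (𝓝 c) →
      Tendsto (potential f φ) (𝓝[sidePlane f σ] (Xi f x)) (𝓝 c.re) := fun {σ c} h => by
    refine ((Complex.continuous_re.tendsto c).comp
      (h.comp (tendsto_toPlane_symm_nhdsWithin x))).congr' ?_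
    filter_upwards [self_mem_nhdsWithin] with p hp using (eqOn_potential hf hφ2 hp).symm
  refine ⟨a.re, b.re, ?_, ?_, ?_⟩
  · rw [OmegaPlus_eq]; exact key ha
  · rw [OmegaMinus_eq]; exact key hb
  · rw [← Complex.sub_re, h3, Complex.re_ofReal_mul]
    simp

theorem normal_eq (f : ℝ → ℝ) (x : ℝ) : normal f x =
    toPlane (((√(1 + deriv f x ^ 2))⁻¹ : ℝ) * (Complex.I * tangent f x)) := by
  ext i
  fin_cases i
  · simp [normal, tangent]
  · simp [normal, tangent]

theorem hasJump_gradient_potential (hf : HolderC1 C f) (hφ : HolderC1 B φ)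
    (hφ2 : MemLp φ 2 volume) (x : ℝ) :
    HasJump f (fun p => ⟪∇ (potential f φ) p, normal f x⟫_ℝ)
      (fun p => ⟪∇ (potential f φ) p, normal f x⟫_ℝ) x
      ((√(1 + deriv f x ^ 2))⁻¹ * deriv φ x) := by
  obtain ⟨a, ha⟩ := exists_tendsto_of_uniformContinuousOn (f := f) (σ := 1) (by simp)
    (uniformContinuousOn_complexPotentialDeriv hf hφ (by simp)) x
  obtain ⟨b, hb⟩ := exists_tendsto_of_uniformContinuousOn (f := f) (σ := -1) (by simp)
    (uniformContinuousOn_complexPotentialDeriv hf hφ (by simp)) x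
  have h1 := tendsto_sub_shiftPt ha hb
  have h2 := ((tendsto_cauchy_density_two_sub hf hφ x).const_mul
    ((1 / (2 * Real.pi) : ℝ) : ℂ)).neg
  have h3 := tendsto_nhds_unique h1 (h2.congr fun t => by
    simp only [complexPotentialDeriv]; ring)
  have key : ∀ {σ : ℝ} {c : ℂ},
      Tendsto (complexPotentialDeriv f φ) (𝓝[side f σ] (curve f x)) (𝓝 c) →
      Tendsto (fun p => ⟪∇ (potential f φ) p, normal f x⟫_ℝ) (𝓝[sidePlane f σ] (Xi f x))
        (𝓝 ⟪toPlane (starRingEnd ℂ c), normal f x⟫_ℝ) := fun {σ c} h => by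
    have hc : Continuous fun w : ℂ => ⟪toPlane (starRingEnd ℂ w), normal f x⟫_ℝ :=
      (toPlane.continuous.comp Complex.continuous_conj).inner continuous_const
    refine ((hc.tendsto c).comp (h.comp (tendsto_toPlane_symm_nhdsWithin x))).congr' ?_
    filter_upwards [self_mem_nhdsWithin] with p hp
    rw [gradient_potential hf hφ hφ2 hp]
    rfl
  refine ⟨⟪toPlane (starRingEnd ℂ a), normal f x⟫_ℝ, ⟪toPlane (starRingEnd ℂ b), normal f x⟫_ℝ,
    ?_, ?_, ?_⟩
  · rw [OmegaPlus_eq]; exact key ha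
  · rw [OmegaMinus_eq]; exact key hb
  · rw [← inner_sub_left, ← map_sub, ← map_sub, h3, normal_eq, toPlane.inner_map_map,
      Complex.inner, Complex.conj_conj]
    have ht := tangent_ne_zero f x
    have hpi : (Real.pi : ℂ) ≠ 0 := Complex.ofReal_ne_zero.2 Real.pi_ne_zero
    have e : (((√(1 + deriv f x ^ 2))⁻¹ : ℝ) : ℂ) * (Complex.I * tangent f x) *
        -(((1 / (2 * Real.pi) : ℝ) : ℂ) *
          (2 * Real.pi * Complex.I * (((deriv φ x : ℝ) : ℂ) / tangent f x))) =
        (((√(1 + deriv f x ^ 2))⁻¹ * deriv φ x : ℝ) : ℂ) := by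
      push_cast
      field_simp
      rw [Complex.I_sq]; ring
    rw [e, Complex.ofReal_re]

theorem isSolution_potential (hf : HolderC1 C f) (hφ : HolderC1 B φ) (hφ2 : MemLp φ 2 volume) :
    IsSolution f φ (potential f φ) (potential f φ) where
  contDiffOn_plus := by rw [OmegaPlus_eq]; exact contDiffOn_potential hf hφ hφ2 2
  contDiffOn_minus := by rw [OmegaMinus_eq]; exact contDiffOn_potential hf hφ hφ2 2
  memUC1_plus := by rw [OmegaPlus_eq]; exact memUC1_potential hf hφ hφ2 (by simp)
  memUC1_minus := by rw [OmegaMinus_eq]; exact memUC1_potential hf hφ hφ2 (by simp)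
  laplacian_plus p hp := by
    rw [OmegaPlus_eq] at hp; exact laplacian_potential hf hφ hφ2 hp
  laplacian_minus p hp := by
    rw [OmegaMinus_eq] at hp; exact laplacian_potential hf hφ hφ2 hp
  jump := hasJump_potential hf hφ hφ2
  jump_normal := hasJump_gradient_potential hf hφ hφ2
  gradient_plus := by rw [OmegaPlus_eq]; exact tendsto_gradient_potential hf hφ hφ2 (by simp)
  gradient_minus := by rw [OmegaMinus_eq]; exact tendsto_gradient_potential hf hφ hφ2 (by simp)

/-! ### Contour integrals over translates of the graph -/

theorem HolderC1.continuous_shiftPt (hf : HolderC1 C f) :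
    Continuous fun q : ℝ × ℝ => shiftPt f σ q.1 q.2 := by
  simp_rw [shiftPt_eq]
  have := hf.continuous_curve
  fun_prop

theorem HolderC1.hasDerivAt_comp_shiftPt_left (hf : HolderC1 C f) (hσ : |σ| = 1) {H : ℂ → ℂ}
    (hH : DifferentiableOn ℂ H (side f σ)) (x : ℝ) {τ : ℝ} (hτ : 0 < τ) :
    HasDerivAt (fun x => H (shiftPt f σ x τ)) (deriv H (shiftPt f σ x τ) * tangent f x) x := by
  have h1 := (hH.differentiableAt (hf.isOpen_side.mem_nhds (shiftPt_mem_side hσ hτ x))).hasDerivAt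
  rw [mul_comm]
  exact HasDerivAt.scomp (h := fun x => shiftPt f σ x τ) x h1 (hf.hasDerivAt_shiftPt_left x τ)

theorem HolderC1.hasDerivAt_comp_shiftPt_right (hf : HolderC1 C f) (hσ : |σ| = 1) {H : ℂ → ℂ}
    (hH : DifferentiableOn ℂ H (side f σ)) (x : ℝ) {τ : ℝ} (hτ : 0 < τ) :
    HasDerivAt (fun τ => H (shiftPt f σ x τ)) (deriv H (shiftPt f σ x τ) * (σ * Complex.I)) τ := by
  have h1 := (hH.differentiableAt (hf.isOpen_side.mem_nhds (shiftPt_mem_side hσ hτ x))).hasDerivAt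
  rw [mul_comm]
  exact HasDerivAt.scomp (h := fun τ => shiftPt f σ x τ) τ h1 (hasDerivAt_shiftPt_right x τ)

theorem HolderC1.continuousOn_comp_shiftPt (hf : HolderC1 C f) (hσ : |σ| = 1) {H : ℂ → ℂ}
    (hH : ContinuousOn H (side f σ)) :
    ContinuousOn (fun q : ℝ × ℝ => H (shiftPt f σ q.1 q.2)) {q | 0 < q.2} :=
  hH.comp hf.continuous_shiftPt.continuousOn fun q hq => shiftPt_mem_side hσ hq q.1

theorem HolderC1.continuous_comp_shiftPt (hf : HolderC1 C f) (hσ : |σ| = 1) {H : ℂ → ℂ}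
    (hH : ContinuousOn H (side f σ)) {τ : ℝ} (hτ : 0 < τ) :
    Continuous fun x => H (shiftPt f σ x τ) :=
  (hf.continuousOn_comp_shiftPt hσ hH).comp_continuous
    (f := fun x : ℝ => ((x, τ) : ℝ × ℝ)) (by fun_prop) fun _ => hτ

theorem abs_le_norm_shiftPt (f : ℝ → ℝ) (σ x τ : ℝ) : |x| ≤ ‖shiftPt f σ x τ‖ :=
  Complex.abs_re_le_norm (shiftPt f σ x τ)

/-- Cauchy's theorem for the region between two vertical translates of an arc of the graph. -/
theorem HolderC1.integral_shiftPt_sub (hf : HolderC1 C f) (hσ : |σ| = 1) {H : ℂ → ℂ}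
    (hH : DifferentiableOn ℂ H (side f σ)) {τ₁ τ₂ : ℝ} (h1 : 0 < τ₁) (h12 : τ₁ ≤ τ₂) (a b : ℝ) :
    (∫ s in a..b, H (shiftPt f σ s τ₂) * tangent f s) -
      ∫ s in a..b, H (shiftPt f σ s τ₁) * tangent f s =
    ∫ τ in τ₁..τ₂, (H (shiftPt f σ b τ) - H (shiftPt f σ a τ)) * (σ * Complex.I) := by
  have hd : ContinuousOn (fun q : ℝ × ℝ => deriv H (shiftPt f σ q.1 q.2)) {q | 0 < q.2} :=
    hf.continuousOn_comp_shiftPt hσ (hH.deriv hf.isOpen_side).continuousOn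
  have hpos : ∀ τ ∈ Set.uIcc τ₁ τ₂, 0 < τ := fun τ hτ => by
    rw [Set.uIcc_of_le h12] at hτ
    exact h1.trans_le hτ.1
  have ht := hf.continuous_tangent
  have hcs : ∀ τ, 0 < τ → Continuous fun s => H (shiftPt f σ s τ) * tangent f s := fun τ hτ =>
    (hf.continuous_comp_shiftPt hσ hH.continuousOn hτ).mul ht
  rw [← intervalIntegral.integral_sub ((hcs τ₂ (h1.trans_le h12)).intervalIntegrable a b)
    ((hcs τ₁ h1).intervalIntegrable a b)]
  have e1 : ∀ s, H (shiftPt f σ s τ₂) * tangent f s - H (shiftPt f σ s τ₁) * tangent f s =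
      ∫ τ in τ₁..τ₂, deriv H (shiftPt f σ s τ) * (σ * Complex.I) * tangent f s := fun s => by
    rw [← sub_mul, intervalIntegral.integral_mul_const]
    congr 1
    rw [intervalIntegral.integral_eq_sub_of_hasDerivAt
      (fun τ hτ => hf.hasDerivAt_comp_shiftPt_right hσ hH s (hpos τ hτ))]
    refine ContinuousOn.intervalIntegrable ?_
    exact (hd.comp (f := fun τ : ℝ => ((s, τ) : ℝ × ℝ)) (by fun_prop)
      fun τ hτ => hpos τ hτ).mul continuousOn_const
  simp_rw [e1]
  rw [MeasureTheory.intervalIntegral_intervalIntegral_swap]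
  · refine intervalIntegral.integral_congr fun τ hτ => ?_
    have hτ0 := hpos τ hτ
    rw [← intervalIntegral.integral_eq_sub_of_hasDerivAt
      (fun s _ => hf.hasDerivAt_comp_shiftPt_left hσ hH s hτ0), ← intervalIntegral.integral_mul_const]
    · refine intervalIntegral.integral_congr fun s _ => ?_
      ring
    · exact ((hf.continuous_comp_shiftPt hσ (hH.deriv hf.isOpen_side).continuousOn hτ0).mul
        ht).intervalIntegrable a b
  · refine (ContinuousOn.integrableOn_compact (K := Set.uIcc a b ×ˢ Set.uIcc τ₁ τ₂)
      (isCompact_uIcc.prod isCompact_uIcc) ?_).mono_set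
      (Set.prod_mono Set.uIoc_subset_uIcc Set.uIoc_subset_uIcc)
    exact ((hd.mono fun q hq => hpos q.2 hq.2).mul continuousOn_const).mul
      (ht.comp continuous_fst).continuousOn

theorem HolderC1.norm_comp_shiftPt_mul_le (hf : HolderC1 C f) (hσ : |σ| = 1) {H : ℂ → ℂ} {A : ℝ}
    (hA : ∀ z ∈ side f σ, ‖H z‖ ≤ A / (1 + ‖z‖) ^ 2) (s : ℝ) {τ : ℝ} (hτ : 0 < τ) :
    ‖H (shiftPt f σ s τ) * tangent f s‖ ≤ A * (1 + C) * (1 / (|0 - s| + 1) ^ 2) := by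
  have h1 := hA _ (shiftPt_mem_side hσ hτ s)
  have hA0 : 0 ≤ A := by
    have h2 := (norm_nonneg _).trans h1
    rcases div_nonneg_iff.1 h2 with h | h
    · exact h.1
    · have : 0 < (1 + ‖shiftPt f σ s τ‖) ^ 2 := by positivity
      linarith [h.2]
  have h2 := abs_le_norm_shiftPt f σ s τ
  have hC := hf.nonneg
  rw [norm_mul, zero_sub, abs_neg]
  calc _ ≤ A / (1 + ‖shiftPt f σ s τ‖) ^ 2 * (1 + C) := by
        gcongr; exact hf.norm_tangent_le s
    _ ≤ A / (1 + |s|) ^ 2 * (1 + C) := by gcongr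
    _ = _ := by rw [add_comm 1 |s|]; ring

theorem HolderC1.integrable_comp_shiftPt_mul (hf : HolderC1 C f) (hσ : |σ| = 1) {H : ℂ → ℂ} {A : ℝ}
    (hH : DifferentiableOn ℂ H (side f σ)) (hA : ∀ z ∈ side f σ, ‖H z‖ ≤ A / (1 + ‖z‖) ^ 2)
    {τ : ℝ} (hτ : 0 < τ) : Integrable fun s => H (shiftPt f σ s τ) * tangent f s :=
  ((integrable_inv_sq one_pos 0).const_mul (A * (1 + C))).mono'
    ((hf.continuous_comp_shiftPt hσ hH.continuousOn hτ).mul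
      hf.continuous_tangent).aestronglyMeasurable
    (Eventually.of_forall fun s => hf.norm_comp_shiftPt_mul_le hσ hA s hτ)

theorem tendsto_shiftPt_cobounded (hσ : |σ| = 1) (x : ℝ) :
    Tendsto (fun τ => shiftPt f σ x τ) atTop (Bornology.cobounded ℂ ⊓ 𝓟 (side f σ)) := by
  refine tendsto_inf.2 ⟨?_, tendsto_principal.2 ?_⟩
  · rw [← comap_norm_atTop (E := ℂ), tendsto_comap_iff]
    refine tendsto_atTop_mono' _ ?_ (tendsto_atTop_add_const_right _ (-‖curve f x‖) tendsto_id)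
    filter_upwards [eventually_ge_atTop 0] with τ hτ
    have h1 : ‖(τ : ℂ) * (σ * Complex.I)‖ = τ := by
      rw [norm_mul, norm_sigma_mul_I hσ, mul_one, Complex.norm_real, Real.norm_of_nonneg hτ]
    have h2 : (τ : ℂ) * (σ * Complex.I) = shiftPt f σ x τ - curve f x := by
      rw [shiftPt_eq]; ring
    rw [h2] at h1
    have := norm_sub_le (shiftPt f σ x τ) (curve f x)
    simp only [Function.comp_apply, id]
    linarith
  · filter_upwards [eventually_gt_atTop 0] with τ hτ using shiftPt_mem_side hσ hτ x

/-- The integral of a holomorphic function with quadratic decay over a translate of the graph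
vanishes: it does not depend on the translate, and tends to zero when the translate moves away. -/
theorem HolderC1.integral_comp_shiftPt_mul_eq_zero (hf : HolderC1 C f) (hσ : |σ| = 1) {H : ℂ → ℂ}
    {A : ℝ} (hH : DifferentiableOn ℂ H (side f σ))
    (hA : ∀ z ∈ side f σ, ‖H z‖ ≤ A / (1 + ‖z‖) ^ 2) {τ : ℝ} (hτ : 0 < τ) :
    ∫ s, H (shiftPt f σ s τ) * tangent f s = 0 := by
  have hbd : Tendsto (fun R : ℝ => A / (1 + R) ^ 2) atTop (𝓝 0) := by
    refine Tendsto.const_div_atTop ?_ _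
    exact (tendsto_pow_atTop two_ne_zero).comp (tendsto_atTop_add_const_left _ _ tendsto_id)
  have hA0 : 0 ≤ A := by
    have h2 := (norm_nonneg _).trans (hA _ (shiftPt_mem_side hσ hτ 0))
    rcases div_nonneg_iff.1 h2 with h | h
    · exact h.1
    · have : 0 < (1 + ‖shiftPt f σ 0 τ‖) ^ 2 := by positivity
      linarith [h.2]
  have hconst : ∀ τ₂, τ ≤ τ₂ → ∫ s, H (shiftPt f σ s τ₂) * tangent f s =
      ∫ s, H (shiftPt f σ s τ) * tangent f s := fun τ₂ h2 => by
    have l1 := intervalIntegral_tendsto_integral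
      (hf.integrable_comp_shiftPt_mul hσ hH hA (hτ.trans_le h2)) tendsto_neg_atTop_atBot tendsto_id
    have l2 := intervalIntegral_tendsto_integral
      (hf.integrable_comp_shiftPt_mul hσ hH hA hτ) tendsto_neg_atTop_atBot tendsto_id
    refine sub_eq_zero.1 (tendsto_nhds_unique (l1.sub l2) ?_)
    refine squeeze_zero_norm' (a := fun R => (A / (1 + R) ^ 2 + A / (1 + R) ^ 2) * |τ₂ - τ|) ?_ ?_
    · filter_upwards [eventually_ge_atTop 0] with R hR
      simp only [id]
      rw [hf.integral_shiftPt_sub hσ hH hτ h2]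
      refine intervalIntegral.norm_integral_le_of_norm_le_const fun t ht => ?_
      rw [Set.uIoc_of_le h2] at ht
      have ht0 := hτ.trans ht.1
      have hb : ∀ x : ℝ, |x| = R → ‖H (shiftPt f σ x t)‖ ≤ A / (1 + R) ^ 2 := fun x hx => by
        refine (hA _ (shiftPt_mem_side hσ ht0 x)).trans ?_
        have := abs_le_norm_shiftPt f σ x t
        rw [hx] at this
        gcongr
      rw [norm_mul, norm_sigma_mul_I hσ, mul_one]
      refine (norm_sub_le _ _).trans (add_le_add (hb _ (abs_of_nonneg hR)) (hb _ ?_))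
      rw [abs_neg, abs_of_nonneg hR]
    · have := (hbd.add hbd).mul_const |τ₂ - τ|
      simpa using this
  have hlim : Tendsto (fun t => ∫ s, H (shiftPt f σ s t) * tangent f s) atTop (𝓝 0) := by
    have h := tendsto_integral_filter_of_dominated_convergence (μ := volume) (l := atTop)
      (F := fun t s => H (shiftPt f σ s t) * tangent f s) (f := fun _ => 0)
      (fun s => A * (1 + C) * (1 / (|0 - s| + 1) ^ 2)) ?_ ?_
      ((integrable_inv_sq one_pos 0).const_mul _) (Eventually.of_forall fun s => ?_)
    · simpa using h
    · filter_upwards [eventually_gt_atTop 0] with t ht using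
        (hf.integrable_comp_shiftPt_mul hσ hH hA ht).aestronglyMeasurable
    · filter_upwards [eventually_gt_atTop 0] with t ht using
        Eventually.of_forall fun s => hf.norm_comp_shiftPt_mul_le hσ hA s ht
    · rw [← zero_mul (tangent f s)]
      refine Tendsto.mul_const _ ?_
      refine squeeze_zero_norm' ?_ (hbd.comp ((tendsto_norm_cobounded_atTop.mono_left
        inf_le_left).comp (tendsto_shiftPt_cobounded (f := f) hσ s)))
      filter_upwards [eventually_gt_atTop 0] with t ht using hA _ (shiftPt_mem_side hσ ht s)
  refine tendsto_nhds_unique (tendsto_const_nhds.congr' ?_) hlim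
  filter_upwards [eventually_ge_atTop τ] with t ht using (hconst t ht).symm

/-- Cauchy's theorem on the graph itself, for the boundary values of a holomorphic function with
quadratic decay. -/
theorem HolderC1.integral_boundary_mul_eq_zero (hf : HolderC1 C f) (hσ : |σ| = 1) {H : ℂ → ℂ}
    {A : ℝ} (hH : DifferentiableOn ℂ H (side f σ))
    (hA : ∀ z ∈ side f σ, ‖H z‖ ≤ A / (1 + ‖z‖) ^ 2) {h : ℝ → ℂ}
    (hh : ∀ s, Tendsto (fun t => H (shiftPt f σ s t)) (𝓝[>] 0) (𝓝 (h s))) :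
    (Integrable fun s => h s * tangent f s) ∧ ∫ s, h s * tangent f s = 0 := by
  have hlim : ∀ s, Tendsto (fun t => H (shiftPt f σ s t) * tangent f s) (𝓝[>] 0)
      (𝓝 (h s * tangent f s)) := fun s => (hh s).mul_const _
  have hmeas : AEStronglyMeasurable (fun s => h s * tangent f s) volume := by
    refine aestronglyMeasurable_of_tendsto_ae atTop
      (f := fun (n : ℕ) s => H (shiftPt f σ s (1 / ((n : ℝ) + 1))) * tangent f s)
      (fun n => ?_) (Eventually.of_forall fun s => ?_)
    · exact (hf.integrable_comp_shiftPt_mul hσ hH hA (by positivity)).aestronglyMeasurable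
    · refine (hlim s).comp (tendsto_nhdsWithin_iff.2
        ⟨tendsto_one_div_add_atTop_nhds_zero_nat, Eventually.of_forall fun n => ?_⟩)
      exact Set.mem_Ioi.2 (by positivity)
  have hdom := (integrable_inv_sq one_pos 0).const_mul (A * (1 + C))
  refine ⟨hdom.mono' hmeas (Eventually.of_forall fun s => ?_), ?_⟩
  · refine le_of_tendsto (hlim s).norm ?_
    filter_upwards [self_mem_nhdsWithin] with t ht using hf.norm_comp_shiftPt_mul_le hσ hA s ht
  · have := tendsto_integral_filter_of_dominated_convergence (μ := volume) (l := 𝓝[>] (0 : ℝ))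
      (F := fun t s => H (shiftPt f σ s t) * tangent f s) (f := fun s => h s * tangent f s)
      (fun s => A * (1 + C) * (1 / (|0 - s| + 1) ^ 2)) ?_ ?_ hdom (Eventually.of_forall hlim)
    · refine tendsto_nhds_unique this (tendsto_const_nhds.congr' ?_)
      filter_upwards [self_mem_nhdsWithin] with t ht using
        (hf.integral_comp_shiftPt_mul_eq_zero hσ hH hA ht).symm
    · filter_upwards [self_mem_nhdsWithin] with t ht using
        (hf.integrable_comp_shiftPt_mul hσ hH hA ht).aestronglyMeasurable
    · filter_upwards [self_mem_nhdsWithin] with t ht using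
        Eventually.of_forall fun s => hf.norm_comp_shiftPt_mul_le hσ hA s ht

/-! ### Liouville's theorem across the graph -/

theorem inv_norm_sub_le {z w : ℂ} {δ : ℝ} (hδ : 0 < δ) (h : δ ≤ ‖z - w‖) :
    ‖(z - w)⁻¹‖ ≤ ((1 + ‖w‖) / δ + 1) / (1 + ‖z‖) := by
  have h0 : 0 < ‖z - w‖ := hδ.trans_le h
  have h1 : ‖z‖ ≤ ‖z - w‖ + ‖w‖ := by simpa using norm_add_le (z - w) w
  have h2 : 1 + ‖w‖ ≤ (1 + ‖w‖) / δ * ‖z - w‖ := by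
    rw [div_mul_eq_mul_div, le_div_iff₀ hδ]
    gcongr
  rw [norm_inv, inv_eq_one_div, div_le_div_iff₀ h0 (by positivity)]
  linarith

theorem HolderC1.exists_norm_inv_sub_le (hf : HolderC1 C f) (hσ : |σ| = 1) {w : ℂ}
    (hw : w ∈ side f (-σ)) :
    ∃ K, ∀ z ∈ side f σ, z - w ≠ 0 ∧ ‖(z - w)⁻¹‖ ≤ K / (1 + ‖z‖) := by
  have hC := hf.nonneg
  have hw0 : 0 < height f (-σ) w := hw
  have hδ : 0 < height f (-σ) w / (2 + C) := by positivity
  refine ⟨(1 + ‖w‖) / (height f (-σ) w / (2 + C)) + 1, fun z hz => ?_⟩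
  have hz0 : 0 < height f σ z := hz
  have h : height f (-σ) w / (2 + C) ≤ ‖z - w‖ := by
    have h1 := hf.height_sub_le hσ z w
    have h2 : height f σ w = -height f (-σ) w := by simp only [height]; ring
    have h3 := le_abs_self (height f σ z - height f σ w)
    rw [div_le_iff₀ (by positivity)]
    have := abs_nonneg (z.re - w.re)
    linarith
  exact ⟨norm_pos_iff.1 (hδ.trans_le h), inv_norm_sub_le hδ h⟩

/-- The difference quotients of a bounded holomorphic function decay at infinity. -/
theorem HolderC1.exists_norm_dslope_le (hf : HolderC1 C f) {G : ℂ → ℂ}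
    (hG : DifferentiableOn ℂ G (side f σ)) {M : ℝ} (hM : ∀ z ∈ side f σ, ‖G z‖ ≤ M) {w : ℂ}
    (hw : w ∈ side f σ) : ∃ K, ∀ z ∈ side f σ, ‖dslope G w z‖ ≤ K / (1 + ‖z‖) := by
  obtain ⟨δ, hδ, hball⟩ := Metric.nhds_basis_closedBall.mem_iff.1 (hf.isOpen_side.mem_nhds hw)
  have hd : ContinuousOn (dslope G w) (Metric.closedBall w δ) :=
    (((Complex.differentiableOn_dslope (hf.isOpen_side.mem_nhds hw)).2 hG).mono hball).continuousOn
  obtain ⟨K₁, hK₁⟩ := (isCompact_closedBall w δ).exists_bound_of_continuousOn hd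
  have hK0 : 0 ≤ K₁ := (norm_nonneg _).trans (hK₁ w (Metric.mem_closedBall_self hδ.le))
  have hM0 : 0 ≤ M := (norm_nonneg _).trans (hM w hw)
  refine ⟨max (K₁ * (1 + (‖w‖ + δ))) (((1 + ‖w‖) / δ + 1) * (M + M)), fun z hz => ?_⟩
  by_cases h : z ∈ Metric.closedBall w δ
  · have h1 : ‖z‖ ≤ ‖w‖ + δ := by
      have h2 : ‖z - w‖ ≤ δ := by rw [← dist_eq_norm]; exact h
      have h3 : ‖z‖ ≤ ‖z - w‖ + ‖w‖ := by simpa using norm_add_le (z - w) w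
      linarith
    rw [le_div_iff₀ (by positivity)]
    refine le_trans ?_ (le_max_left _ _)
    have := hK₁ z h
    gcongr
  · have h1 : δ < ‖z - w‖ := by rw [← dist_eq_norm]; exact not_le.1 h
    have h2 : z ≠ w := fun e => by rw [e, sub_self, norm_zero] at h1; exact hδ.not_gt h1
    rw [dslope_of_ne _ h2, slope_def_module, norm_smul]
    have h3 := inv_norm_sub_le hδ h1.le
    have h4 : ‖G z - G w‖ ≤ M + M := (norm_sub_le _ _).trans (add_le_add (hM z hz) (hM w hw))
    calc _ ≤ ((1 + ‖w‖) / δ + 1) / (1 + ‖z‖) * (M + M) := by gcongr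
      _ = ((1 + ‖w‖) / δ + 1) * (M + M) / (1 + ‖z‖) := by ring
      _ ≤ _ := by gcongr; exact le_max_right _ _

/-- The product of two Cauchy kernels with poles `z` and `w`, together with the line element. -/
def doubleKernel (f : ℝ → ℝ) (z w : ℂ) (s : ℝ) : ℂ :=
  (curve f s - z)⁻¹ * (curve f s - w)⁻¹ * tangent f s

theorem HolderC1.integrable_doubleKernel (hf : HolderC1 C f) {z w : ℂ} (hz : 0 < vdist f z)
    (hw : 0 < vdist f w) : Integrable (doubleKernel f z w) := by
  have hC := hf.nonneg
  have hm : ∀ z : ℂ, Measurable fun s => (curve f s - z)⁻¹ := fun z =>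
    (hf.continuous_curve.sub continuous_const).measurable.inv
  refine ((((integrable_inv_sq hz z.re).add (integrable_inv_sq hw w.re)).const_mul
    ((2 + C) ^ 2 * (1 + C)))).mono' (((hm z).mul (hm w)).mul
      hf.continuous_tangent.measurable).aestronglyMeasurable (Eventually.of_forall fun s => ?_)
  have h1 := hf.inv_norm_sub_curve_le hz s
  have h2 := hf.inv_norm_sub_curve_le hw s
  have h3 := hf.norm_tangent_le s
  set a := |z.re - s| + vdist f z
  set b := |w.re - s| + vdist f w
  have ha : 0 < a := by positivity
  have hb : 0 < b := by positivity
  rw [doubleKernel, norm_mul, norm_mul, norm_inv, norm_inv, norm_sub_rev, norm_sub_rev _ w]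
  have h4 : a⁻¹ * b⁻¹ ≤ 1 / a ^ 2 + 1 / b ^ 2 := by
    rw [one_div, one_div, ← inv_pow, ← inv_pow]
    nlinarith [sq_nonneg (a⁻¹ - b⁻¹), sq_nonneg a⁻¹, sq_nonneg b⁻¹]
  calc _ ≤ (2 + C) / a * ((2 + C) / b) * (1 + C) := by gcongr
    _ = (2 + C) ^ 2 * (1 + C) * (a⁻¹ * b⁻¹) := by ring
    _ ≤ _ := by simp only [Pi.add_apply]; gcongr

theorem sub_mul_doubleKernel (hf : HolderC1 C f) {z w : ℂ} (hz : 0 < vdist f z)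
    (hw : 0 < vdist f w) (s : ℝ) : (z - w) * doubleKernel f z w s =
      tangent f s * ((curve f s - z)⁻¹ - (curve f s - w)⁻¹) := by
  have h1 : curve f s - z ≠ 0 := sub_ne_zero.2 (sub_ne_zero.1 (hf.sub_curve_ne_zero hz s)).symm
  have h2 : curve f s - w ≠ 0 := sub_ne_zero.2 (sub_ne_zero.1 (hf.sub_curve_ne_zero hw s)).symm
  rw [doubleKernel]
  field_simp
  ring

theorem HolderC1.tendsto_inv_shiftPt_sub (hf : HolderC1 C f) {w : ℂ} (hw : 0 < vdist f w) (s : ℝ) :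
    Tendsto (fun t => (shiftPt f σ s t - w)⁻¹) (𝓝[>] 0) (𝓝 ((curve f s - w)⁻¹)) := by
  have h1 : curve f s - w ≠ 0 := sub_ne_zero.2 (sub_ne_zero.1 (hf.sub_curve_ne_zero hw s)).symm
  refine Tendsto.inv₀ (Tendsto.sub_const ?_ w) h1
  have h : Continuous fun t => shiftPt f σ s t :=
    continuous_iff_continuousAt.2 fun t => (hasDerivAt_shiftPt_right s t).continuousAt
  have := h.tendsto 0
  rw [shiftPt_eq s 0, Complex.ofReal_zero, zero_mul, add_zero] at this
  exact this.mono_left nhdsWithin_le_nhds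

/-- With both poles on the same side, the double kernel is holomorphic on the other side. -/
theorem HolderC1.integral_doubleKernel_eq_zero (hf : HolderC1 C f) (hσ : |σ| = 1) {z w : ℂ}
    (hz : z ∈ side f (-σ)) (hw : w ∈ side f (-σ)) : ∫ s, doubleKernel f z w s = 0 := by
  obtain ⟨K₁, hK₁⟩ := hf.exists_norm_inv_sub_le hσ hz
  obtain ⟨K₂, hK₂⟩ := hf.exists_norm_inv_sub_le hσ hw
  refine (hf.integral_boundary_mul_eq_zero hσ (H := fun ζ => (ζ - z)⁻¹ * (ζ - w)⁻¹)
    (A := K₁ * K₂) ?_ (fun ζ hζ => ?_) (h := fun s => (curve f s - z)⁻¹ * (curve f s - w)⁻¹)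
    fun s => ?_).2
  · exact ((differentiableOn_id.sub_const z).inv fun ζ hζ => (hK₁ ζ hζ).1).mul
      ((differentiableOn_id.sub_const w).inv fun ζ hζ => (hK₂ ζ hζ).1)
  · rw [norm_mul]
    have h1 := (hK₁ ζ hζ).2
    have h2 := (hK₂ ζ hζ).2
    calc _ ≤ K₁ / (1 + ‖ζ‖) * (K₂ / (1 + ‖ζ‖)) :=
          mul_le_mul h1 h2 (norm_nonneg _) ((norm_nonneg _).trans h1)
      _ = _ := by rw [div_mul_div_comm, sq]
  · exact (hf.tendsto_inv_shiftPt_sub (vdist_pos_of_mem_side hz) s).mul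
      (hf.tendsto_inv_shiftPt_sub (vdist_pos_of_mem_side hw) s)

/-- The integral of the double kernel with poles on different sides of the graph does not vanish:
up to the factor `z - w` it is independent of the poles, and its value for poles that approach the
same point of the graph is given by the jump relation. -/
theorem HolderC1.integral_doubleKernel_ne_zero (hf : HolderC1 C f) {z w : ℂ} (hz : z ∈ side f 1)
    (hw : w ∈ side f (-1)) : ∫ s, doubleKernel f z w s ≠ 0 := by
  intro h0
  have hvz := vdist_pos_of_mem_side hz
  have hvw := vdist_pos_of_mem_side hw
  -- moving both poles to the points above and below `γ(0)` does not change `(z - w) ∫ K`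
  have key : ∀ t, 0 < t → ∫ s, tangent f s * ((shiftPt f 1 0 t - curve f s)⁻¹ -
      (shiftPt f (-1) 0 t - curve f s)⁻¹) = 0 := fun t ht => by
    have hz' := shiftPt_mem_side (f := f) (σ := 1) (by simp) ht 0
    have hw' := shiftPt_mem_side (f := f) (σ := -1) (by simp) ht 0
    set z' := shiftPt f 1 0 t
    set w' := shiftPt f (-1) 0 t
    have hvz' := vdist_pos_of_mem_side hz'
    have hvw' := vdist_pos_of_mem_side hw'
    have h1 := hf.integral_doubleKernel_eq_zero (σ := -1) (by simp) (z := z') (w := z)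
      (by rwa [neg_neg]) (by rwa [neg_neg])
    have h2 := hf.integral_doubleKernel_eq_zero (σ := 1) (by simp) hw hw'
    have e : ∀ s, tangent f s * ((z' - curve f s)⁻¹ - (w' - curve f s)⁻¹) =
        -((z' - z) * doubleKernel f z' z s + (z - w) * doubleKernel f z w s +
          (w - w') * doubleKernel f w w' s) := fun s => by
      rw [sub_mul_doubleKernel hf hvz' hvz, sub_mul_doubleKernel hf hvz hvw,
        sub_mul_doubleKernel hf hvw hvw', ← neg_sub (curve f s) z', ← neg_sub (curve f s) w',
        inv_neg, inv_neg]
      ring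
    have i1 := (hf.integrable_doubleKernel hvz' hvz).const_mul (z' - z)
    have i2 := (hf.integrable_doubleKernel hvz hvw).const_mul (z - w)
    have i3 := (hf.integrable_doubleKernel hvw hvw').const_mul (w - w')
    have i12 : Integrable fun s => (z' - z) * doubleKernel f z' z s +
        (z - w) * doubleKernel f z w s := i1.add i2
    simp_rw [e]
    rw [integral_neg, integral_add i12 i3, integral_add i1 i2, integral_const_mul,
      integral_const_mul, integral_const_mul, h0, h1, h2]
    simp
  have h1 := tendsto_integral_mul_inv_sub_inv hf hf.continuous_tangent hf.norm_tangent_le 0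
  rw [div_self (tangent_ne_zero f 0), mul_one] at h1
  have h2 : Tendsto (fun t => ∫ s, tangent f s * ((shiftPt f 1 0 t - curve f s)⁻¹ -
      (shiftPt f (-1) 0 t - curve f s)⁻¹)) (𝓝[>] 0) (𝓝 0) := by
    refine tendsto_const_nhds.congr' ?_
    filter_upwards [self_mem_nhdsWithin] with t ht using (key t ht).symm
  have := tendsto_nhds_unique h1 h2
  simp at this

/-- Cauchy's theorem for `(G - G(z)) / ((ζ - z) (ζ - w))`, which is holomorphic on the side of `z`
because its singularity at `z` is removable, if `w` is on the other side. -/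
theorem HolderC1.integral_sub_mul_doubleKernel (hf : HolderC1 C f) (hσ : |σ| = 1) {G : ℂ → ℂ}
    (hG : DifferentiableOn ℂ G (side f σ)) {M : ℝ} (hM : ∀ z ∈ side f σ, ‖G z‖ ≤ M) {g : ℝ → ℂ}
    (hg : ∀ s, Tendsto (fun t => G (shiftPt f σ s t)) (𝓝[>] 0) (𝓝 (g s))) {z w : ℂ}
    (hz : z ∈ side f σ) (hw : w ∈ side f (-σ)) :
    (Integrable fun s => (g s - G z) * doubleKernel f z w s) ∧
      ∫ s, (g s - G z) * doubleKernel f z w s = 0 := by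
  obtain ⟨K₁, hK₁⟩ := hf.exists_norm_dslope_le hG hM hz
  obtain ⟨K₂, hK₂⟩ := hf.exists_norm_inv_sub_le hσ hw
  have h := hf.integral_boundary_mul_eq_zero hσ (H := fun ζ => dslope G z ζ * (ζ - w)⁻¹)
    (A := K₁ * K₂) ?_ (fun ζ hζ => ?_)
    (h := fun s => (curve f s - z)⁻¹ * (g s - G z) * (curve f s - w)⁻¹) fun s => ?_
  · have e : ∀ s, (curve f s - z)⁻¹ * (g s - G z) * (curve f s - w)⁻¹ * tangent f s =
        (g s - G z) * doubleKernel f z w s := fun s => by rw [doubleKernel]; ring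
    simpa only [e] using h
  · exact ((Complex.differentiableOn_dslope (hf.isOpen_side.mem_nhds hz)).2 hG).mul
      ((differentiableOn_id.sub_const w).inv fun ζ hζ => (hK₂ ζ hζ).1)
  · rw [norm_mul]
    have h1 := hK₁ ζ hζ
    have h2 := (hK₂ ζ hζ).2
    calc _ ≤ K₁ / (1 + ‖ζ‖) * (K₂ / (1 + ‖ζ‖)) :=
          mul_le_mul h1 h2 (norm_nonneg _) ((norm_nonneg _).trans h1)
      _ = _ := by rw [div_mul_div_comm, sq]
  · refine Tendsto.mul ?_ (hf.tendsto_inv_shiftPt_sub (vdist_pos_of_mem_side hw) s)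
    have hvz := vdist_pos_of_mem_side hz
    refine ((hf.tendsto_inv_shiftPt_sub (σ := σ) hvz s).mul ((hg s).sub_const (G z))).congr' ?_
    filter_upwards [self_mem_nhdsWithin, Ioo_mem_nhdsGT hvz] with t ht ht'
    have hne : shiftPt f σ s t ≠ z := fun e => by
      have := vdist_shiftPt (f := f) hσ (le_of_lt ht) s
      rw [e] at this
      exact ht'.2.ne' this
    rw [dslope_of_ne _ hne, slope_def_module, smul_eq_mul]

/-- Liouville's theorem for functions that are holomorphic and bounded off the graph and continuous
across it. The function is given by `G 1` above and by `G (-1)` below the graph, with the common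
boundary values `g`. The two instances of `HolderC1.integral_sub_mul_doubleKernel` with the poles
`z` and `w` are subtracted. -/
theorem HolderC1.eq_of_mem_side (hf : HolderC1 C f) {G : ℝ → ℂ → ℂ}
    (hG : ∀ σ : ℝ, |σ| = 1 → DifferentiableOn ℂ (G σ) (side f σ)) {M : ℝ}
    (hM : ∀ σ : ℝ, |σ| = 1 → ∀ z ∈ side f σ, ‖G σ z‖ ≤ M) {g : ℝ → ℂ}
    (hg : ∀ σ : ℝ, |σ| = 1 → ∀ s, Tendsto (fun t => G σ (shiftPt f σ s t)) (𝓝[>] 0) (𝓝 (g s)))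
    {z w : ℂ} (hz : z ∈ side f 1) (hw : w ∈ side f (-1)) : G 1 z = G (-1) w := by
  have a1 : |(1 : ℝ)| = 1 := by simp
  have a2 : |(-1 : ℝ)| = 1 := by simp
  obtain ⟨i1, e1⟩ := hf.integral_sub_mul_doubleKernel a1 (hG 1 a1) (hM 1 a1) (hg 1 a1) hz hw
  obtain ⟨i2, e2⟩ := hf.integral_sub_mul_doubleKernel a2 (hG _ a2) (hM _ a2) (hg _ a2) hw
    (by rwa [neg_neg])
  have hsym : doubleKernel f w z = doubleKernel f z w := by
    ext s; simp only [doubleKernel]; ring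
  rw [hsym] at i2 e2
  have h := integral_sub i2 i1
  rw [e1, e2, sub_self] at h
  have h' : ∫ s, (G 1 z - G (-1) w) * doubleKernel f z w s = 0 := by
    rw [← h]
    congr 1; ext s; ring
  rw [integral_const_mul] at h'
  exact sub_eq_zero.1 ((mul_eq_zero.1 h').resolve_right (hf.integral_doubleKernel_ne_zero hz hw))

/-- Uniform continuity gives a bound on bounded parts of `S`, as these are totally bounded. -/
theorem exists_norm_le_of_uniformContinuousOn {S : Set ℂ} {F : ℂ → ℂ}
    (hF : UniformContinuousOn F S) (h0 : Tendsto F (Bornology.cobounded ℂ ⊓ 𝓟 S) (𝓝 0)) :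
    ∃ M, ∀ z ∈ S, ‖F z‖ ≤ M := by
  have h1 : ∀ᶠ z in Bornology.cobounded ℂ ⊓ 𝓟 S, ‖F z‖ < 1 := by
    have := h0.norm
    rw [norm_zero] at this
    exact this.eventually_lt_const one_pos
  rw [eventually_inf_principal] at h1
  rw [← comap_norm_atTop, eventually_comap] at h1
  obtain ⟨R, hR⟩ := eventually_atTop.1 h1
  have ht : TotallyBounded ((↑) ⁻¹' Metric.closedBall (0 : ℂ) R : Set S) :=
    totallyBounded_preimage (isUniformInducing_val S) (isCompact_closedBall 0 R).totallyBounded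
  obtain ⟨M, hM⟩ := (ht.image (uniformContinuousOn_iff_restrict.1 hF)).isBounded.exists_norm_le
  refine ⟨max M 1, fun z hz => ?_⟩
  by_cases h : R ≤ ‖z‖
  · exact (hR _ h z rfl hz).le.trans (le_max_right _ _)
  · refine (hM (F z) ⟨⟨z, hz⟩, ?_, rfl⟩).trans (le_max_left _ _)
    simpa using (not_le.1 h).le

/-- A function which is holomorphic and uniformly continuous on both sides of the graph, continuous
across the graph and tends to zero at infinity vanishes. -/
theorem HolderC1.eq_zero_of_mem_side (hf : HolderC1 C f) {G : ℝ → ℂ → ℂ}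
    (hG : ∀ σ : ℝ, |σ| = 1 → DifferentiableOn ℂ (G σ) (side f σ))
    (hu : ∀ σ : ℝ, |σ| = 1 → UniformContinuousOn (G σ) (side f σ))
    (h0 : ∀ σ : ℝ, |σ| = 1 → Tendsto (G σ) (Bornology.cobounded ℂ ⊓ 𝓟 (side f σ)) (𝓝 0)) {g : ℝ → ℂ}
    (hg : ∀ σ : ℝ, |σ| = 1 → ∀ s, Tendsto (G σ) (𝓝[side f σ] (curve f s)) (𝓝 (g s))) (hσ : |σ| = 1)
    {z : ℂ} (hz : z ∈ side f σ) : G σ z = 0 := by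
  have a1 : |(1 : ℝ)| = 1 := by simp
  have a2 : |(-1 : ℝ)| = 1 := by simp
  obtain ⟨M₁, hM₁⟩ := exists_norm_le_of_uniformContinuousOn (hu 1 a1) (h0 1 a1)
  obtain ⟨M₂, hM₂⟩ := exists_norm_le_of_uniformContinuousOn (hu _ a2) (h0 _ a2)
  have hor : ∀ σ : ℝ, |σ| = 1 → σ = 1 ∨ σ = -1 := fun σ h => (abs_eq one_pos.le).1 h
  have hM : ∀ σ : ℝ, |σ| = 1 → ∀ z ∈ side f σ, ‖G σ z‖ ≤ max M₁ M₂ := fun σ h z hz => by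
    rcases hor σ h with rfl | rfl
    · exact (hM₁ z hz).trans (le_max_left _ _)
    · exact (hM₂ z hz).trans (le_max_right _ _)
  have heq := fun (z w : ℂ) (hz : z ∈ side f 1) (hw : w ∈ side f (-1)) => hf.eq_of_mem_side hG hM
    (fun σ h s => (hg σ h s).comp (tendsto_shiftPt h s)) hz hw
  rcases hor σ hσ with rfl | rfl
  · refine tendsto_nhds_unique (tendsto_const_nhds.congr' ?_)
      ((h0 _ a2).comp (tendsto_shiftPt_cobounded (f := f) a2 0))
    filter_upwards [eventually_gt_atTop 0] with t ht using heq z _ hz (shiftPt_mem_side a2 ht 0)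
  · refine tendsto_nhds_unique (tendsto_const_nhds.congr' ?_)
      ((h0 _ a1).comp (tendsto_shiftPt_cobounded (f := f) a1 0))
    filter_upwards [eventually_gt_atTop 0] with t ht using
      (heq _ z (shiftPt_mem_side a1 ht 0) hz).symm

/-! ### Uniqueness -/

/-- The part of the transmission problem that concerns only one of the two regions. -/
structure IsHarmonicUC1 (u : Plane → ℝ) (Ω : Set Plane) : Prop where
  contDiffOn : ContDiffOn ℝ 2 u Ω
  memUC1 : MemUC1 u Ω
  laplacian : ∀ p ∈ Ω, Laplacian.laplacian u p = 0
  gradient : Tendsto (∇ u) (Bornology.cobounded Plane ⊓ 𝓟 Ω) (𝓝 0)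

theorem isSolution_iff {Up Um : Plane → ℝ} : IsSolution f φ Up Um ↔
    (IsHarmonicUC1 Up (OmegaPlus f) ∧ IsHarmonicUC1 Um (OmegaMinus f)) ∧
    (∀ x, HasJump f Up Um x 0) ∧
    ∀ x, HasJump f (fun p => ⟪∇ Up p, normal f x⟫_ℝ) (fun p => ⟪∇ Um p, normal f x⟫_ℝ) x
      ((√(1 + deriv f x ^ 2))⁻¹ * deriv φ x) :=
  ⟨fun h => ⟨⟨⟨h.1, h.3, h.5, h.9⟩, ⟨h.2, h.4, h.6, h.10⟩⟩, h.7, h.8⟩,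
    fun ⟨⟨h1, h2⟩, h3, h4⟩ => ⟨h1.1, h2.1, h1.2, h2.2, h1.3, h2.3, h3, h4, h1.4, h2.4⟩⟩

theorem uniformContinuousOn_sub {E : Type*} [NormedAddCommGroup E] {u v : Plane → E}
    {Ω : Set Plane} (hu : UniformContinuousOn u Ω) (hv : UniformContinuousOn v Ω) :
    UniformContinuousOn (u - v) Ω :=
  uniformContinuousOn_iff_restrict.2
    ((uniformContinuousOn_iff_restrict.1 hu).sub (uniformContinuousOn_iff_restrict.1 hv))

theorem gradient_sub {u v : Plane → ℝ} {p : Plane} (hu : DifferentiableAt ℝ u p)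
    (hv : DifferentiableAt ℝ v p) : ∇ (u - v) p = ∇ u p - ∇ v p := by
  simp [gradient, fderiv_sub hu hv]

section Side

variable {Ω : Set Plane} {u v : Plane → ℝ}

theorem IsHarmonicUC1.differentiableAt (hu : IsHarmonicUC1 u Ω) (hΩ : IsOpen Ω) {p : Plane}
    (hp : p ∈ Ω) : DifferentiableAt ℝ u p :=
  (hu.contDiffOn.contDiffAt (hΩ.mem_nhds hp)).differentiableAt two_ne_zero

theorem IsHarmonicUC1.gradient_sub (hu : IsHarmonicUC1 u Ω) (hv : IsHarmonicUC1 v Ω)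
    (hΩ : IsOpen Ω) : Set.EqOn (∇ (u - v)) (∇ u - ∇ v) Ω := fun _ hp =>
  MullinsSekerka.gradient_sub (hu.differentiableAt hΩ hp) (hv.differentiableAt hΩ hp)

theorem IsHarmonicUC1.sub (hu : IsHarmonicUC1 u Ω) (hv : IsHarmonicUC1 v Ω) (hΩ : IsOpen Ω) :
    IsHarmonicUC1 (u - v) Ω where
  contDiffOn := hu.contDiffOn.sub hv.contDiffOn
  memUC1 := ⟨hu.memUC1.contDiffOn.sub hv.memUC1.contDiffOn,
    uniformContinuousOn_sub hu.memUC1.uniformContinuousOn hv.memUC1.uniformContinuousOn,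
    (uniformContinuousOn_sub hu.memUC1.uniformContinuousOn_gradient
      hv.memUC1.uniformContinuousOn_gradient).congr (hu.gradient_sub hv hΩ).symm⟩
  laplacian p hp := by
    have h := (hu.contDiffOn.contDiffAt (hΩ.mem_nhds hp)).laplacian_sub
      (hv.contDiffOn.contDiffAt (hΩ.mem_nhds hp))
    rw [h, hu.laplacian p hp, hv.laplacian p hp, sub_zero]
  gradient := by
    have h := hu.gradient.sub hv.gradient
    rw [sub_zero] at h
    refine h.congr' ?_
    filter_upwards [mem_inf_of_right (mem_principal_self _)] with p hp
      using (hu.gradient_sub hv hΩ hp).symm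

theorem gradient_eqOn_of_eqOn_add_const (hΩ : IsOpen Ω) {c : ℝ} (h : ∀ p ∈ Ω, v p = u p + c) :
    Set.EqOn (∇ v) (∇ u) Ω := fun p hp => by
  have h1 : v =ᶠ[𝓝 p] fun p => u p + c := by
    filter_upwards [hΩ.mem_nhds hp] with q hq using h q hq
  rw [h1.gradient_eq]
  simp [gradient, fderiv_add_const]

theorem IsHarmonicUC1.of_eqOn_add_const (hu : IsHarmonicUC1 u Ω) (hΩ : IsOpen Ω) {c : ℝ}
    (h : ∀ p ∈ Ω, v p = u p + c) : IsHarmonicUC1 v Ω where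
  contDiffOn := (hu.contDiffOn.add contDiffOn_const).congr h
  memUC1 := ⟨(hu.memUC1.contDiffOn.add contDiffOn_const).congr h,
    ((uniformContinuous_id.add uniformContinuous_const).comp_uniformContinuousOn
      hu.memUC1.uniformContinuousOn).congr fun p hp => (h p hp).symm,
    hu.memUC1.uniformContinuousOn_gradient.congr (gradient_eqOn_of_eqOn_add_const hΩ h).symm⟩
  laplacian p hp := by
    have h1 : v =ᶠ[𝓝 p] u + fun _ => c := by
      filter_upwards [hΩ.mem_nhds hp] with q hq using h q hq
    rw [(InnerProductSpace.laplacian_congr_nhds h1).eq_of_nhds,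
      (hu.contDiffOn.contDiffAt (hΩ.mem_nhds hp)).laplacian_add contDiffAt_const,
      hu.laplacian p hp, zero_add, InnerProductSpace.laplacian_const]
    rfl
  gradient := by
    refine hu.gradient.congr' ?_
    filter_upwards [mem_inf_of_right (mem_principal_self _)] with p hp
      using (gradient_eqOn_of_eqOn_add_const hΩ h hp).symm

end Side

/-- The function `∂ₓu - i ∂ᵧu` in the complex variable, which is holomorphic where `u` is
harmonic. -/
def complexGradient (u : Plane → ℝ) (z : ℂ) : ℂ :=
  starRingEnd ℂ (toPlane.symm (∇ u (toPlane z)))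

theorem inner_gradient_toPlane (u : Plane → ℝ) (z v : ℂ) :
    ⟪∇ u (toPlane z), toPlane v⟫_ℝ = (v * complexGradient u z).re := by
  conv_lhs => rw [← toPlane.apply_symm_apply (∇ u (toPlane z))]
  rw [toPlane.inner_map_map, Complex.inner, complexGradient, mul_comm v, mul_comm]

theorem hasDerivAt_comp_toPlane {u : Plane → ℝ} {c : ℝ → ℂ} {v : ℂ} {t : ℝ}
    (hu : DifferentiableAt ℝ u (toPlane (c t))) (hc : HasDerivAt c v t) :
    HasDerivAt (fun t => u (toPlane (c t))) (v * complexGradient u (c t)).re t := by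
  have h1 : HasDerivAt (fun t => toPlane (c t)) (toPlane v) t :=
    toPlane.toContinuousLinearEquiv.toContinuousLinearMap.hasFDerivAt.comp_hasDerivAt t hc
  have h2 := hu.hasFDerivAt.comp_hasDerivAt t h1
  rw [← inner_gradient_toPlane, inner_gradient_left]
  exact h2

theorem mem_sidePlane_toPlane {z : ℂ} : toPlane z ∈ sidePlane f σ ↔ z ∈ side f σ := by
  rw [sidePlane, Set.mem_preimage, toPlane.symm_apply_apply]

theorem IsHarmonicUC1.differentiableOn_complexGradient (hf : HolderC1 C f) {u : Plane → ℝ}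
    (hu : IsHarmonicUC1 u (sidePlane f σ)) :
    DifferentiableOn ℂ (complexGradient u) (side f σ) := by
  intro z hz
  have hopen := isOpen_sidePlane (σ := σ) hf
  have hharm : InnerProductSpace.HarmonicAt (u ∘ toPlane) z := by
    refine ⟨?_, ?_⟩
    · exact (hu.contDiffOn.contDiffAt (hopen.mem_nhds (mem_sidePlane_toPlane.2 hz))).comp z
        toPlane.toContinuousLinearEquiv.contDiff.contDiffAt
    · filter_upwards [hf.isOpen_side.mem_nhds hz] with w hw
      rw [laplacian_comp_toPlane]
      exact hu.laplacian _ (mem_sidePlane_toPlane.2 hw)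
  refine DifferentiableAt.differentiableWithinAt
    ((HarmonicAt.differentiableAt_complex_partial hharm).congr_of_eventuallyEq ?_)
  filter_upwards [hf.isOpen_side.mem_nhds hz] with w hw
  have hd := hu.differentiableAt hopen (mem_sidePlane_toPlane.2 hw)
  have h1 : ∀ v, fderiv ℝ (u ∘ toPlane) w v = (v * complexGradient u w).re := fun v => by
    rw [← inner_gradient_toPlane, inner_gradient_left]
    have := hd.hasFDerivAt.comp w (toPlane.toContinuousLinearEquiv.hasFDerivAt (x := w))
    exact congrArg (fun L => L v) this.fderiv
  rw [h1, h1]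
  apply Complex.ext <;> simp

theorem IsHarmonicUC1.uniformContinuousOn_complexGradient {u : Plane → ℝ}
    (hu : IsHarmonicUC1 u (sidePlane f σ)) :
    UniformContinuousOn (complexGradient u) (side f σ) :=
  (Complex.isometry_conj.uniformContinuous.comp
    toPlane.symm.isometry.uniformContinuous).comp_uniformContinuousOn
    (hu.memUC1.uniformContinuousOn_gradient.comp
      toPlane.isometry.uniformContinuous.uniformContinuousOn
      fun _ hz => mem_sidePlane_toPlane.2 hz)

theorem IsHarmonicUC1.tendsto_complexGradient {u : Plane → ℝ}
    (hu : IsHarmonicUC1 u (sidePlane f σ)) :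
    Tendsto (complexGradient u) (Bornology.cobounded ℂ ⊓ 𝓟 (side f σ)) (𝓝 0) := by
  have h := (Complex.continuous_conj.comp toPlane.symm.continuous).tendsto 0
  simp only [Function.comp_apply, map_zero] at h
  exact h.comp (hu.gradient.comp tendsto_toPlane_cobounded)

/-- The boundary values of a function on one side of the graph are differentiable along the graph,
and their derivative is the tangential part of the boundary values of the gradient. -/
theorem IsHarmonicUC1.hasDerivAt_boundary (hf : HolderC1 C f) (hσ : |σ| = 1) {u : Plane → ℝ}
    (hu : IsHarmonicUC1 u (sidePlane f σ)) {a : ℝ → ℂ} {b : ℝ → ℝ}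
    (ha : ∀ x, Tendsto (complexGradient u) (𝓝[side f σ] (curve f x)) (𝓝 (a x)))
    (hb : ∀ x, Tendsto u (𝓝[sidePlane f σ] (Xi f x)) (𝓝 (b x))) (x : ℝ) :
    HasDerivAt b (tangent f x * a x).re x := by
  refine hasDerivAt_of_tendstoUniformly (l := 𝓝[>] (0 : ℝ))
    (f := fun t x => u (toPlane (shiftPt f σ x t)))
    (f' := fun t x => (tangent f x * complexGradient u (shiftPt f σ x t)).re)
    (g' := fun x => (tangent f x * a x).re) ?_ ?_ (fun x => ?_) x
  · rw [Metric.tendstoUniformly_iff]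
    intro ε hε
    have hC := hf.nonneg
    obtain ⟨δ, hδ, hδε⟩ := Metric.uniformContinuousOn_iff_le.1
      hu.uniformContinuousOn_complexGradient (ε / (2 * (1 + C))) (by positivity)
    filter_upwards [Ioo_mem_nhdsGT hδ] with t ht x
    have h1 : ‖a x - complexGradient u (shiftPt f σ x t)‖ ≤ ε / (2 * (1 + C)) := by
      refine le_of_tendsto (((ha x).comp (tendsto_shiftPt hσ x)).sub_const _).norm ?_
      filter_upwards [Ioo_mem_nhdsGT hδ] with r hr
      rw [Function.comp_apply, ← dist_eq_norm]
      refine hδε _ (shiftPt_mem_side hσ hr.1 x) _ (shiftPt_mem_side hσ ht.1 x) ?_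
      rw [dist_eq_norm, shiftPt_eq, shiftPt_eq, add_sub_add_left_eq_sub, ← sub_mul, norm_mul,
        norm_sigma_mul_I hσ, mul_one, ← Complex.ofReal_sub, Complex.norm_real, Real.norm_eq_abs,
        abs_le]
      exact ⟨by linarith [hr.1, ht.2], by linarith [hr.2, ht.1]⟩
    rw [Real.dist_eq, ← Complex.sub_re, ← mul_sub]
    refine (Complex.abs_re_le_norm _).trans_lt ?_
    rw [norm_mul]
    calc _ ≤ (1 + C) * (ε / (2 * (1 + C))) := by gcongr; exact hf.norm_tangent_le x
      _ = ε / 2 := by field_simp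
      _ < ε := half_lt_self hε
  · filter_upwards [self_mem_nhdsWithin] with t ht x
    exact hasDerivAt_comp_toPlane (hu.differentiableAt (isOpen_sidePlane hf)
      (mem_sidePlane_toPlane.2 (shiftPt_mem_side hσ ht x))) (hf.hasDerivAt_shiftPt_left x t)
  · exact (hb x).comp ((tendsto_toPlane_nhdsWithin x).comp (tendsto_shiftPt hσ x))

/-- A function with vanishing gradient on one side of the graph is constant along vertical
half-lines, and equal there to its boundary value. -/
theorem IsHarmonicUC1.eq_of_complexGradient_eq_zero (hf : HolderC1 C f) (hσ : |σ| = 1)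
    {u : Plane → ℝ} (hu : IsHarmonicUC1 u (sidePlane f σ))
    (h0 : ∀ z ∈ side f σ, complexGradient u z = 0) {x b : ℝ}
    (hb : Tendsto u (𝓝[sidePlane f σ] (Xi f x)) (𝓝 b)) {t : ℝ} (ht : 0 < t) :
    u (toPlane (shiftPt f σ x t)) = b := by
  have hd : ∀ r, 0 < r → HasDerivAt (fun r => u (toPlane (shiftPt f σ x r))) 0 r := fun r hr => by
    have hm := shiftPt_mem_side (f := f) hσ hr x
    have := hasDerivAt_comp_toPlane (hu.differentiableAt (isOpen_sidePlane hf)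
      (mem_sidePlane_toPlane.2 hm)) (hasDerivAt_shiftPt_right (f := f) (σ := σ) x r)
    rwa [h0 _ hm, mul_zero, Complex.zero_re] at this
  have hconst : ∀ r, 0 < r → u (toPlane (shiftPt f σ x r)) = u (toPlane (shiftPt f σ x t)) :=
    fun r hr => IsOpen.is_const_of_deriv_eq_zero isOpen_Ioi isPreconnected_Ioi
      (fun y hy => (hd y hy).differentiableAt.differentiableWithinAt) (fun y hy => (hd y hy).deriv)
      hr ht
  refine tendsto_nhds_unique (tendsto_const_nhds.congr' ?_)
    (hb.comp ((tendsto_toPlane_nhdsWithin x).comp (tendsto_shiftPt hσ x)))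
  filter_upwards [self_mem_nhdsWithin] with r hr using (hconst r hr).symm

theorem eqOn_sidePlane_of_forall_shiftPt (hσ : |σ| = 1) {u : Plane → ℝ} {c : ℝ}
    (h : ∀ x t, 0 < t → u (toPlane (shiftPt f σ x t)) = c) : ∀ p ∈ sidePlane f σ, u p = c :=
  fun p hp => by
  have := h (toPlane.symm p).re (height f σ (toPlane.symm p)) hp
  rwa [shiftPt_height hσ, toPlane.apply_symm_apply] at this

/-- The homogeneous transmission problem has only constant solutions. The solution is given by `u 1`
above and by `u (-1)` below the graph. -/
theorem exists_const_of_hasJump_zero (hf : HolderC1 C f) {u : ℝ → Plane → ℝ}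
    (hu : ∀ σ : ℝ, |σ| = 1 → IsHarmonicUC1 (u σ) (sidePlane f σ))
    (hj : ∀ x, HasJump f (u 1) (u (-1)) x 0)
    (hn : ∀ x, HasJump f (fun p => ⟪∇ (u 1) p, normal f x⟫_ℝ)
      (fun p => ⟪∇ (u (-1)) p, normal f x⟫_ℝ) x 0) :
    ∃ c, ∀ σ : ℝ, |σ| = 1 → ∀ p ∈ sidePlane f σ, u σ p = c := by
  have a1 : |(1 : ℝ)| = 1 := by simp
  have a2 : |(-1 : ℝ)| = 1 := by simp
  have hor : ∀ σ : ℝ, |σ| = 1 → σ = 1 ∨ σ = -1 := fun σ h => (abs_eq one_pos.le).1 h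
  simp only [HasJump, OmegaPlus_eq, OmegaMinus_eq, sub_eq_zero] at hj hn
  choose b b' hb hb' hbb using hj
  obtain rfl : b = b' := funext hbb
  choose a ha using exists_tendsto_of_uniformContinuousOn (f := f) a1
    (hu 1 a1).uniformContinuousOn_complexGradient
  choose a' ha' using exists_tendsto_of_uniformContinuousOn (f := f) a2
    (hu _ a2).uniformContinuousOn_complexGradient
  have hder := (hu 1 a1).hasDerivAt_boundary hf a1 ha hb
  -- `a` and `a'` are the boundary values of the complex gradient from the two sides; the real and the
  -- imaginary part of `γ' a` are its tangential and, up to a factor, its normal component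
  have htan : ∀ x, (tangent f x * a x).re = (tangent f x * a' x).re := fun x =>
    (hder x).unique ((hu _ a2).hasDerivAt_boundary hf a2 ha' hb' x)
  have hnor : ∀ x, (tangent f x * a x).im = (tangent f x * a' x).im := fun x => by
    obtain ⟨d, d', hd, hd', rfl⟩ := hn x
    set k : ℝ := (√(1 + deriv f x ^ 2))⁻¹ with hk
    have hk0 : k ≠ 0 := by rw [hk]; positivity
    have key : ∀ {σ d : ℝ} {c : ℂ} {w : Plane → ℝ}, |σ| = 1 →
        Tendsto (complexGradient w) (𝓝[side f σ] (curve f x)) (𝓝 c) →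
        Tendsto (fun p => ⟪∇ w p, normal f x⟫_ℝ) (𝓝[sidePlane f σ] (Xi f x)) (𝓝 d) →
        d = -k * (tangent f x * c).im := fun {σ d c w} hσ hc hd => by
      have := neBot_nhdsWithin_side (f := f) hσ x
      have h1 := hd.comp (tendsto_toPlane_nhdsWithin x)
      have h2 := (Complex.continuous_re.tendsto _).comp (hc.const_mul (k * (Complex.I * tangent f x)))
      refine (tendsto_nhds_unique h1 (h2.congr fun z => ?_)).trans ?_
      · simp only [Function.comp_apply]
        rw [normal_eq, inner_gradient_toPlane]
      · rw [mul_assoc, Complex.re_ofReal_mul, mul_assoc, Complex.I_mul_re]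
        ring
    have h1 := key a1 (ha x) hd
    have h2 := key a2 (ha' x) hd'
    rw [h1] at h2
    exact mul_left_cancel₀ (neg_ne_zero.2 hk0) h2
  have haa : ∀ x, a' x = a x := fun x =>
    (mul_left_cancel₀ (tangent_ne_zero f x) (Complex.ext (htan x) (hnor x))).symm
  have hzero : ∀ σ : ℝ, |σ| = 1 → ∀ z ∈ side f σ, complexGradient (u σ) z = 0 := fun σ hσ z hz =>
    hf.eq_zero_of_mem_side (G := fun σ => complexGradient (u σ)) (g := a)
      (fun σ h => (hu σ h).differentiableOn_complexGradient hf)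
      (fun σ h => (hu σ h).uniformContinuousOn_complexGradient)
      (fun σ h => (hu σ h).tendsto_complexGradient) (fun σ h x => by
        rcases hor σ h with rfl | rfl
        · exact ha x
        · rw [← haa x]; exact ha' x) hσ hz
  have ha0 : ∀ x, a x = 0 := fun x => by
    have := neBot_nhdsWithin_side (f := f) a1 x
    refine tendsto_nhds_unique (ha x) (tendsto_const_nhds.congr' ?_)
    filter_upwards [self_mem_nhdsWithin] with z hz using (hzero 1 a1 z hz).symm
  have hbc : ∀ x, b x = b 0 := fun x =>
    is_const_of_deriv_eq_zero (fun x => (hder x).differentiableAt)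
      (fun x => by rw [(hder x).deriv, ha0, mul_zero, Complex.zero_re]) x 0
  refine ⟨b 0, fun σ hσ => eqOn_sidePlane_of_forall_shiftPt hσ fun x t ht => ?_⟩
  rw [← hbc x]
  refine (hu σ hσ).eq_of_complexGradient_eq_zero hf hσ (hzero σ hσ) ?_ ht
  rcases hor σ hσ with rfl | rfl
  · exact hb x
  · exact hb' x

theorem HasJump.sub {wp wm vp vm : Plane → ℝ} {x i j : ℝ} (h : HasJump f wp wm x i)
    (h' : HasJump f vp vm x j) : HasJump f (wp - vp) (wm - vm) x (i - j) := by
  obtain ⟨a, b, ha, hb, rfl⟩ := h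
  obtain ⟨a', b', ha', hb', rfl⟩ := h'
  exact ⟨a - a', b - b', ha.sub ha', hb.sub hb', by ring⟩

theorem HasJump.congr {wp wm vp vm : Plane → ℝ} {x j : ℝ} (h : HasJump f wp wm x j)
    (hp : Set.EqOn wp vp (OmegaPlus f)) (hm : Set.EqOn wm vm (OmegaMinus f)) :
    HasJump f vp vm x j := by
  obtain ⟨a, b, ha, hb, e⟩ := h
  exact ⟨a, b, ha.congr' (hp.eventuallyEq_of_mem self_mem_nhdsWithin),
    hb.congr' (hm.eventuallyEq_of_mem self_mem_nhdsWithin), e⟩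

theorem isOpen_OmegaPlus (hf : HolderC1 C f) : IsOpen (OmegaPlus f) := by
  rw [OmegaPlus_eq]; exact isOpen_sidePlane hf

theorem isOpen_OmegaMinus (hf : HolderC1 C f) : IsOpen (OmegaMinus f) := by
  rw [OmegaMinus_eq]; exact isOpen_sidePlane hf

theorem IsSolution.exists_const (hf : HolderC1 C f) {Up Um Vp Vm : Plane → ℝ}
    (hU : IsSolution f φ Up Um) (hV : IsSolution f φ Vp Vm) :
    ∃ c : ℝ, (∀ p ∈ OmegaPlus f, Vp p = Up p + c) ∧ ∀ p ∈ OmegaMinus f, Vm p = Um p + c := by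
  obtain ⟨⟨u1, u2⟩, u3, u4⟩ := isSolution_iff.1 hU
  obtain ⟨⟨v1, v2⟩, v3, v4⟩ := isSolution_iff.1 hV
  have hne : (-1 : ℝ) ≠ 1 := by norm_num
  have hn : ∀ x, HasJump f (fun p => ⟪∇ (Vp - Up) p, normal f x⟫_ℝ)
      (fun p => ⟪∇ (Vm - Um) p, normal f x⟫_ℝ) x 0 := fun x => by
    have h := (v4 x).sub (u4 x)
    rw [sub_self] at h
    refine h.congr (fun p hp => ?_) fun p hp => ?_
    · simp only [Pi.sub_apply, v1.gradient_sub u1 (isOpen_OmegaPlus hf) hp, inner_sub_left]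
    · simp only [Pi.sub_apply, v2.gradient_sub u2 (isOpen_OmegaMinus hf) hp, inner_sub_left]
  obtain ⟨c, hc⟩ := exists_const_of_hasJump_zero hf
    (u := fun σ => if σ = 1 then Vp - Up else Vm - Um)
    (fun σ hσ => by
      rcases (abs_eq one_pos.le).1 hσ with rfl | rfl
      · simpa only [if_true, OmegaPlus_eq] using v1.sub u1 (isOpen_OmegaPlus hf)
      · simpa only [if_neg hne, OmegaMinus_eq] using v2.sub u2 (isOpen_OmegaMinus hf))
    (fun x => by simpa only [if_true, if_neg hne, sub_self] using (v3 x).sub (u3 x))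
    (fun x => by simpa only [if_true, if_neg hne] using hn x)
  refine ⟨c, fun p hp => ?_, fun p hp => ?_⟩
  · have := hc 1 (by simp) p (by rwa [← OmegaPlus_eq])
    rw [if_pos rfl, Pi.sub_apply] at this
    linarith
  · have := hc (-1) (by simp) p (by rwa [← OmegaMinus_eq])
    rw [if_neg hne, Pi.sub_apply] at this
    linarith

theorem IsSolution.of_eqOn_add_const (hf : HolderC1 C f) {Up Um Vp Vm : Plane → ℝ}
    (hU : IsSolution f φ Up Um) {c : ℝ} (hp : ∀ p ∈ OmegaPlus f, Vp p = Up p + c)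
    (hm : ∀ p ∈ OmegaMinus f, Vm p = Um p + c) : IsSolution f φ Vp Vm := by
  obtain ⟨⟨u1, u2⟩, u3, u4⟩ := isSolution_iff.1 hU
  refine isSolution_iff.2 ⟨⟨u1.of_eqOn_add_const (isOpen_OmegaPlus hf) hp,
    u2.of_eqOn_add_const (isOpen_OmegaMinus hf) hm⟩, fun x => ?_, fun x => ?_⟩
  · obtain ⟨a, b, ha, hb, e⟩ := u3 x
    refine HasJump.congr (wp := fun p => Up p + c) (wm := fun p => Um p + c)
      ⟨a + c, b + c, ha.add_const c, hb.add_const c, ?_⟩ (fun p h => (hp p h).symm)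
      fun p h => (hm p h).symm
    rw [add_sub_add_right_eq_sub, e]
  · refine (u4 x).congr (fun p h => ?_) fun p h => ?_
    · simp only [gradient_eqOn_of_eqOn_add_const (isOpen_OmegaPlus hf) hp h]
    · simp only [gradient_eqOn_of_eqOn_add_const (isOpen_OmegaMinus hf) hm h]

end MullinsSekerka

end

theorem proposition2p3 (f φ : ℝ → ℝ)
    (hf : Continuous f) (hf3 : MullinsSekerka.MemH 3 f)
    (hφ : Continuous φ) (hφ2 : MullinsSekerka.MemH 2 φ) :
    (∀ p : MullinsSekerka.Plane, p ∉ MullinsSekerka.Gamma f →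
      Integrable (MullinsSekerka.potentialIntegrand f φ p)) ∧
    MullinsSekerka.IsSolution f φ
      (MullinsSekerka.potential f φ) (MullinsSekerka.potential f φ) ∧
    ∀ Vp Vm : MullinsSekerka.Plane → ℝ,
      MullinsSekerka.IsSolution f φ Vp Vm ↔
        ∃ c : ℝ,
          (∀ p ∈ MullinsSekerka.OmegaPlus f, Vp p = MullinsSekerka.potential f φ p + c) ∧
          (∀ p ∈ MullinsSekerka.OmegaMinus f, Vm p = MullinsSekerka.potential f φ p + c) := by
  have hf2 : MullinsSekerka.MemH 2 f := ⟨hf3.choose, hf3.choose_spec.mono (by norm_num)⟩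
  obtain ⟨C, hfC⟩ := hf2.exists_holderC1 hf
  obtain ⟨B, hφB⟩ := hφ2.exists_holderC1 hφ
  have hL : MemLp φ 2 volume := by simpa using hφ2.choose.re
  have hU := MullinsSekerka.isSolution_potential hfC hφB hL
  exact ⟨fun p hp => MullinsSekerka.integrable_potentialIntegrand hfC hL
      (MullinsSekerka.vdist_pos_of_notMem_Gamma hp), hU,
    fun Vp Vm => ⟨fun hV => hU.exists_const hfC hV,
      fun ⟨_, h1, h2⟩ => hU.of_eqOn_add_const hfC h1 h2⟩⟩
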